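/- There is a deterministic algorithm that, given any tournament $T$ (a loopless directed graph with exactly one arc between any two distinct vertices) on $n$ vertices by its adjacency matrix, finds a minimum feedback vertex set of $T$, i.e. a set of vertices of minimum cardinality whose deletion leaves no directed cycle. The algorithm runs in time $O(1.6740^n)$ and uses space polynomial in $n$. (Time and space are measured on a random access machine under the logarithmic cost criterion, in which operations and storage are charged by the binary lengths of the numbers and addresses involved; in particular the space bound is in bits.) -/

import Mathlib

/-! ### Tournaments and feedback vertex sets -/

/-- A tournament: a loopless directed graph with exactly one arc between any two distinct
vertices. `T.Adj u v` means that there is an arc from `u` to `v`. -/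
structure Tournament (V : Type*) extends Digraph V where
  loopless : ∀ v, ¬ Adj v v
  exactly_one : ∀ u v, u ≠ v → Xor (Adj u v) (Adj v u)

namespace Tournament

/-- The induced subtournament `T[W]` has no directed cycle, that is, no vertex reaches itself by
a nonempty directed walk all of whose vertices lie in `W`. -/
def AcyclicOn {V : Type*} (T : Tournament V) (W : Set V) : Prop :=
  ∀ v, ¬ Relation.TransGen (fun a b => a ∈ W ∧ b ∈ W ∧ T.Adj a b) v v

/-- `F` is a feedback vertex set: deleting `F` makes the tournament acyclic. -/
def IsFVS {V : Type*} (T : Tournament V) (F : Finset V) : Prop :=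
  T.AcyclicOn {v | v ∉ F}

/-- `F` is a feedback vertex set with the minimum number of vertices. -/
def IsMinimumFVS {V : Type*} (T : Tournament V) (F : Finset V) : Prop :=
  T.IsFVS F ∧ ∀ F' : Finset V, T.IsFVS F' → F.card ≤ F'.card

end Tournament

/-! ### Random access machines with logarithmic cost

A program works on registers, addressed directly, and on a memory, addressed indirectly through
registers. Both hold natural numbers and all but finitely many of their cells are `0`. A program
is a fixed finite text, built from the machine instructions by sequencing, branching and loops.
Both time and space are charged by the lengths of the binary representations of the numbers that
occur (`Nat.size x` is the number of binary digits of `x`). -/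

namespace RAM

/-- The contents of the registers and of the memory. -/
structure State where
  reg : ℕ →₀ ℕ
  mem : ℕ →₀ ℕ

/-- The number of bits that are in use: the total length of the addresses and of the contents of
all registers and memory cells that are not `0`. -/
def State.space (s : State) : ℕ :=
  (s.reg.sum fun a x => Nat.size a + Nat.size x) + s.mem.sum fun a x => Nat.size a + Nat.size x

/-- The machine instructions; the arguments `i j k` are numbers of registers, `x` is a constant.
* `const i x`: `rᵢ := x`
* `add i j k`: `rᵢ := rⱼ + rₖ`
* `sub i j k`: `rᵢ := max (rⱼ - rₖ) 0`
* `mul i j k`: `rᵢ := rⱼ * rₖ`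
* `load i j`: `rᵢ := mem[rⱼ]`
* `store i j`: `mem[rᵢ] := rⱼ` -/
inductive Instr where
  | const (i x : ℕ)
  | add (i j k : ℕ)
  | sub (i j k : ℕ)
  | mul (i j k : ℕ)
  | load (i j : ℕ)
  | store (i j : ℕ)

/-- The effect of an instruction. -/
noncomputable def Instr.apply : Instr → State → State
  | .const i x, s => { s with reg := s.reg.update i x }
  | .add i j k, s => { s with reg := s.reg.update i (s.reg j + s.reg k) }
  | .sub i j k, s => { s with reg := s.reg.update i (s.reg j - s.reg k) }
  | .mul i j k, s => { s with reg := s.reg.update i (s.reg j * s.reg k) }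
  | .load i j, s => { s with reg := s.reg.update i (s.mem (s.reg j)) }
  | .store i j, s => { s with mem := s.mem.update (s.reg i) (s.reg j) }

/-- The time that an instruction takes: one plus the lengths of the addresses and numbers it
handles; a multiplication is charged as much as the schoolbook method needs. -/
def Instr.cost : Instr → State → ℕ
  | .const _ x, _ => 1 + Nat.size x
  | .add _ j k, s => 1 + Nat.size (s.reg j) + Nat.size (s.reg k)
  | .sub _ j k, s => 1 + Nat.size (s.reg j) + Nat.size (s.reg k)
  | .mul _ j k, s => (1 + Nat.size (s.reg j)) * (1 + Nat.size (s.reg k))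
  | .load _ j, s => 1 + Nat.size (s.reg j) + Nat.size (s.mem (s.reg j))
  | .store i j, s => 1 + Nat.size (s.reg i) + Nat.size (s.reg j)

/-- The tests for branches and loops: comparisons of two registers. -/
inductive Test where
  | lt (i j : ℕ)
  | eq (i j : ℕ)

/-- The test succeeds in the state `s`. -/
def Test.Holds : Test → State → Prop
  | .lt i j, s => s.reg i < s.reg j
  | .eq i j, s => s.reg i = s.reg j

/-- The time that a test takes. -/
def Test.cost : Test → State → ℕ
  | .lt i j, s => 1 + Nat.size (s.reg i) + Nat.size (s.reg j)
  | .eq i j, s => 1 + Nat.size (s.reg i) + Nat.size (s.reg j)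

/-- Programs. -/
inductive Prog where
  | skip
  | instr (c : Instr)
  | seq (p q : Prog)
  | ite (b : Test) (p q : Prog)
  | loop (b : Test) (p : Prog)

/-- `Runs p s s' t m`: started in the state `s`, the program `p` halts in the state `s'`, the total
time of all the instructions and tests that it executes is `t`, and the maximum of `State.space`
over all the states that it goes through is `m`. Here `loop b p` repeats `p` while `b` holds. -/
inductive Runs : Prog → State → State → ℕ → ℕ → Prop where
  | skip (s : State) : Runs .skip s s 1 s.space
  | instr (c : Instr) (s : State) :
      Runs (.instr c) s (c.apply s) (c.cost s) (max s.space (c.apply s).space)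
  | seq {p q : Prog} {s s₁ s₂ : State} {t₁ t₂ m₁ m₂ : ℕ} :
      Runs p s s₁ t₁ m₁ → Runs q s₁ s₂ t₂ m₂ →
      Runs (.seq p q) s s₂ (t₁ + t₂) (max m₁ m₂)
  | ite_true {b : Test} {p q : Prog} {s s' : State} {t m : ℕ} :
      b.Holds s → Runs p s s' t m → Runs (.ite b p q) s s' (b.cost s + t) m
  | ite_false {b : Test} {p q : Prog} {s s' : State} {t m : ℕ} :
      ¬ b.Holds s → Runs q s s' t m → Runs (.ite b p q) s s' (b.cost s + t) m
  | loop_true {b : Test} {p : Prog} {s s₁ s₂ : State} {t₁ t₂ m₁ m₂ : ℕ} :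
      b.Holds s → Runs p s s₁ t₁ m₁ → Runs (.loop b p) s₁ s₂ t₂ m₂ →
      Runs (.loop b p) s s₂ (b.cost s + t₁ + t₂) (max m₁ m₂)
  | loop_false {b : Test} {p : Prog} {s : State} :
      ¬ b.Holds s → Runs (.loop b p) s s (b.cost s) s.space

open Classical in
/-- The input: register `0` holds the number `n` of vertices, all other registers hold `0`, and the
memory holds the adjacency matrix row by row: for vertices `i, j < n` the cell `i * n + j` is `1`
if there is an arc from `i` to `j`, and `0` otherwise. All other cells are `0`. -/
noncomputable def input {n : ℕ} (T : Tournament (Fin n)) : State where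
  reg := Finsupp.single 0 n
  mem := Finsupp.onFinset (Finset.range (n * n))
    (fun a => if ∃ i j : Fin n, a = i.val * n + j.val ∧ T.Adj i j then 1 else 0) (by
      intro a ha
      simp only [ne_eq, ite_eq_right_iff, one_ne_zero, imp_false, not_not] at ha
      obtain ⟨i, j, rfl, -⟩ := ha
      have hi := i.isLt
      have hj := j.isLt
      rw [Finset.mem_range]
      nlinarith)

/-- The output in the state `s` is the set `F` of vertices: the first `n` memory cells hold the
characteristic vector of `F`. -/
def Outputs {n : ℕ} (s : State) (F : Finset (Fin n)) : Prop :=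
  ∀ i : Fin n, s.mem i.val = if i ∈ F then 1 else 0

end RAM

/-! Deleting a set from a tournament leaves no directed cycle exactly if it leaves no directed
triangle, and the arcs then order the remaining vertices linearly. The task is therefore to find a
largest triangle-free vertex set `O`.

Fix such an `O` and let `M` be its every 256th vertex. Guess `M`, which has at most `n / 256`
elements, keep it, and leave all other vertices undecided. While some triangle `u → w → a → u` has
`a` kept and `u` undecided, act on it: if `w` is kept, `u` must go; if `w` is undecided, either
delete `u`, or keep `u` and delete `w`. The branches settle one and two vertices, so there are at
most Fibonacci many outcomes, and one of them agrees with `O`.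

When no such conflict is left, group the undecided vertices by the set of kept vertices to which
they have arcs. If `x → y` are undecided, the set of `y` is contained in that of `x`; around a
triangle all these sets coincide. Hence each surviving triangle lies in a single class and the
classes can be solved independently. A class meets `O` within one gap of `M`, thus in at most 255
vertices, and trying all subsets of at most 255 vertices is polynomial. The base of the running time
is the golden ratio times the small growth rate of the number of candidates for `M`; the product
stays below 1.6705, and the distance to 1.6740 absorbs the polynomial factors.

For polynomial space there is no recursion. Both the guess of `M` and the branching are decoded from
counters below `subCount n (n / 256)` and `Nat.fib (n + 1)`, and nested loops run through all
values. It suffices that some pair of counters leads to `O` (`exists_good`); the other pairs do no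
harm, because a result is recorded only after a test for triangles. The combinatorial core is
`exists_sparse_subset`, `exists_conflictAll`, `conflictFree_conflictAll`, `ConflictFree.triangle`
and `card_inter_cls_lt`.

The machine model is handled by a loop language with a verified compiler (`Cmd.comp_takes`) and a
program logic `Spec` that proves safety, cost and result together. -/

/-! ### A loop language and its compilation to random access machines -/

namespace LoopLang

open RAM

/-- Iterate `f 0`, `f 1`, …, `f (N - 1)`, in this order. -/
def iter {α : Type*} (f : ℕ → α → α) : ℕ → α → α
  | 0, a => a
  | N + 1, a => f N (iter f N a)

/-- Expressions over variables and arrays; `sub` is truncated. -/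
inductive Expr where
  | var (x : ℕ)
  | lit (c : ℕ)
  | add (e f : Expr)
  | sub (e f : Expr)
  | mul (e f : Expr)
  | arr (k : ℕ) (e : Expr)

/-- Commands; `loop x y c` runs `c` for `x = 0, …, y - 1`. -/
inductive Cmd where
  | skip
  | assign (x : ℕ) (e : Expr)
  | store (k : ℕ) (e f : Expr)
  | seq (c d : Cmd)
  | ite (e : Expr) (c d : Cmd)
  | loop (x y : ℕ) (c : Cmd)

/-- The values of the variables and of the arrays. -/
structure Store where
  v : ℕ → ℕ
  a : ℕ → ℕ → ℕ

def Store.setv (s : Store) (x m : ℕ) : Store := { s with v := Function.update s.v x m }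

def Store.seta (s : Store) (k i m : ℕ) : Store :=
  { s with a := Function.update s.a k (Function.update (s.a k) i m) }

@[simp] theorem Store.setv_v (s : Store) (x m y : ℕ) :
    (s.setv x m).v y = if y = x then m else s.v y := by
  simp [Store.setv, Function.update_apply]

@[simp] theorem Store.setv_a (s : Store) (x m : ℕ) : (s.setv x m).a = s.a := rfl

@[simp] theorem Store.seta_v (s : Store) (k i m : ℕ) : (s.seta k i m).v = s.v := rfl

@[simp] theorem Store.seta_a (s : Store) (k i m l j : ℕ) :
    (s.seta k i m).a l j = if l = k ∧ j = i then m else s.a l j := by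
  by_cases h : l = k
  · subst h; simp [Store.seta, Function.update_apply]
  · simp [Store.seta, h]

def Expr.eval (s : Store) : Expr → ℕ
  | .var x => s.v x
  | .lit c => c
  | .add e f => e.eval s + f.eval s
  | .sub e f => e.eval s - f.eval s
  | .mul e f => e.eval s * f.eval s
  | .arr k e => s.a k (e.eval s)

/-- A loop leaves its counter at the bound, which is where the compiled while-loop stops. -/
def Cmd.run : Cmd → Store → Store
  | .skip, s => s
  | .assign x e, s => s.setv x (e.eval s)
  | .store k e f, s => s.seta k (e.eval s) (f.eval s)
  | .seq c d, s => d.run (c.run s)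
  | .ite e c d, s => if e.eval s ≠ 0 then c.run s else d.run s
  | .loop x y c, s => (iter (fun i r => c.run (r.setv x i)) (s.v y) s).setv x (s.v y)

/-! #### Resource parameters for instances with `n` vertices -/

/-- The number of registers that hold variables. -/
abbrev varCount : ℕ := 40
/-- The number of registers that are used. -/
abbrev regCount : ℕ := 110
/-- The length of every array other than the adjacency matrix. -/
def arrLen (n : ℕ) : ℕ := (n + 1) * (n + 257)
/-- The length of the used part of the memory. -/
def memLen (n : ℕ) : ℕ := n * n + 6 * arrLen n
/-- The number of bits of the values of variables and array cells. -/
def bits (n : ℕ) : ℕ := 2 * n + 40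
/-- The number of bits of intermediate results. -/
def regBits (n : ℕ) : ℕ := bits n * 64
/-- A bound for the cost of a single instruction. -/
def unit (n : ℕ) : ℕ := (1 + regBits n) ^ 2
/-- A bound for the space. -/
def spaceBound (n : ℕ) : ℕ :=
  regCount * (regCount + regBits n) + memLen n * (memLen n + bits n)

/-- Cell `i` of array `k` is in the range of the array; array `0` is the adjacency matrix. -/
def Valid (n k i : ℕ) : Prop := (k = 0 ∧ i < n * n) ∨ (1 ≤ k ∧ k ≤ 6 ∧ i < arrLen n)

/-- The memory cell that holds cell `i` of array `k`. -/
def addr (n k i : ℕ) : ℕ := if k = 0 then i else n * n + 6 * i + (k - 1)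

theorem addr_lt {n k i : ℕ} (h : Valid n k i) : addr n k i < memLen n := by
  unfold addr memLen
  rcases h with ⟨rfl, h⟩ | ⟨h1, h2, h⟩
  · simp; omega
  · rw [if_neg (by omega)]; omega

/-- Behind the matrix the six arrays are interleaved with stride 6, so the residue of the address
determines the array. Array `0` sits at address `0`, as the input and output conventions demand. -/
theorem addr_inj {n k i l j : ℕ} (h : Valid n k i) (h' : Valid n l j)
    (e : addr n k i = addr n l j) : k = l ∧ i = j := by
  unfold addr at e
  rcases h with ⟨rfl, h⟩ | ⟨h1, h2, h⟩ <;> rcases h' with ⟨rfl, h'⟩ | ⟨h1', h2', h'⟩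
  · simpa using e
  · rw [if_pos rfl, if_neg (by omega)] at e; omega
  · rw [if_pos rfl, if_neg (by omega)] at e; omega
  · rw [if_neg (by omega), if_neg (by omega)] at e; omega

/-- The width `bits n` also covers all addresses, so that address arithmetic stays within the
register bound. -/
theorem memLen_lt (n : ℕ) : memLen n < 2 ^ bits n := by
  have h1 : n < 2 ^ n := Nat.lt_two_pow_self
  have h2 : n + 257 ≤ 2 ^ (n + 9) := by
    rw [pow_add]; have := Nat.one_le_two_pow (n := n); omega
  have h3 : (n + 257) * (n + 257) ≤ 2 ^ (n + 9) * 2 ^ (n + 9) := Nat.mul_le_mul h2 h2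
  have h4 : 2 ^ bits n = 2 ^ (n + 9) * 2 ^ (n + 9) * 2 ^ 22 := by
    rw [← pow_add, ← pow_add]; congr 1; unfold bits; omega
  have h5 : memLen n ≤ 7 * ((n + 257) * (n + 257)) := by
    unfold memLen arrLen; nlinarith
  rw [h4]
  nlinarith [Nat.one_le_two_pow (n := n + 9)]

theorem bits_le_regBits (n : ℕ) : bits n ≤ regBits n := by unfold regBits; omega

theorem lt_regBits {n m : ℕ} (h : m < 2 ^ bits n) : m < 2 ^ regBits n :=
  h.trans_le (Nat.pow_le_pow_right (by norm_num) (bits_le_regBits n))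

/-! #### Machine states within the resource bounds -/

structure Fits (n : ℕ) (σ : State) : Prop where
  reg_lt : ∀ i, σ.reg i < 2 ^ regBits n
  reg_zero : ∀ i, regCount ≤ i → σ.reg i = 0
  mem_lt : ∀ a, σ.mem a < 2 ^ bits n
  mem_zero : ∀ a, memLen n ≤ a → σ.mem a = 0

theorem sum_size_le (f : ℕ →₀ ℕ) (R B : ℕ) (h0 : ∀ i, R ≤ i → f i = 0) (h : ∀ i, f i < 2 ^ B) :
    (f.sum fun a x => Nat.size a + Nat.size x) ≤ R * (R + B) := by
  have hs : f.support ⊆ Finset.range R := by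
    intro i hi
    rw [Finset.mem_range]
    by_contra hR
    exact (Finsupp.mem_support_iff.mp hi) (h0 i (by omega))
  calc (f.sum fun a x => Nat.size a + Nat.size x)
      = ∑ a ∈ f.support, (Nat.size a + Nat.size (f a)) := rfl
    _ ≤ ∑ a ∈ f.support, (R + B) := by
        refine Finset.sum_le_sum fun a ha => ?_
        have h1 : Nat.size a ≤ R :=
          Nat.size_le.mpr ((Finset.mem_range.mp (hs ha)).trans Nat.lt_two_pow_self)
        have h2 : Nat.size (f a) ≤ B := Nat.size_le.mpr (h a)
        omega
    _ = f.support.card * (R + B) := by simp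
    _ ≤ R * (R + B) := by
        refine Nat.mul_le_mul_right _ ?_
        simpa using Finset.card_le_card hs

theorem Fits.space_le {n : ℕ} {σ : State} (h : Fits n σ) : σ.space ≤ spaceBound n :=
  Nat.add_le_add (sum_size_le _ _ _ h.reg_zero h.reg_lt) (sum_size_le _ _ _ h.mem_zero h.mem_lt)

theorem Fits.size_reg {n : ℕ} {σ : State} (h : Fits n σ) (i : ℕ) :
    Nat.size (σ.reg i) ≤ regBits n := Nat.size_le.mpr (h.reg_lt i)

theorem Fits.size_mem {n : ℕ} {σ : State} (h : Fits n σ) (i : ℕ) :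
    Nat.size (σ.mem i) ≤ regBits n := Nat.size_le.mpr (lt_regBits (h.mem_lt i))

theorem Fits.setReg {n : ℕ} {σ : State} (h : Fits n σ) {i x : ℕ} (hi : i < regCount)
    (hx : x < 2 ^ regBits n) : Fits n { σ with reg := σ.reg.update i x } where
  reg_lt j := by
    simp only [Finsupp.coe_update, Function.update_apply]
    split_ifs
    exacts [hx, h.reg_lt j]
  reg_zero j hj := by
    simp only [Finsupp.coe_update, Function.update_apply]
    rw [if_neg (by omega)]
    exact h.reg_zero j hj
  mem_lt := h.mem_lt
  mem_zero := h.mem_zero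

/-- `p` leads from `σ` to `σ'` in time at most `k` units and within the space bound. -/
def Takes (n : ℕ) (p : Prog) (σ σ' : State) (k : ℕ) : Prop :=
  ∃ t m, Runs p σ σ' t m ∧ t ≤ k * unit n ∧ m ≤ spaceBound n

theorem Takes.mono {n : ℕ} {p : Prog} {σ σ' : State} {k l : ℕ} (h : Takes n p σ σ' k)
    (hkl : k ≤ l) : Takes n p σ σ' l := by
  obtain ⟨t, m, h1, h2, h3⟩ := h
  exact ⟨t, m, h1, h2.trans (Nat.mul_le_mul_right _ hkl), h3⟩

theorem unit_pos (n : ℕ) : 1 ≤ unit n := Nat.one_le_pow _ _ (by omega)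

theorem le_unit {n t : ℕ} (h : t ≤ 1 + regBits n + regBits n) : t ≤ unit n := by
  unfold unit; nlinarith

theorem Takes.skip {n : ℕ} {σ : State} (h : Fits n σ) : Takes n .skip σ σ 1 :=
  ⟨_, _, .skip σ, by have := unit_pos n; omega, h.space_le⟩

theorem Takes.instr {n : ℕ} {σ : State} (c : Instr) (h : Fits n σ) (h' : Fits n (c.apply σ)) :
    Takes n (.instr c) σ (c.apply σ) 1 := by
  refine ⟨_, _, .instr c σ, ?_, max_le h.space_le h'.space_le⟩
  rw [one_mul]
  cases c with
  | const i x =>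
    refine le_unit ?_
    have := h'.size_reg i
    simp only [Instr.apply, Finsupp.coe_update, Function.update_self] at this
    simp only [Instr.cost]; omega
  | add i j k =>
    exact le_unit (by simp only [Instr.cost]; have := h.size_reg j; have := h.size_reg k; omega)
  | sub i j k =>
    exact le_unit (by simp only [Instr.cost]; have := h.size_reg j; have := h.size_reg k; omega)
  | mul i j k =>
    simp only [Instr.cost, unit, sq]
    exact Nat.mul_le_mul (by have := h.size_reg j; omega) (by have := h.size_reg k; omega)
  | load i j =>
    exact le_unit (by
      simp only [Instr.cost]; have := h.size_reg j; have := h.size_mem (σ.reg j); omega)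
  | store i j =>
    exact le_unit (by simp only [Instr.cost]; have := h.size_reg i; have := h.size_reg j; omega)

theorem Takes.seq {n : ℕ} {p q : Prog} {σ σ₁ σ₂ : State} {k l : ℕ} (h : Takes n p σ σ₁ k)
    (h' : Takes n q σ₁ σ₂ l) : Takes n (.seq p q) σ σ₂ (k + l) := by
  obtain ⟨t, m, h1, h2, h3⟩ := h
  obtain ⟨t', m', h1', h2', h3'⟩ := h'
  exact ⟨_, _, .seq h1 h1', by rw [add_mul]; omega, max_le h3 h3'⟩

theorem Fits.test_le {n : ℕ} {σ : State} (h : Fits n σ) (b : Test) : b.cost σ ≤ unit n := by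
  cases b with
  | lt i j =>
    exact le_unit (by simp only [Test.cost]; have := h.size_reg i; have := h.size_reg j; omega)
  | eq i j =>
    exact le_unit (by simp only [Test.cost]; have := h.size_reg i; have := h.size_reg j; omega)

theorem Takes.ite_true {n : ℕ} {b : Test} {p q : Prog} {σ σ' : State} {k : ℕ} (hf : Fits n σ)
    (hb : b.Holds σ) (h : Takes n p σ σ' k) : Takes n (.ite b p q) σ σ' (1 + k) := by
  obtain ⟨t, m, h1, h2, h3⟩ := h
  exact ⟨_, _, .ite_true hb h1, by have := hf.test_le b; rw [add_mul]; omega, h3⟩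

theorem Takes.ite_false {n : ℕ} {b : Test} {p q : Prog} {σ σ' : State} {k : ℕ} (hf : Fits n σ)
    (hb : ¬ b.Holds σ) (h : Takes n q σ σ' k) : Takes n (.ite b p q) σ σ' (1 + k) := by
  obtain ⟨t, m, h1, h2, h3⟩ := h
  exact ⟨_, _, .ite_false hb h1, by have := hf.test_le b; rw [add_mul]; omega, h3⟩

theorem Takes.loop_true {n : ℕ} {b : Test} {p : Prog} {σ σ₁ σ₂ : State} {k l : ℕ}
    (hf : Fits n σ) (hb : b.Holds σ) (h : Takes n p σ σ₁ k) (h' : Takes n (.loop b p) σ₁ σ₂ l) :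
    Takes n (.loop b p) σ σ₂ (1 + k + l) := by
  obtain ⟨t, m, h1, h2, h3⟩ := h
  obtain ⟨t', m', h1', h2', h3'⟩ := h'
  exact ⟨_, _, .loop_true hb h1 h1', by have := hf.test_le b; rw [add_mul, add_mul]; omega,
    max_le h3 h3'⟩

theorem Takes.loop_false {n : ℕ} {b : Test} {p : Prog} {σ : State} (hf : Fits n σ)
    (hb : ¬ b.Holds σ) : Takes n (.loop b p) σ σ 1 :=
  ⟨_, _, .loop_false hb, by have := hf.test_le b; omega, hf.space_le⟩

/-! #### Representation of stores by machine states -/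

/-- Registers from `varCount` on are scratch space and only have to fit. Register `0` permanently
holds `n`, because the address computation needs `n * n`; this is why assignments to variable `0`
are excluded. -/
structure Represents (n : ℕ) (s : Store) (σ : State) : Prop where
  fits : Fits n σ
  reg_eq : ∀ x, x < varCount → σ.reg x = s.v x
  mem_eq : ∀ k i, Valid n k i → σ.mem (addr n k i) = s.a k i
  v_lt : ∀ x, x < varCount → s.v x < 2 ^ bits n
  v_zero : s.v 0 = n

theorem Represents.setReg {n : ℕ} {s : Store} {σ : State} (h : Represents n s σ) {i x : ℕ}
    (hi : varCount ≤ i) (hi' : i < regCount) (hx : x < 2 ^ regBits n) :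
    Represents n s { σ with reg := σ.reg.update i x } where
  fits := h.fits.setReg hi' hx
  reg_eq y hy := by
    simp only [Finsupp.coe_update, Function.update_apply]
    rw [if_neg (by omega)]
    exact h.reg_eq y hy
  mem_eq := h.mem_eq
  v_lt := h.v_lt
  v_zero := h.v_zero

theorem Represents.setv {n : ℕ} {s : Store} {σ : State} (h : Represents n s σ) {x m : ℕ}
    (h0 : x ≠ 0) (hx : x < varCount) (hm : m < 2 ^ bits n) :
    Represents n (s.setv x m) { σ with reg := σ.reg.update x m } where
  fits := h.fits.setReg (by unfold varCount at hx; unfold regCount; omega) (lt_regBits hm)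
  reg_eq y hy := by
    simp only [Finsupp.coe_update, Function.update_apply, Store.setv_v]
    rw [h.reg_eq y hy]
  mem_eq := h.mem_eq
  v_lt y hy := by
    rw [Store.setv_v]; split_ifs
    exacts [hm, h.v_lt y hy]
  v_zero := by rw [Store.setv_v, if_neg h0.symm]; exact h.v_zero

theorem Represents.seta {n : ℕ} {s : Store} {σ : State} (h : Represents n s σ) {k i m : ℕ}
    (hk : Valid n k i) (hm : m < 2 ^ bits n) :
    Represents n (s.seta k i m) { σ with mem := σ.mem.update (addr n k i) m } where
  fits :=
    { reg_lt := h.fits.reg_lt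
      reg_zero := h.fits.reg_zero
      mem_lt := fun a => by
        simp only [Finsupp.coe_update, Function.update_apply]
        split_ifs
        exacts [hm, h.fits.mem_lt a]
      mem_zero := fun a ha => by
        simp only [Finsupp.coe_update, Function.update_apply]
        rw [if_neg (by have := addr_lt hk; omega)]
        exact h.fits.mem_zero a ha }
  reg_eq := h.reg_eq
  mem_eq l j hl := by
    simp only [Finsupp.coe_update, Function.update_apply, Store.seta_a]
    by_cases e : l = k ∧ j = i
    · obtain ⟨rfl, rfl⟩ := e; simp
    · rw [if_neg e, if_neg (fun e' => e (addr_inj hl hk e'))]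
      exact h.mem_eq l j hl
  v_lt := h.v_lt
  v_zero := h.v_zero

/-- The values of a store are within the bounds. -/
structure Bounded (n : ℕ) (s : Store) : Prop where
  v_lt : ∀ x, x < varCount → s.v x < 2 ^ bits n
  a_lt : ∀ k i, Valid n k i → s.a k i < 2 ^ bits n
  v_zero : s.v 0 = n

theorem Represents.bounded {n : ℕ} {s : Store} {σ : State} (h : Represents n s σ) :
    Bounded n s where
  v_lt := h.v_lt
  a_lt k i hk := h.mem_eq k i hk ▸ h.fits.mem_lt _
  v_zero := h.v_zero

/-! #### Expressions -/

def Expr.size : Expr → ℕ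
  | .var _ => 1
  | .lit _ => 1
  | .add e f => e.size + f.size + 1
  | .sub e f => e.size + f.size + 1
  | .mul e f => e.size + f.size + 1
  | .arr _ e => e.size + 2

def Expr.wf : Expr → Bool
  | .var x => x < varCount
  | .lit c => c ≤ 1000
  | .add e f => e.wf && f.wf
  | .sub e f => e.wf && f.wf
  | .mul e f => e.wf && f.wf
  | .arr _ e => e.wf

/-- All array cells that are read are within range. -/
def Expr.ok (n : ℕ) (s : Store) : Expr → Prop
  | .var _ => True
  | .lit _ => True
  | .add e f => e.ok n s ∧ f.ok n s
  | .sub e f => e.ok n s ∧ f.ok n s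
  | .mul e f => e.ok n s ∧ f.ok n s
  | .arr k e => e.ok n s ∧ Valid n k (e.eval s)

def Expr.comp (d : ℕ) : Expr → Prog
  | .var x => .seq (.instr (.const (varCount + d) 0))
      (.instr (.add (varCount + d) (varCount + d) x))
  | .lit c => .instr (.const (varCount + d) c)
  | .add e f => .seq (.seq (e.comp d) (f.comp (d + 1)))
      (.instr (.add (varCount + d) (varCount + d) (varCount + d + 1)))
  | .sub e f => .seq (.seq (e.comp d) (f.comp (d + 1)))
      (.instr (.sub (varCount + d) (varCount + d) (varCount + d + 1)))
  | .mul e f => .seq (.seq (e.comp d) (f.comp (d + 1)))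
      (.instr (.mul (varCount + d) (varCount + d) (varCount + d + 1)))
  | .arr k e => .seq (e.comp d) (.seq (compAddr k d)
      (.instr (.load (varCount + d) (varCount + d))))
where
  /-- Replace an index in register `varCount + d` by the address in array `k`. -/
  compAddr (k d : ℕ) : Prog :=
    if k = 0 then .skip else
      .seq (.instr (.const (varCount + d + 1) 6))
        (.seq (.instr (.mul (varCount + d) (varCount + d) (varCount + d + 1)))
          (.seq (.instr (.mul (varCount + d + 1) 0 0))
            (.seq (.instr (.add (varCount + d) (varCount + d) (varCount + d + 1)))
              (.seq (.instr (.const (varCount + d + 1) (k - 1)))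
                (.instr (.add (varCount + d) (varCount + d) (varCount + d + 1)))))))

theorem add_lt_two_pow {x y p q : ℕ} (hp : 1 ≤ p) (hq : 1 ≤ q) (hx : x < 2 ^ p) (hy : y < 2 ^ q) :
    x + y < 2 ^ (p + q) := by
  have h1 : 2 ≤ 2 ^ p := by simpa using Nat.pow_le_pow_right (n := 2) (by norm_num) hp
  have h2 : 2 ≤ 2 ^ q := by simpa using Nat.pow_le_pow_right (n := 2) (by norm_num) hq
  rw [pow_add]
  nlinarith

theorem Expr.one_le_size (e : Expr) : 1 ≤ e.size := by cases e <;> simp [Expr.size]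

/-- Lengths add under multiplication, so each node of the expression contributes at most `bits n`
binary digits. Expressions of size at most 64 therefore fit into `regBits n`. -/
theorem Expr.eval_lt {n : ℕ} {s : Store} (hb : Bounded n s) (e : Expr) (hw : e.wf = true)
    (hok : e.ok n s) : e.eval s < 2 ^ (bits n * e.size) := by
  have up : ∀ {a b c : ℕ}, a < 2 ^ b → b ≤ c → a < 2 ^ c := fun h h' =>
    h.trans_le (Nat.pow_le_pow_right (by norm_num) h')
  have b1 : 40 ≤ bits n := by unfold bits; omega
  have mulsize : ∀ e : Expr, 1 ≤ bits n * e.size := fun e =>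
    Nat.mul_pos (by omega) e.one_le_size
  induction e with
  | var x => simpa [Expr.size, Expr.eval] using hb.v_lt x (by simpa [Expr.wf] using hw)
  | lit c =>
    have hc : c ≤ 1000 := by simpa [Expr.wf] using hw
    refine up (b := 40) (by simp only [Expr.eval]; omega) (by simp only [Expr.size]; omega)
  | add e f ihe ihf =>
    simp only [Expr.wf, Bool.and_eq_true] at hw
    refine up (add_lt_two_pow (mulsize e) (mulsize f) (ihe hw.1 hok.1) (ihf hw.2 hok.2)) ?_
    simp only [Expr.size]; nlinarith
  | sub e f ihe ihf =>
    simp only [Expr.wf, Bool.and_eq_true] at hw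
    refine up ((Nat.sub_le _ _).trans_lt (ihe hw.1 hok.1)) ?_
    simp only [Expr.size]; nlinarith
  | mul e f ihe ihf =>
    simp only [Expr.wf, Bool.and_eq_true] at hw
    have : e.eval s * f.eval s < 2 ^ (bits n * e.size) * 2 ^ (bits n * f.size) :=
      Nat.mul_lt_mul'' (ihe hw.1 hok.1) (ihf hw.2 hok.2)
    rw [← pow_add] at this
    refine up this ?_
    simp only [Expr.size]; nlinarith
  | arr k e ih =>
    refine up (hb.a_lt k _ hok.2) ?_
    simp only [Expr.size]; nlinarith

theorem Expr.eval_lt_regBits {n : ℕ} {s : Store} (hb : Bounded n s) (e : Expr)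
    (hw : e.wf = true) (hok : e.ok n s) (hs : e.size ≤ 64) : e.eval s < 2 ^ regBits n :=
  (e.eval_lt hb hw hok).trans_le
    (Nat.pow_le_pow_right (by norm_num) (Nat.mul_le_mul_left _ hs))

/-- The effect of an instruction that writes a scratch register. -/
theorem Represents.step {n : ℕ} {s : Store} {σ : State} (h : Represents n s σ) (c : Instr)
    {i x : ℕ} (hc : c.apply σ = { σ with reg := σ.reg.update i x }) (hi : varCount ≤ i)
    (hi' : i < regCount) (hx : x < 2 ^ regBits n) :
    ∃ σ', Takes n (.instr c) σ σ' 1 ∧ Represents n s σ' ∧ σ'.reg i = x ∧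
      (∀ j, j ≠ i → σ'.reg j = σ.reg j) ∧ σ'.mem = σ.mem := by
  have h' := h.setReg hi hi' hx
  refine ⟨_, Takes.instr c h.fits (hc ▸ h'.fits), hc ▸ h', ?_, ?_, ?_⟩
  · rw [hc]; simp
  · intro j hj; rw [hc]; simp [hj]
  · rw [hc]

theorem compAddr_takes {n : ℕ} {s : Store} {σ : State} (h : Represents n s σ) {k i d : ℕ}
    (hd : d ≤ 64) (hi : σ.reg (varCount + d) = i) (hv : Valid n k i) :
    ∃ σ', Takes n (Expr.comp.compAddr k d) σ σ' 6 ∧ Represents n s σ' ∧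
      σ'.reg (varCount + d) = addr n k i ∧
      (∀ j, j < varCount + d → σ'.reg j = σ.reg j) ∧ σ'.mem = σ.mem := by
  unfold Expr.comp.compAddr
  have hA := addr_lt hv
  have hM := memLen_lt n
  by_cases hk : k = 0
  · rw [if_pos hk]
    exact ⟨σ, (Takes.skip h.fits).mono (by omega), h, by simp [addr, hk, hi],
      fun _ _ => rfl, rfl⟩
  have hv' : k ≤ 6 := by rcases hv with ⟨h, -⟩ | ⟨-, h, -⟩ <;> omega
  rw [if_neg hk]
  have hA' : addr n k i = n * n + 6 * i + (k - 1) := by rw [addr, if_neg hk]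
  -- Each intermediate result is a partial sum of the final address or a constant of at most 6, so
  -- no separate overflow estimates are needed.
  have b1 : ∀ {m : ℕ}, m ≤ addr n k i → m < 2 ^ regBits n := fun hm =>
    lt_regBits (hm.trans_lt (hA.trans hM))
  have b2 : ∀ {m : ℕ}, m ≤ 6 → m < 2 ^ regBits n := fun hm => by
    refine lt_regBits (hm.trans_lt (lt_of_lt_of_le (b := 2 ^ 40) (by norm_num)
      (Nat.pow_le_pow_right (by norm_num) (by unfold bits; omega))))
  obtain ⟨σ1, t1, r1, e1, f1, m1⟩ := h.step (.const (varCount + d + 1) 6) rfl (by omega)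
    (by unfold varCount regCount; omega) (b2 le_rfl)
  obtain ⟨σ2, t2, r2, e2, f2, m2⟩ := r1.step
    (.mul (varCount + d) (varCount + d) (varCount + d + 1)) (x := i * 6)
    (by simp only [Instr.apply]; rw [e1, f1 _ (by omega), hi]) (by omega)
    (by unfold varCount regCount; omega) (b1 (by rw [hA']; omega))
  have hn : σ2.reg 0 = n := by rw [r2.reg_eq 0 (by norm_num), r2.v_zero]
  obtain ⟨σ3, t3, r3, e3, f3, m3⟩ := r2.step
    (.mul (varCount + d + 1) 0 0) (x := n * n)
    (by simp only [Instr.apply]; rw [hn]) (by omega)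
    (by unfold varCount regCount; omega) (b1 (by rw [hA']; omega))
  obtain ⟨σ4, t4, r4, e4, f4, m4⟩ := r3.step
    (.add (varCount + d) (varCount + d) (varCount + d + 1)) (x := i * 6 + n * n)
    (by simp only [Instr.apply]; rw [e3, f3 _ (by omega), e2]) (by omega)
    (by unfold varCount regCount; omega) (b1 (by rw [hA']; omega))
  obtain ⟨σ5, t5, r5, e5, f5, m5⟩ := r4.step (.const (varCount + d + 1) (k - 1)) rfl (by omega)
    (by unfold varCount regCount; omega) (b2 (by omega))
  obtain ⟨σ6, t6, r6, e6, f6, m6⟩ := r5.step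
    (.add (varCount + d) (varCount + d) (varCount + d + 1)) (x := i * 6 + n * n + (k - 1))
    (by simp only [Instr.apply]; rw [e5, f5 _ (by omega), e4]) (by omega)
    (by unfold varCount regCount; omega) (b1 (by rw [hA']; omega))
  refine ⟨σ6, t1.seq (t2.seq (t3.seq (t4.seq (t5.seq t6)))), r6, ?_, ?_, ?_⟩
  · rw [e6, hA']; ring
  · intro j hj
    rw [f6 _ (by omega), f5 _ (by omega), f4 _ (by omega), f3 _ (by omega), f2 _ (by omega),
      f1 _ (by omega)]
  · rw [m6, m5, m4, m3, m2, m1]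

/-- The scratch registers act as a stack: at depth `d` the value lands in register `varCount + d`
and everything below is preserved, so a left operand survives the evaluation of the right one. The
bound 64 on depth plus size keeps the stack below `regCount`. -/
theorem Expr.comp_takes {n : ℕ} {s : Store} (e : Expr) (hw : e.wf = true) (hok : e.ok n s) :
    ∀ (d : ℕ) (σ : State), Represents n s σ → d + e.size ≤ 64 →
      ∃ σ', Takes n (e.comp d) σ σ' (8 * e.size) ∧ Represents n s σ' ∧
        σ'.reg (varCount + d) = e.eval s ∧ ∀ j, j < varCount + d → σ'.reg j = σ.reg j := by
  induction e with
  | var x =>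
    intro d σ h hd
    have hx : x < varCount := by simpa [Expr.wf] using hw
    obtain ⟨σ1, t1, r1, e1, f1, -⟩ := h.step (.const (varCount + d) 0) rfl (by omega)
      (by simp only [Expr.size] at hd; unfold varCount regCount; omega) (by positivity)
    obtain ⟨σ2, t2, r2, e2, f2, -⟩ := r1.step (.add (varCount + d) (varCount + d) x)
      (x := s.v x) (by simp only [Instr.apply]; rw [e1, r1.reg_eq x hx, zero_add]) (by omega)
      (by simp only [Expr.size] at hd; unfold varCount regCount; omega)
      (lt_regBits (h.v_lt x hx))
    refine ⟨σ2, (t1.seq t2).mono (by simp [Expr.size]), r2, e2, fun j hj => ?_⟩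
    rw [f2 _ (by omega), f1 _ (by omega)]
  | lit c =>
    intro d σ h hd
    obtain ⟨σ1, t1, r1, e1, f1, -⟩ := h.step (.const (varCount + d) c) rfl (by omega)
      (by simp only [Expr.size] at hd; unfold varCount regCount; omega)
      ((Expr.lit c).eval_lt_regBits h.bounded hw hok (by omega))
    exact ⟨σ1, t1.mono (by simp [Expr.size]), r1, e1, fun j hj => f1 _ (by omega)⟩
  | add e f ihe ihf =>
    intro d σ h hd
    have hlt := (Expr.add e f).eval_lt_regBits h.bounded hw hok (by omega)
    simp only [Expr.wf, Bool.and_eq_true] at hw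
    simp only [Expr.size] at hd
    obtain ⟨σ1, t1, r1, e1, f1⟩ := ihe hw.1 hok.1 d σ h (by omega)
    obtain ⟨σ2, t2, r2, e2, f2⟩ := ihf hw.2 hok.2 (d + 1) σ1 r1 (by omega)
    obtain ⟨σ3, t3, r3, e3, f3, -⟩ := r2.step
      (.add (varCount + d) (varCount + d) (varCount + d + 1)) (x := e.eval s + f.eval s)
      (by simp only [Instr.apply]; rw [← e2, f2 _ (by omega), e1]; rfl) (by omega)
      (by unfold varCount regCount; omega) hlt
    refine ⟨σ3, ((t1.seq t2).seq t3).mono (by simp only [Expr.size]; omega), r3, e3, ?_⟩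
    intro j hj
    rw [f3 _ (by omega), f2 _ (by omega), f1 _ (by omega)]
  | sub e f ihe ihf =>
    intro d σ h hd
    have hlt := (Expr.sub e f).eval_lt_regBits h.bounded hw hok (by omega)
    simp only [Expr.wf, Bool.and_eq_true] at hw
    simp only [Expr.size] at hd
    obtain ⟨σ1, t1, r1, e1, f1⟩ := ihe hw.1 hok.1 d σ h (by omega)
    obtain ⟨σ2, t2, r2, e2, f2⟩ := ihf hw.2 hok.2 (d + 1) σ1 r1 (by omega)
    obtain ⟨σ3, t3, r3, e3, f3, -⟩ := r2.step
      (.sub (varCount + d) (varCount + d) (varCount + d + 1)) (x := e.eval s - f.eval s)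
      (by simp only [Instr.apply]; rw [← e2, f2 _ (by omega), e1]; rfl) (by omega)
      (by unfold varCount regCount; omega) hlt
    refine ⟨σ3, ((t1.seq t2).seq t3).mono (by simp only [Expr.size]; omega), r3, e3, ?_⟩
    intro j hj
    rw [f3 _ (by omega), f2 _ (by omega), f1 _ (by omega)]
  | mul e f ihe ihf =>
    intro d σ h hd
    have hlt := (Expr.mul e f).eval_lt_regBits h.bounded hw hok (by omega)
    simp only [Expr.wf, Bool.and_eq_true] at hw
    simp only [Expr.size] at hd
    obtain ⟨σ1, t1, r1, e1, f1⟩ := ihe hw.1 hok.1 d σ h (by omega)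
    obtain ⟨σ2, t2, r2, e2, f2⟩ := ihf hw.2 hok.2 (d + 1) σ1 r1 (by omega)
    obtain ⟨σ3, t3, r3, e3, f3, -⟩ := r2.step
      (.mul (varCount + d) (varCount + d) (varCount + d + 1)) (x := e.eval s * f.eval s)
      (by simp only [Instr.apply]; rw [← e2, f2 _ (by omega), e1]; rfl) (by omega)
      (by unfold varCount regCount; omega) hlt
    refine ⟨σ3, ((t1.seq t2).seq t3).mono (by simp only [Expr.size]; omega), r3, e3, ?_⟩
    intro j hj
    rw [f3 _ (by omega), f2 _ (by omega), f1 _ (by omega)]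
  | arr k e ih =>
    intro d σ h hd
    simp only [Expr.size] at hd
    have hw' : e.wf = true := by simpa [Expr.wf] using hw
    obtain ⟨σ1, t1, r1, e1, f1⟩ := ih hw' hok.1 d σ h (by omega)
    obtain ⟨σ2, t2, r2, e2, f2, -⟩ := compAddr_takes r1 (by omega) e1 hok.2
    obtain ⟨σ3, t3, r3, e3, f3, -⟩ := r2.step (.load (varCount + d) (varCount + d))
      (x := s.a k (e.eval s)) (by simp only [Instr.apply]; rw [e2, r2.mem_eq _ _ hok.2])
      (by omega) (by unfold varCount regCount; omega) (lt_regBits (h.bounded.a_lt k _ hok.2))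
    refine ⟨σ3, (t1.seq (t2.seq t3)).mono (by simp only [Expr.size]; omega), r3, e3, ?_⟩
    intro j hj
    rw [f3 _ (by omega), f2 _ (by omega), f1 _ (by omega)]

/-! #### Commands -/

/-- The variables that a command may change. -/
def Cmd.vmods : Cmd → List ℕ
  | .skip => []
  | .assign x _ => [x]
  | .store _ _ _ => []
  | .seq c d => c.vmods ++ d.vmods
  | .ite _ c d => c.vmods ++ d.vmods
  | .loop x _ c => x :: c.vmods

/-- The arrays that a command may change. -/
def Cmd.amods : Cmd → List ℕ
  | .skip => []
  | .assign _ _ => []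
  | .store k _ _ => [k]
  | .seq c d => c.amods ++ d.amods
  | .ite _ c d => c.amods ++ d.amods
  | .loop _ _ c => c.amods

theorem iter_invariant {α : Type*} {f : ℕ → α → α} {p : α → Prop} (h : ∀ i a, p a → p (f i a))
    (N : ℕ) (a : α) (ha : p a) : p (iter f N a) := by
  induction N with
  | zero => exact ha
  | succ N ih => exact h _ _ ih

theorem Cmd.run_v (c : Cmd) {x : ℕ} (hx : x ∉ c.vmods) (s : Store) : (c.run s).v x = s.v x := by
  induction c generalizing s with
  | skip => rfl
  | assign y e =>
    have : x ≠ y := by simpa [Cmd.vmods] using hx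
    simp [Cmd.run, this]
  | store k e f => rfl
  | seq c d ihc ihd =>
    simp only [Cmd.vmods, List.mem_append, not_or] at hx
    simp only [Cmd.run]; rw [ihd hx.2, ihc hx.1]
  | ite e c d ihc ihd =>
    simp only [Cmd.vmods, List.mem_append, not_or] at hx
    simp only [Cmd.run]; split_ifs
    exacts [ihc hx.1 s, ihd hx.2 s]
  | loop z y c ih =>
    simp only [Cmd.vmods, List.mem_cons, not_or] at hx
    simp only [Cmd.run, Store.setv_v, if_neg hx.1]
    refine iter_invariant (p := fun r : Store => r.v x = s.v x) (fun i r hr => ?_) _ _ rfl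
    rw [ih hx.2, Store.setv_v, if_neg hx.1, hr]

theorem Cmd.run_a (c : Cmd) {k : ℕ} (hk : k ∉ c.amods) (s : Store) : (c.run s).a k = s.a k := by
  induction c generalizing s with
  | skip => rfl
  | assign y e => rfl
  | store l e f =>
    have : k ≠ l := by simpa [Cmd.amods] using hk
    ext j; simp [Cmd.run, this]
  | seq c d ihc ihd =>
    simp only [Cmd.amods, List.mem_append, not_or] at hk
    simp only [Cmd.run]; rw [ihd hk.2, ihc hk.1]
  | ite e c d ihc ihd =>
    simp only [Cmd.amods, List.mem_append, not_or] at hk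
    simp only [Cmd.run]; split_ifs
    exacts [ihc hk.1 s, ihd hk.2 s]
  | loop z y c ih =>
    simp only [Cmd.amods] at hk
    simp only [Cmd.run, Store.setv_a]
    refine iter_invariant (p := fun r : Store => r.a k = s.a k) (fun i r hr => ?_) _ _ rfl
    rw [ih hk, Store.setv_a, hr]

/-- Static conditions on a command. -/
def Cmd.wf : Cmd → Bool
  | .skip => true
  | .assign x e => x ≠ 0 && x < varCount && e.wf && e.size ≤ 60
  | .store _ e f => e.wf && f.wf && e.size ≤ 60 && f.size ≤ 60
  | .seq c d => c.wf && d.wf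
  | .ite e c d => e.wf && e.size ≤ 60 && c.wf && d.wf
  | .loop x y c => x ≠ 0 && x < varCount && y < varCount && x ≠ y && c.wf &&
      !c.vmods.contains x && !c.vmods.contains y

/-- All array cells that are used are within range and all values within the bounds. -/
def Cmd.safe (n : ℕ) : Cmd → Store → Prop
  | .skip, _ => True
  | .assign _ e, s => e.ok n s ∧ e.eval s < 2 ^ bits n
  | .store k e f, s => e.ok n s ∧ f.ok n s ∧ Valid n k (e.eval s) ∧ f.eval s < 2 ^ bits n
  | .seq c d, s => c.safe n s ∧ d.safe n (c.run s)
  | .ite e c d, s => e.ok n s ∧ (e.eval s ≠ 0 → c.safe n s) ∧ (e.eval s = 0 → d.safe n s)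
  | .loop x y c, s => ∀ i, i < s.v y →
      c.safe n ((iter (fun i r => c.run (r.setv x i)) i s).setv x i)

/-- The number of elementary commands and tests that are executed. -/
def Cmd.cost : Cmd → Store → ℕ
  | .skip, _ => 1
  | .assign _ _, _ => 1
  | .store _ _ _, _ => 1
  | .seq c d, s => c.cost s + d.cost (c.run s)
  | .ite e c d, s => 1 + if e.eval s ≠ 0 then c.cost s else d.cost s
  | .loop x y c, s => 1 + ∑ i ∈ Finset.range (s.v y),
      (c.cost ((iter (fun i r => c.run (r.setv x i)) i s).setv x i) + 1)

def Cmd.comp : Cmd → Prog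
  | .skip => .skip
  | .assign x e => .seq (e.comp 0) (.seq (.instr (.const (varCount + 1) 0))
      (.instr (.add x varCount (varCount + 1))))
  | .store k e f => .seq (e.comp 0) (.seq (Expr.comp.compAddr k 0)
      (.seq (f.comp 1) (.instr (.store varCount (varCount + 1)))))
  | .seq c d => .seq c.comp d.comp
  | .ite e c d => .seq (e.comp 0) (.seq (.instr (.const (varCount + 1) 0))
      (.ite (.lt (varCount + 1) varCount) c.comp d.comp))
  | .loop x y c => .seq (.instr (.const x 0)) (.loop (.lt x y)
      (.seq c.comp (.seq (.instr (.const varCount 1)) (.instr (.add x x varCount)))))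

theorem Represents.stepVar {n : ℕ} {s : Store} {σ : State} (h : Represents n s σ) (c : Instr)
    {x m : ℕ} (hc : c.apply σ = { σ with reg := σ.reg.update x m }) (h0 : x ≠ 0)
    (hx : x < varCount) (hm : m < 2 ^ bits n) :
    ∃ σ', Takes n (.instr c) σ σ' 1 ∧ Represents n (s.setv x m) σ' := by
  have h' := h.setv h0 hx hm
  exact ⟨_, Takes.instr c h.fits (hc ▸ h'.fits), hc ▸ h'⟩

/-- Time units per elementary command. -/
abbrev unitsPerCmd : ℕ := 1200

/-- The constant `unitsPerCmd` is generous: the worst case is a store with two expressions of size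
at most 60, at 8 units per node, and a few extra instructions. -/
theorem Cmd.comp_takes {n : ℕ} (c : Cmd) (hw : c.wf = true) :
    ∀ (s : Store) (σ : State), Represents n s σ → c.safe n s →
      ∃ σ', Takes n c.comp σ σ' (unitsPerCmd * c.cost s) ∧ Represents n (c.run s) σ' := by
  have pos : ∀ m, m ≤ 6 → m < 2 ^ bits n := fun m hm =>
    hm.trans_lt (lt_of_lt_of_le (b := 2 ^ 40) (by norm_num)
      (Nat.pow_le_pow_right (by norm_num) (by unfold bits; omega)))
  induction c with
  | skip => exact fun s σ h _ => ⟨σ, (Takes.skip h.fits).mono (by simp [Cmd.cost]), h⟩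
  | assign x e =>
    intro s σ h hs
    simp only [Cmd.wf, Bool.and_eq_true, decide_eq_true_eq] at hw
    obtain ⟨⟨⟨hx0, hx⟩, he⟩, hsz⟩ := hw
    obtain ⟨σ1, t1, r1, e1, f1⟩ := e.comp_takes he hs.1 0 σ h (by omega)
    obtain ⟨σ2, t2, r2, e2, f2, -⟩ := r1.step (.const (varCount + 1) 0) rfl (by omega)
      (by norm_num) (by positivity)
    obtain ⟨σ3, t3, r3⟩ := r2.stepVar (.add x varCount (varCount + 1)) (x := x) (m := e.eval s)
      (by simp only [Instr.apply]; rw [e2, f2 _ (by omega), ← e1]; rfl) hx0 hx hs.2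
    exact ⟨σ3, (t1.seq (t2.seq t3)).mono (by simp only [Cmd.cost, unitsPerCmd]; omega), r3⟩
  | store k e f =>
    intro s σ h hs
    simp only [Cmd.wf, Bool.and_eq_true, decide_eq_true_eq] at hw
    obtain ⟨⟨⟨hwe, hwf⟩, hse⟩, hsf⟩ := hw
    obtain ⟨hoe, hof, hv, hlt⟩ := hs
    obtain ⟨σ1, t1, r1, e1, f1⟩ := e.comp_takes hwe hoe 0 σ h (by omega)
    obtain ⟨σ2, t2, r2, e2, f2, -⟩ := compAddr_takes r1 (by omega) e1 hv
    obtain ⟨σ3, t3, r3, e3, f3⟩ := f.comp_takes hwf hof 1 σ2 r2 (by omega)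
    have h' := r3.seta hv hlt
    have ha : (Instr.store varCount (varCount + 1)).apply σ3 =
        { σ3 with mem := σ3.mem.update (addr n k (e.eval s)) (f.eval s) } := by
      simp only [Instr.apply]
      rw [← e3, f3 _ (by omega), ← e2]
    exact ⟨_, (t1.seq (t2.seq (t3.seq (Takes.instr _ r3.fits (ha ▸ h'.fits))))).mono
      (by simp only [Cmd.cost, unitsPerCmd]; omega), ha ▸ h'⟩
  | seq c d ihc ihd =>
    intro s σ h hs
    simp only [Cmd.wf, Bool.and_eq_true] at hw
    obtain ⟨σ1, t1, r1⟩ := ihc hw.1 s σ h hs.1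
    obtain ⟨σ2, t2, r2⟩ := ihd hw.2 _ σ1 r1 hs.2
    exact ⟨σ2, (t1.seq t2).mono (by simp only [Cmd.cost, unitsPerCmd]; omega), r2⟩
  | ite e c d ihc ihd =>
    intro s σ h hs
    simp only [Cmd.wf, Bool.and_eq_true, decide_eq_true_eq] at hw
    obtain ⟨⟨⟨hwe, hse⟩, hwc⟩, hwd⟩ := hw
    obtain ⟨σ1, t1, r1, e1, f1⟩ := e.comp_takes hwe hs.1 0 σ h (by omega)
    obtain ⟨σ2, t2, r2, e2, f2, -⟩ := r1.step (.const (varCount + 1) 0) rfl (by omega)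
      (by norm_num) (by positivity)
    have e3 : σ2.reg varCount = e.eval s := by rw [f2 _ (by omega)]; exact e1
    by_cases hc : e.eval s ≠ 0
    · obtain ⟨σ3, t3, r3⟩ := ihc hwc s σ2 r2 (hs.2.1 hc)
      refine ⟨σ3, (t1.seq (t2.seq (Takes.ite_true r2.fits ?_ t3))).mono ?_, ?_⟩
      · simp only [Test.Holds]; omega
      · simp only [Cmd.cost, unitsPerCmd, if_pos hc]; omega
      · simpa only [Cmd.run, if_pos hc] using r3
    · obtain ⟨σ3, t3, r3⟩ := ihd hwd s σ2 r2 (hs.2.2 (not_not.mp hc))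
      refine ⟨σ3, (t1.seq (t2.seq (Takes.ite_false r2.fits ?_ t3))).mono ?_, ?_⟩
      · simp only [Test.Holds]; omega
      · simp only [Cmd.cost, unitsPerCmd, if_neg hc]; omega
      · simpa only [Cmd.run, if_neg hc] using r3
  | loop x y c ih =>
    intro s σ h hs
    simp only [Cmd.wf, Bool.and_eq_true, decide_eq_true_eq, Bool.not_eq_true',
      List.contains_eq_mem, decide_eq_false_iff_not] at hw
    obtain ⟨⟨⟨⟨⟨⟨hx0, hx⟩, hy⟩, hxy⟩, hwc⟩, hxc⟩, hyc⟩ := hw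
    set F : ℕ → Store → Store := fun i r => c.run (r.setv x i) with hF
    have hyF : ∀ i, (iter F i s).v y = s.v y := fun i =>
      iter_invariant (p := fun r : Store => r.v y = s.v y)
        (fun j r hr => by rw [hF]; simp only; rw [c.run_v hyc, Store.setv_v, if_neg hxy.symm, hr])
        _ _ rfl
    -- Induction on the number `j` of iterations that remain, since the machine unfolds the loop
    -- from its first pass while `iter` unfolds from its last.
    have main : ∀ j i σ1, i + j = s.v y → Represents n ((iter F i s).setv x i) σ1 →
        ∃ σ2, Takes n (.loop (.lt x y) (.seq c.comp (.seq (.instr (.const varCount 1))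
            (.instr (.add x x varCount))))) σ1 σ2
            (1 + unitsPerCmd * ∑ i ∈ Finset.Ico i (s.v y),
              (c.cost ((iter F i s).setv x i) + 1)) ∧
          Represents n ((iter F (s.v y) s).setv x (s.v y)) σ2 := by
      intro j
      induction j with
      | zero =>
        intro i σ1 hi r1
        obtain rfl : i = s.v y := by omega
        refine ⟨σ1, (Takes.loop_false r1.fits ?_).mono (by omega), r1⟩
        simp only [Test.Holds, r1.reg_eq x hx, r1.reg_eq y hy, Store.setv_v, if_true,
          if_neg hxy.symm, hyF, lt_irrefl, not_false_eq_true]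
      | succ j ihj =>
        intro i σ1 hi r1
        have hiy : i < s.v y := by omega
        obtain ⟨σ2, t2, r2⟩ := ih hwc _ σ1 r1 (hs i hiy)
        obtain ⟨σ3, t3, r3, e3, -, -⟩ := r2.step (.const varCount 1) rfl le_rfl (by norm_num)
          (lt_regBits (pos 1 (by norm_num)))
        have hxi : (c.run ((iter F i s).setv x i)).v x = i := by
          rw [c.run_v hxc, Store.setv_v, if_pos rfl]
        obtain ⟨σ4, t4, r4⟩ := r3.stepVar (.add x x varCount) (x := x) (m := i + 1)
          (by simp only [Instr.apply]; rw [e3, r3.reg_eq x hx, hxi]) hx0 hx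
          (lt_of_le_of_lt hiy (h.v_lt y hy))
        obtain ⟨σ5, t5, r5⟩ := ihj (i + 1) σ4 (by omega) r4
        refine ⟨σ5, (Takes.loop_true r1.fits ?_ (t2.seq (t3.seq t4)) t5).mono ?_, r5⟩
        · simp only [Test.Holds, r1.reg_eq x hx, r1.reg_eq y hy, Store.setv_v, if_true,
            if_neg hxy.symm, hyF, hiy]
        · rw [Finset.sum_eq_sum_Ico_succ_bot hiy]
          simp only [unitsPerCmd]; omega
    obtain ⟨σ1, t1, r1⟩ := h.stepVar (.const x 0) (x := x) (m := 0) rfl hx0 hx (by positivity)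
    obtain ⟨σ2, t2, r2⟩ := main (s.v y) 0 σ1 (by omega) r1
    refine ⟨σ2, (t1.seq t2).mono ?_, r2⟩
    simp only [Cmd.cost, unitsPerCmd, ← hF, Finset.range_eq_Ico]; omega

/-! #### Program verification -/

/-- A bound for the cost of a command, given bounds `N` for the variables that bound loops. -/
def Cmd.costBound (N : ℕ → ℕ) : Cmd → ℕ
  | .skip => 1
  | .assign _ _ => 1
  | .store _ _ _ => 1
  | .seq c d => c.costBound N + d.costBound N
  | .ite _ c d => 1 + (c.costBound N + d.costBound N)
  | .loop _ y c => 1 + N y * (c.costBound N + 1)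

/-- Started in `s`, the command `c` is safe, respects the cost bound and establishes `Q`. -/
def Spec (n : ℕ) (N : ℕ → ℕ) (c : Cmd) (s : Store) (Q : Store → Prop) : Prop :=
  Bounded n s → c.safe n s ∧ c.cost s ≤ c.costBound N ∧ Q (c.run s)

/-- `s'` differs from `s` only in what `c` may change. -/
def Agree (c : Cmd) (s s' : Store) : Prop :=
  (∀ x, x ∉ c.vmods → s'.v x = s.v x) ∧ ∀ k, k ∉ c.amods → s'.a k = s.a k

theorem Cmd.agree_run (c : Cmd) (s : Store) : Agree c s (c.run s) :=
  ⟨fun _ hx => c.run_v hx s, fun _ hk => c.run_a hk s⟩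

theorem Bounded.setv {n : ℕ} {s : Store} (h : Bounded n s) {x m : ℕ} (h0 : x ≠ 0)
    (hm : m < 2 ^ bits n) : Bounded n (s.setv x m) where
  v_lt y hy := by
    rw [Store.setv_v]; split_ifs
    exacts [hm, h.v_lt y hy]
  a_lt := h.a_lt
  v_zero := by rw [Store.setv_v, if_neg h0.symm]; exact h.v_zero

theorem Bounded.seta {n : ℕ} {s : Store} (h : Bounded n s) {k i m : ℕ}
    (hm : m < 2 ^ bits n) : Bounded n (s.seta k i m) where
  v_lt := h.v_lt
  a_lt l j hl := by
    rw [Store.seta_a]; split_ifs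
    exacts [hm, h.a_lt l j hl]
  v_zero := h.v_zero

theorem Cmd.bounded_run {n : ℕ} (c : Cmd) (hw : c.wf = true) :
    ∀ s, Bounded n s → c.safe n s → Bounded n (c.run s) := by
  induction c with
  | skip => exact fun s h _ => h
  | assign x e =>
    intro s h hs
    simp only [Cmd.wf, Bool.and_eq_true, decide_eq_true_eq] at hw
    exact h.setv hw.1.1.1 hs.2
  | store k e f => exact fun s h hs => h.seta hs.2.2.2
  | seq c d ihc ihd =>
    intro s h hs
    simp only [Cmd.wf, Bool.and_eq_true] at hw
    exact ihd hw.2 _ (ihc hw.1 s h hs.1) hs.2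
  | ite e c d ihc ihd =>
    intro s h hs
    simp only [Cmd.wf, Bool.and_eq_true] at hw
    simp only [Cmd.run]
    split_ifs with he
    exacts [ihc hw.1.2 s h (hs.2.1 he), ihd hw.2 s h (hs.2.2 (not_not.mp he))]
  | loop x y c ih =>
    intro s h hs
    simp only [Cmd.wf, Bool.and_eq_true, decide_eq_true_eq] at hw
    obtain ⟨⟨⟨⟨⟨⟨hx0, hx⟩, hy⟩, hxy⟩, hwc⟩, -⟩, -⟩ := hw
    have : ∀ i, i ≤ s.v y → Bounded n (iter (fun i r => c.run (r.setv x i)) i s) := by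
      intro i
      induction i with
      | zero => exact fun _ => h
      | succ i ihi =>
        intro hi
        exact ih hwc _ ((ihi (by omega)).setv hx0 (lt_of_lt_of_le hi (h.v_lt y hy).le))
          (hs i hi)
    exact (this _ le_rfl).setv hx0 (h.v_lt y hy)

section Rules

variable {n : ℕ} {N : ℕ → ℕ} {s : Store} {Q : Store → Prop}

theorem Spec.mono {c : Cmd} {P : Store → Prop} (h : Spec n N c s P) (hPQ : ∀ s', P s' → Q s') :
    Spec n N c s Q :=
  fun hb => ⟨(h hb).1, (h hb).2.1, hPQ _ (h hb).2.2⟩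

/-- The frame rule. -/
theorem Spec.agree {c : Cmd} {P : Store → Prop} (h : Spec n N c s P)
    (hPQ : ∀ s', Agree c s s' → P s' → Q s') : Spec n N c s Q :=
  fun hb => ⟨(h hb).1, (h hb).2.1, hPQ _ (c.agree_run s) (h hb).2.2⟩

theorem Spec.skip (h : Q s) : Spec n N .skip s Q :=
  fun _ => ⟨trivial, le_rfl, h⟩

theorem Spec.assign {x : ℕ} {e : Expr}
    (h : Bounded n s → e.ok n s ∧ e.eval s < 2 ^ bits n) (hQ : Q (s.setv x (e.eval s))) :
    Spec n N (.assign x e) s Q :=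
  fun hb => ⟨h hb, le_rfl, hQ⟩

theorem Spec.store {k : ℕ} {e f : Expr}
    (h : Bounded n s → e.ok n s ∧ f.ok n s ∧ Valid n k (e.eval s) ∧ f.eval s < 2 ^ bits n)
    (hQ : Q (s.seta k (e.eval s) (f.eval s))) :
    Spec n N (.store k e f) s Q :=
  fun hb => ⟨h hb, le_rfl, hQ⟩

theorem Spec.seq {P : Store → Prop} {c d : Cmd} (hw : c.wf = true) (hc : Spec n N c s P)
    (hd : ∀ s', Agree c s s' → P s' → Spec n N d s' Q) : Spec n N (.seq c d) s Q := by
  intro hb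
  obtain ⟨h1, h2, h3⟩ := hc hb
  obtain ⟨h4, h5, h6⟩ := hd _ (c.agree_run s) h3 (c.bounded_run hw s hb h1)
  exact ⟨⟨h1, h4⟩, Nat.add_le_add h2 h5, h6⟩

theorem Spec.assign_seq {x : ℕ} {e : Expr} {d : Cmd} (hx : x ≠ 0)
    (h : Bounded n s → e.ok n s ∧ e.eval s < 2 ^ bits n)
    (hd : Spec n N d (s.setv x (e.eval s)) Q) : Spec n N (.seq (.assign x e) d) s Q := by
  intro hb
  obtain ⟨h4, h5, h6⟩ := hd (hb.setv hx (h hb).2)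
  exact ⟨⟨h hb, h4⟩, Nat.add_le_add le_rfl h5, h6⟩

theorem Spec.store_seq {k : ℕ} {e f : Expr} {d : Cmd}
    (h : Bounded n s → e.ok n s ∧ f.ok n s ∧ Valid n k (e.eval s) ∧ f.eval s < 2 ^ bits n)
    (hd : Spec n N d (s.seta k (e.eval s) (f.eval s)) Q) :
    Spec n N (.seq (.store k e f) d) s Q := by
  intro hb
  obtain ⟨h4, h5, h6⟩ := hd (hb.seta (h hb).2.2.2)
  exact ⟨⟨h hb, h4⟩, Nat.add_le_add le_rfl h5, h6⟩

theorem Spec.ite {e : Expr} {c d : Cmd} (he : Bounded n s → e.ok n s)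
    (hc : e.eval s ≠ 0 → Spec n N c s Q) (hd : e.eval s = 0 → Spec n N d s Q) :
    Spec n N (.ite e c d) s Q := by
  intro hb
  by_cases h : e.eval s = 0
  · obtain ⟨h1, h2, h3⟩ := hd h hb
    refine ⟨⟨he hb, fun h' => absurd h h', fun _ => h1⟩, ?_, ?_⟩
    · simp only [Cmd.cost, Cmd.costBound, ne_eq, h, not_true_eq_false, if_false]; omega
    · simpa only [Cmd.run, ne_eq, h, not_true_eq_false, if_false] using h3
  · obtain ⟨h1, h2, h3⟩ := hc h hb
    refine ⟨⟨he hb, fun _ => h1, fun h' => absurd h' h⟩, ?_, ?_⟩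
    · simp only [Cmd.cost, Cmd.costBound, ne_eq, h, not_false_eq_true, if_true]; omega
    · simpa only [Cmd.run, ne_eq, h, not_false_eq_true, if_true] using h3

/-- The invariant is taken before the counter is set for the next pass. The frame condition `Agree`
is supplied at every iteration, so an invariant need only speak of what the body changes. -/
theorem Spec.loop {c : Cmd} {x y : ℕ} (I : ℕ → Store → Prop)
    (hw : (Cmd.loop x y c).wf = true) (hN : s.v y ≤ N y) (h0 : I 0 s)
    (hI : ∀ i s', i < s.v y → Agree (.loop x y c) s s' → I i s' →
      Spec n N c (s'.setv x i) (I (i + 1)))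
    (hQ : ∀ s', Agree (.loop x y c) s s' → I (s.v y) s' → Q (s'.setv x (s.v y))) :
    Spec n N (.loop x y c) s Q := by
  intro hb
  have hw' := hw
  simp only [Cmd.wf, Bool.and_eq_true, decide_eq_true_eq] at hw'
  obtain ⟨⟨⟨⟨⟨⟨hx0, hx⟩, hy⟩, hxy⟩, hwc⟩, -⟩, -⟩ := hw'
  set F : ℕ → Store → Store := fun i r => c.run (r.setv x i) with hF
  have hag : ∀ i, Agree (.loop x y c) s (iter F i s) := by
    intro i
    refine iter_invariant (p := Agree (.loop x y c) s) (fun j r hr => ⟨?_, ?_⟩) _ _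
      ⟨fun _ _ => rfl, fun _ _ => rfl⟩
    · intro z hz
      have hz' := hz
      simp only [Cmd.vmods, List.mem_cons, not_or] at hz'
      rw [hF]; simp only
      rw [c.run_v hz'.2, Store.setv_v, if_neg hz'.1, hr.1 z hz]
    · intro l hl
      rw [hF]; simp only
      rw [c.run_a hl, Store.setv_a, hr.2 l hl]
  have main : ∀ i, i ≤ s.v y → Bounded n (iter F i s) ∧ I i (iter F i s) := by
    intro i
    induction i with
    | zero => exact fun _ => ⟨hb, h0⟩
    | succ i ih =>
      intro hi
      obtain ⟨hb', hI'⟩ := ih (by omega)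
      have hb'' := hb'.setv hx0 (lt_of_lt_of_le hi (hb.v_lt y hy).le)
      obtain ⟨h1, h2, h3⟩ := hI i _ hi (hag i) hI' hb''
      exact ⟨c.bounded_run hwc _ hb'' h1, h3⟩
  have step : ∀ i, i < s.v y → c.safe n ((iter F i s).setv x i) ∧
      c.cost ((iter F i s).setv x i) ≤ c.costBound N := by
    intro i hi
    obtain ⟨hb', hI'⟩ := main i hi.le
    obtain ⟨h1, h2, -⟩ := hI i _ hi (hag i) hI'
      (hb'.setv hx0 (hi.trans (hb.v_lt y hy)))
    exact ⟨h1, h2⟩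
  refine ⟨fun i hi => (step i hi).1, ?_, hQ _ (hag _) (main _ le_rfl).2⟩
  simp only [Cmd.cost, Cmd.costBound]
  refine Nat.add_le_add_left ?_ 1
  calc _ ≤ ∑ i ∈ Finset.range (s.v y), (c.costBound N + 1) := by
        refine Finset.sum_le_sum fun i hi => ?_
        exact Nat.add_le_add_right (step i (Finset.mem_range.mp hi)).2 1
    _ = s.v y * (c.costBound N + 1) := by simp
    _ ≤ N y * (c.costBound N + 1) := Nat.mul_le_mul_right _ hN

end Rules

end LoopLang

/-! ### Combinatorics of transitive subtournaments -/

namespace TransitiveSearch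

open LoopLang Finset

/-- The triple is a directed triangle. -/
def Cyc (e : ℕ → ℕ → Prop) (u w a : ℕ) : Prop := e u w ∧ e w a ∧ e a u

/-- There is no directed triangle in `P`. -/
def NoCyc (e : ℕ → ℕ → Prop) (P : Finset ℕ) : Prop :=
  ∀ u ∈ P, ∀ w ∈ P, ∀ a ∈ P, ¬ Cyc e u w a

theorem NoCyc.mono {e : ℕ → ℕ → Prop} {P Q : Finset ℕ} (h : NoCyc e Q) (hPQ : P ⊆ Q) :
    NoCyc e P := fun u hu w hw a ha => h u (hPQ hu) w (hPQ hw) a (hPQ ha)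

/-- `e` is the arc relation of a tournament on `0, …, n - 1`. -/
structure IsTour (n : ℕ) (e : ℕ → ℕ → Prop) : Prop where
  asymm : ∀ u w, e u w → ¬ e w u
  total : ∀ u w, u < n → w < n → u ≠ w → e u w ∨ e w u

theorem IsTour.irrefl {n : ℕ} {e : ℕ → ℕ → Prop} (h : IsTour n e) (u : ℕ) : ¬ e u u :=
  fun hu => h.asymm u u hu hu

/-- Inside a set without directed triangles the arc relation is transitive. -/
theorem NoCyc.trans {n : ℕ} {e : ℕ → ℕ → Prop} (ht : IsTour n e) {P : Finset ℕ}
    (hP : P ⊆ range n) (h : NoCyc e P) {u w a : ℕ} (hu : u ∈ P) (hw : w ∈ P) (ha : a ∈ P)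
    (h1 : e u w) (h2 : e w a) : e u a := by
  have hua : u ≠ a := by rintro rfl; exact ht.asymm _ _ h1 h2
  rcases ht.total u a (mem_range.mp (hP hu)) (mem_range.mp (hP ha)) hua with h3 | h3
  · exact h3
  · exact absurd ⟨h1, h2, h3⟩ (h u hu w hw a ha)

/-! #### Sparse subsets of a transitive set -/

open Classical in
/-- A transitive set `O` has a subset `M`, its every `L`-th vertex, such that fewer than `L`
vertices of `O \ M` fit into a gap of `M`. -/
theorem exists_sparse_subset {n : ℕ} {e : ℕ → ℕ → Prop} (ht : IsTour n e) {O : Finset ℕ}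
    (hO : O ⊆ range n) (hc : NoCyc e O) {L : ℕ} (hL : 0 < L) :
    ∃ M ⊆ O, M.card ≤ n / L ∧ ∀ C ⊆ O, (∀ x ∈ C, x ∉ M) →
      (∀ x ∈ C, ∀ y ∈ C, ∀ a ∈ M, ¬ (e x a ∧ e a y)) → C.card < L := by
  -- The position of `v` in the linear order of `O`; the next facts show that it is a bijection onto
  -- `0, …, O.card - 1`.
  set idx : ℕ → ℕ := fun v => (O.filter (fun x => e x v)).card with hidx
  have lt_of : ∀ x ∈ O, ∀ y ∈ O, e x y → idx x < idx y := by
    intro x hx y hy hxy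
    refine card_lt_card ((ssubset_iff_of_subset ?_).mpr ⟨x, ?_, ?_⟩)
    · intro z hz
      rw [mem_filter] at hz ⊢
      exact ⟨hz.1, hc.trans ht hO hz.1 hx hy hz.2 hxy⟩
    · simp [hx, hxy]
    · simp [ht.irrefl x]
  have tot : ∀ x ∈ O, ∀ y ∈ O, x ≠ y → e x y ∨ e y x := fun x hx y hy =>
    ht.total x y (mem_range.mp (hO hx)) (mem_range.mp (hO hy))
  have inj : ∀ x ∈ O, ∀ y ∈ O, idx x = idx y → x = y := by
    intro x hx y hy hxy
    by_contra hne
    rcases tot x hx y hy hne with h | h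
    · have := lt_of x hx y hy h; omega
    · have := lt_of y hy x hx h; omega
  have idx_lt : ∀ x ∈ O, idx x < O.card := by
    intro x hx
    refine card_lt_card ((ssubset_iff_of_subset (filter_subset _ _)).mpr ⟨x, hx, ?_⟩)
    simp [ht.irrefl x]
  have surj : ∀ t < O.card, ∃ x ∈ O, idx x = t := by
    have him : O.image idx = range O.card := by
      refine eq_of_subset_of_card_le ?_ ?_
      · intro t h
        obtain ⟨x, hx, rfl⟩ := mem_image.mp h
        exact mem_range.mpr (idx_lt x hx)
      · rw [card_range, card_image_of_injOn fun x hx y hy => inj x hx y hy]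
    intro t h
    have : t ∈ O.image idx := him ▸ mem_range.mpr h
    exact mem_image.mp this
  -- Choosing the last position of each block of length `L` means that only complete blocks
  -- contribute to `M`, which gives the rounded-down bound `n / L`.
  refine ⟨O.filter (fun v => idx v % L = L - 1), filter_subset _ _, ?_, ?_⟩
  · have hcard : (O.filter (fun v => idx v % L = L - 1)).card ≤ (range (n / L)).card := by
      refine card_le_card_of_injOn (fun v => idx v / L) ?_ ?_
      · intro v hv
        obtain ⟨hv1, hv2⟩ := mem_filter.mp hv
        have h1 := idx_lt v hv1
        have h2 : O.card ≤ n := by simpa using card_le_card hO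
        have h3 := Nat.div_add_mod (idx v) L
        rw [coe_range, Set.mem_Iio]
        show idx v / L < n / L
        rw [Nat.lt_iff_add_one_le, Nat.le_div_iff_mul_le hL]
        have : (idx v / L + 1) * L = L * (idx v / L) + L := by ring
        omega
      · intro v hv w hw hvw
        obtain ⟨hv1, hv2⟩ := mem_filter.mp hv
        obtain ⟨hw1, hw2⟩ := mem_filter.mp hw
        refine inj v hv1 w hw1 ?_
        have hvw' : idx v / L = idx w / L := hvw
        rw [← Nat.div_add_mod (idx v) L, ← Nat.div_add_mod (idx w) L, hvw', hv2, hw2]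
    simpa using hcard
  · intro C hCO hCM hsep
    -- If `x` lay in an earlier block than `y`, the last vertex of the block of `x` would be in `M`
    -- and separate them. So `C` lies in one block, and its residues avoid `L - 1`.
    have key : ∀ x ∈ C, ∀ y ∈ C, ¬ idx x / L < idx y / L := by
      intro x hx y hy hlt
      have hxO := hCO hx
      have hyO := hCO hy
      set t := L * (idx x / L) + (L - 1) with htdef
      have h1 : t < idx y := by
        have h3 : L * (idx x / L + 1) ≤ idx y :=
          (Nat.mul_le_mul_left L hlt).trans (Nat.mul_div_le _ _)
        rw [mul_add, mul_one] at h3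
        omega
      obtain ⟨a, haO, hat⟩ := surj t (h1.trans (idx_lt y hyO))
      have haM : a ∈ O.filter (fun v => idx v % L = L - 1) := by
        refine mem_filter.mpr ⟨haO, ?_⟩
        rw [hat, htdef, Nat.mul_add_mod, Nat.mod_eq_of_lt (by omega)]
      have h2 : idx x ≤ t := by
        have := Nat.div_add_mod (idx x) L
        have := Nat.mod_lt (idx x) hL
        omega
      refine hsep x hx y hy a haM ⟨?_, ?_⟩
      · have hne : x ≠ a := by rintro rfl; exact hCM _ hx haM
        rcases tot x hxO a haO hne with h | h
        · exact h
        · have := lt_of a haO x hxO h; omega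
      · have hne : a ≠ y := by rintro rfl; omega
        rcases tot a haO y hyO hne with h | h
        · exact h
        · have := lt_of y hyO a haO h; omega
    have hcard : C.card ≤ (range (L - 1)).card := by
      refine card_le_card_of_injOn (fun v => idx v % L) ?_ ?_
      · intro v hv
        have h1 : idx v % L ≠ L - 1 := fun h => hCM v hv (mem_filter.mpr ⟨hCO hv, h⟩)
        have h2 := Nat.mod_lt (idx v) hL
        rw [coe_range, Set.mem_Iio]
        show idx v % L < L - 1
        omega
      · intro v hv w hw hvw
        refine inj v (hCO hv) w (hCO hw) ?_
        have hvw' : idx v % L = idx w % L := hvw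
        have h1 := key v hv w hw
        have h2 := key w hw v hv
        rw [← Nat.div_add_mod (idx v) L, ← Nat.div_add_mod (idx w) L, hvw',
          show idx v / L = idx w / L by omega]
    rw [card_range] at hcard
    omega

/-! #### Enumerations by counters -/

/-- A decoder consumes a counter while it makes decisions. The desired decisions are followed
forwards from `q` to `q'`, and the counter that causes them is recovered backwards: any remainder
admissible after a step is left over by some counter admissible before it. Only the existence of a
counter matters, not its uniqueness. -/
theorem iter_lift {Q : Type*} {f : ℕ → Q × ℕ → Q × ℕ} {G : ℕ → Q → Prop} {B : ℕ → Q → ℕ} {N : ℕ}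
    (h : ∀ i < N, ∀ q, G i q → ∃ q', G (i + 1) q' ∧ ∀ c' < B (i + 1) q', ∃ c < B i q,
      f i (q, c) = (q', c')) {q : Q} (hq : G 0 q) :
    ∃ q', G N q' ∧ ∀ c' < B N q', ∃ c < B 0 q, iter f N (q, c) = (q', c') := by
  induction N with
  | zero => exact ⟨q, hq, fun c' hc' => ⟨c', hc', rfl⟩⟩
  | succ N ih =>
    obtain ⟨q1, hq1, h1⟩ := ih fun i hi => h i (by omega)
    obtain ⟨q2, hq2, h2⟩ := h N (by omega) q1 hq1
    refine ⟨q2, hq2, fun c' hc' => ?_⟩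
    obtain ⟨c1, hc1, e1⟩ := h2 c' hc'
    obtain ⟨c, hc, e2⟩ := h1 c1 hc1
    exact ⟨c, hc, by simp only [iter]; rw [e2, e1]⟩

/-- The number of subsets of at most `b` elements of a set of `r` elements. -/
def subCount : ℕ → ℕ → ℕ
  | 0, _ => 1
  | _ + 1, 0 => 1
  | r + 1, b + 1 => subCount r (b + 1) + subCount r b

theorem subCount_zero_right (r : ℕ) : subCount r 0 = 1 := by cases r <;> rfl

theorem subCount_pos (r b : ℕ) : 0 < subCount r b := by
  induction r generalizing b with
  | zero => simp [subCount]
  | succ r ih =>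
    cases b with
    | zero => simp [subCount]
    | succ b => simp only [subCount]; have := ih b; omega

theorem subCount_le_succ (r b : ℕ) : subCount r b ≤ subCount (r + 1) b := by
  cases b with
  | zero => simp [subCount_zero_right]
  | succ b => simp [subCount]

theorem subCount_le_two_pow (r b : ℕ) : subCount r b ≤ 2 ^ r := by
  induction r generalizing b with
  | zero => simp [subCount]
  | succ r ih =>
    cases b with
    | zero => simp only [subCount]; exact Nat.one_le_two_pow
    | succ b =>
      simp only [subCount]
      have := ih b; have := ih (b + 1); rw [pow_succ]; omega

theorem subCount_le_pow (r b : ℕ) : subCount r b ≤ (r + 1) ^ b := by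
  induction r generalizing b with
  | zero => simp [subCount]
  | succ r ih =>
    cases b with
    | zero => simp [subCount]
    | succ b =>
      simp only [subCount]
      calc subCount r (b + 1) + subCount r b ≤ (r + 1) ^ (b + 1) + (r + 1) ^ b :=
            Nat.add_le_add (ih _) (ih _)
        _ = (r + 1) ^ b * (r + 1 + 1) := by ring
        _ ≤ (r + 1 + 1) ^ b * (r + 1 + 1) :=
            Nat.mul_le_mul_right _ (Nat.pow_le_pow_left (by omega) _)
        _ = (r + 1 + 1) ^ (b + 1) := by ring

/-- The usual weighting argument: give a subset `X` the weight `y ^ (b - |X|)`, which is at least 1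
if `|X| ≤ b`. All subsets together weigh `(1 + 1 / y) ^ r * y ^ b`, and this expression satisfies
the recursion of `subCount` with equality. -/
theorem subCount_le_weight (r b : ℕ) {y : ℝ} (hy : 1 ≤ y) :
    (subCount r b : ℝ) ≤ (1 + 1 / y) ^ r * y ^ b := by
  have hy0 : 0 < y := by linarith
  induction r generalizing b with
  | zero => simpa [subCount] using one_le_pow₀ hy
  | succ r ih =>
    cases b with
    | zero =>
      simp only [subCount, Nat.cast_one, pow_zero, mul_one]
      exact one_le_pow₀ (by have : 0 < 1 / y := by positivity
                            linarith)
    | succ b =>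
      simp only [subCount, Nat.cast_add]
      refine (add_le_add (ih (b + 1)) (ih b)).trans (le_of_eq ?_)
      rw [pow_succ, pow_succ]
      field_simp

/-- Decide on vertex `i` in the decoding of a subset; the state consists of the characteristic
vector, the remaining number of elements and the remaining counter. -/
def unrankStep (n i : ℕ) (p : ((ℕ → ℕ) × ℕ) × ℕ) : ((ℕ → ℕ) × ℕ) × ℕ :=
  if p.2 < subCount (n - 1 - i) p.1.2 then ((Function.update p.1.1 i 0, p.1.2), p.2)
  else ((Function.update p.1.1 i 1, p.1.2 - 1), p.2 - subCount (n - 1 - i) p.1.2)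

/-- The subset of at most `b` elements with number `c`. -/
def unrank (n b c : ℕ) : ℕ → ℕ := (iter (unrankStep n) n ((fun _ => 0, b), c)).1.1

theorem unrank_le_one (n b c : ℕ) {j : ℕ} (hj : j < n) : unrank n b c j ≤ 1 := by
  have : ∀ N, ∀ j < N, (iter (unrankStep n) N ((fun _ => 0, b), c)).1.1 j ≤ 1 := by
    intro N
    induction N with
    | zero => simp
    | succ N ih =>
      intro j hj
      simp only [iter, unrankStep]
      split_ifs <;> simp only [Function.update_apply] <;> split_ifs
      · omega
      · exact ih j (by omega)
      · omega
      · exact ih j (by omega)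
  exact this n j hj

-- The decoder is steered along `Y`. The remaining budget always bounds the number of elements of
-- `Y` still to come, and the counter ranges below the number of subsets of the remaining vertices
-- within that budget.
open Classical in
theorem exists_unrank (n b : ℕ) (Y : Finset ℕ) (hY : Y.card ≤ b) :
    ∃ c < subCount n b, ∀ j < n, unrank n b c j = if j ∈ Y then 1 else 0 := by
  set G : ℕ → (ℕ → ℕ) × ℕ → Prop := fun i q => (∀ j < i, q.1 j = if j ∈ Y then 1 else 0) ∧
    (Y.filter (fun j => i ≤ j)).card ≤ q.2 with hG
  have step : ∀ i < n, ∀ q, G i q → ∃ q', G (i + 1) q' ∧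
      ∀ c' < subCount (n - (i + 1)) q'.2, ∃ c < subCount (n - i) q.2,
        unrankStep n i (q, c) = (q', c') := by
    rintro i hi ⟨Z, b'⟩ ⟨hZ, hb⟩
    have hn : n - i = n - 1 - i + 1 := by omega
    have hn' : n - (i + 1) = n - 1 - i := by omega
    simp only at hZ hb
    by_cases hiY : i ∈ Y
    · have hins : Y.filter (fun j => i ≤ j) = insert i (Y.filter (fun j => i + 1 ≤ j)) := by
        ext j; simp only [mem_filter, mem_insert]
        constructor
        · rintro ⟨h1, h2⟩
          rcases h2.eq_or_lt with h | h
          · exact Or.inl h.symm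
          · exact Or.inr ⟨h1, h⟩
        · rintro (rfl | ⟨h1, h2⟩)
          · exact ⟨hiY, le_rfl⟩
          · exact ⟨h1, by omega⟩
      rw [hins, card_insert_of_notMem (by simp)] at hb
      obtain ⟨b'', rfl⟩ : ∃ b'', b' = b'' + 1 := ⟨b' - 1, by omega⟩
      refine ⟨(Function.update Z i 1, b''), ⟨?_, by simpa using hb⟩, ?_⟩
      · intro j hj
        simp only [Function.update_apply]
        split_ifs with h1 h2 h2
        · rfl
        · exact absurd (h1 ▸ hiY) h2
        · rw [hZ j (by omega), if_pos h2]
        · rw [hZ j (by omega), if_neg h2]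
      · intro c' hc'
        simp only [hn'] at hc'
        -- The counters of the subsets without `i` come first; those with `i` are shifted by their
        -- number.
        refine ⟨c' + subCount (n - 1 - i) (b'' + 1), ?_, ?_⟩
        · simp only [hn, subCount]; omega
        · simp only [unrankStep]
          rw [if_neg (by omega)]
          simp
    · have hfil : Y.filter (fun j => i + 1 ≤ j) ⊆ Y.filter (fun j => i ≤ j) := by
        intro j; simp only [mem_filter]
        exact fun h => ⟨h.1, by omega⟩
      refine ⟨(Function.update Z i 0, b'), ⟨?_, (card_le_card hfil).trans hb⟩, ?_⟩
      · intro j hj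
        simp only [Function.update_apply]
        split_ifs with h1 h2 h2
        · exact absurd (h1 ▸ h2) hiY
        · rfl
        · rw [hZ j (by omega), if_pos h2]
        · rw [hZ j (by omega), if_neg h2]
      · intro c' hc'
        simp only [hn'] at hc'
        refine ⟨c', ?_, ?_⟩
        · simp only [hn]; exact hc'.trans_le (subCount_le_succ _ _)
        · simp only [unrankStep]
          rw [if_pos hc']
  obtain ⟨q, hq, h⟩ := iter_lift (f := unrankStep n) (N := n) (q := (fun _ => 0, b)) (G := G)
    (B := fun i q => subCount (n - i) q.2) step ⟨by simp, by simpa using hY⟩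
  obtain ⟨c, hc, e⟩ := h 0 (subCount_pos _ _)
  refine ⟨c, by simpa using hc, ?_⟩
  unfold unrank
  rw [e]
  exact hq.1

/-! #### Branching on conflicts

The state of a vertex is `0` if it is undecided, `1` if it is kept and `2` if it is deleted. -/

open Classical in
/-- Treat the triangle `u`, `w`, `a` if `a` is kept and `u` is undecided: if `w` is kept, then `u`
is deleted; if `w` is undecided, then the counter tells whether `u` is deleted or kept. -/
noncomputable def conflictStep (e : ℕ → ℕ → Prop) (u w a : ℕ) (p : ((ℕ → ℕ) × ℕ × ℕ) × ℕ) :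
    ((ℕ → ℕ) × ℕ × ℕ) × ℕ :=
  if p.1.1 a = 1 ∧ p.1.1 u = 0 ∧ Cyc e u w a then
    if p.1.1 w = 1 then ((Function.update p.1.1 u 2, p.1.2), p.2)
    else if p.1.1 w = 0 then
      if p.2 < p.1.2.2 then
        ((Function.update p.1.1 u 2, p.1.2.2, p.1.2.1 - p.1.2.2), p.2)
      else ((Function.update (Function.update p.1.1 u 1) w 2, p.1.2.1 - p.1.2.2,
        p.1.2.2 - (p.1.2.1 - p.1.2.2)), p.2 - p.1.2.2)
    else p
  else p

/-- All ordered triples are visited, hence all three rotations of every triangle; a step may thus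
fix which vertex is kept and which is undecided. -/
noncomputable def conflictPass (e : ℕ → ℕ → Prop) (n : ℕ) :
    ((ℕ → ℕ) × ℕ × ℕ) × ℕ → ((ℕ → ℕ) × ℕ × ℕ) × ℕ :=
  iter (fun u => iter (fun w => iter (fun a => conflictStep e u w a) n) n) n

noncomputable def conflictAll (e : ℕ → ℕ → Prop) (n : ℕ) :
    ((ℕ → ℕ) × ℕ × ℕ) × ℕ → ((ℕ → ℕ) × ℕ × ℕ) × ℕ :=
  iter (fun _ => conflictPass e n) (n + 1)

/-- The number of undecided vertices. -/
def undecided (n : ℕ) (st : ℕ → ℕ) : ℕ := ((range n).filter (fun j => st j = 0)).card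

theorem undecided_update {n : ℕ} {st : ℕ → ℕ} {u x : ℕ} (hu : u < n) (h0 : st u = 0)
    (hx : x ≠ 0) : undecided n (Function.update st u x) + 1 = undecided n st := by
  have hmem : u ∈ (range n).filter (fun j => st j = 0) := by simp [hu, h0]
  have : (range n).filter (fun j => Function.update st u x j = 0) =
      ((range n).filter (fun j => st j = 0)).erase u := by
    ext j
    simp only [mem_filter, mem_erase, Function.update_apply]
    split_ifs with h <;> simp [h, hx]
  unfold undecided
  rw [this, card_erase_of_mem hmem]
  have := card_pos.mpr ⟨u, hmem⟩
  omega

/-- `f` changes nothing or lowers `μ`; in the former case each member of the family does. -/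
theorem iter_eq_or_lt {α : Type*} {f : ℕ → α → α} {μ : α → ℕ} {N : ℕ}
    (h : ∀ i < N, ∀ p, f i p = p ∨ μ (f i p) < μ p) (p : α) :
    (iter f N p = p ∧ ∀ i < N, f i p = p) ∨ μ (iter f N p) < μ p := by
  induction N with
  | zero => exact Or.inl ⟨rfl, by simp⟩
  | succ N ih =>
    simp only [iter]
    rcases ih fun i hi => h i (by omega) with ⟨h1, h2⟩ | h1
    · rw [h1]
      rcases h N (by omega) p with h3 | h3
      · refine Or.inl ⟨h3, fun i hi => ?_⟩
        rcases Nat.lt_succ_iff_lt_or_eq.mp hi with h4 | rfl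
        exacts [h2 i h4, h3]
      · exact Or.inr h3
    · rcases h N (by omega) (iter f N p) with h3 | h3
      · rw [h3]; exact Or.inr h1
      · exact Or.inr (h3.trans h1)

/-- Once `g` changes nothing it never does again, and `μ` cannot drop `N` times from a value below
`N`. -/
theorem iter_fixed {α : Type*} {g : α → α} {μ : α → ℕ} (h : ∀ p, g p = p ∨ μ (g p) < μ p)
    {N : ℕ} {p : α} (hp : μ p < N) : g (iter (fun _ => g) N p) = iter (fun _ => g) N p := by
  have : ∀ k, g (iter (fun _ => g) k p) = iter (fun _ => g) k p ∨
      μ (iter (fun _ => g) k p) + k ≤ μ p := by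
    intro k
    induction k with
    | zero => exact Or.inr le_rfl
    | succ k ih =>
      simp only [iter]
      rcases ih with h1 | h1
      · left; rw [h1, h1]
      · rcases h (iter (fun _ => g) k p) with h2 | h2
        · left; rw [h2, h2]
        · right; omega
  rcases this N with h1 | h1
  · exact h1
  · omega

theorem conflictStep_eq_or_lt {e : ℕ → ℕ → Prop} {n : ℕ} (ht : IsTour n e) {u w a : ℕ}
    (hu : u < n) (hw : w < n) (p : ((ℕ → ℕ) × ℕ × ℕ) × ℕ) :
    conflictStep e u w a p = p ∨
      undecided n (conflictStep e u w a p).1.1 < undecided n p.1.1 := by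
  unfold conflictStep
  split_ifs with h1 h2 h3 h4
  · right
    have := undecided_update (x := 2) hu h1.2.1 (by norm_num)
    simp only; omega
  · right
    have := undecided_update (x := 2) hu h1.2.1 (by norm_num)
    simp only; omega
  · right
    have huw : w ≠ u := by rintro rfl; exact ht.irrefl _ h1.2.2.1
    have h5 := undecided_update (x := 1) hu h1.2.1 (by norm_num)
    have h6 := undecided_update (n := n) (st := Function.update p.1.1 u 1) (u := w) (x := 2) hw
      (by rw [Function.update_apply, if_neg huw]; exact h3) (by norm_num)
    simp only; omega
  · exact Or.inl rfl
  · exact Or.inl rfl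

/-- No conflict is left. -/
def ConflictFree (e : ℕ → ℕ → Prop) (n : ℕ) (st : ℕ → ℕ) : Prop :=
  ∀ u < n, ∀ w < n, ∀ a < n, st a = 1 → st u = 0 → Cyc e u w a → st w ≠ 1 ∧ st w ≠ 0

/-- A step that acts decides at least one vertex, whatever the counter says. At most `n` vertices
are undecided, so the state after `n + 1` passes is fixed by a further pass, and then by each single
step of it. -/
theorem conflictFree_conflictAll {e : ℕ → ℕ → Prop} {n : ℕ} (ht : IsTour n e)
    (p : ((ℕ → ℕ) × ℕ × ℕ) × ℕ) : ConflictFree e n (conflictAll e n p).1.1 := by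
  set μ : ((ℕ → ℕ) × ℕ × ℕ) × ℕ → ℕ := fun p => undecided n p.1.1 with hμ
  have h1 : ∀ u < n, ∀ w < n, ∀ p, (iter (fun a => conflictStep e u w a) n p = p ∧
      ∀ a < n, conflictStep e u w a p = p) ∨
      μ (iter (fun a => conflictStep e u w a) n p) < μ p := fun u hu w hw =>
    iter_eq_or_lt fun a _ p => conflictStep_eq_or_lt ht hu hw p
  have h2 : ∀ u < n, ∀ p, (iter (fun w => iter (fun a => conflictStep e u w a) n) n p = p ∧
      ∀ w < n, iter (fun a => conflictStep e u w a) n p = p) ∨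
      μ (iter (fun w => iter (fun a => conflictStep e u w a) n) n p) < μ p := fun u hu =>
    iter_eq_or_lt fun w hw p => (h1 u hu w hw p).imp_left And.left
  have h3 : ∀ p, (conflictPass e n p = p ∧
      ∀ u < n, iter (fun w => iter (fun a => conflictStep e u w a) n) n p = p) ∨
      μ (conflictPass e n p) < μ p :=
    iter_eq_or_lt fun u hu p => (h2 u hu p).imp_left And.left
  have hfix : conflictPass e n (conflictAll e n p) = conflictAll e n p := by
    refine iter_fixed (μ := μ) (fun p => (h3 p).imp_left And.left) ?_
    have : undecided n p.1.1 ≤ (range n).card := card_filter_le _ _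
    rw [card_range] at this
    exact Nat.lt_succ_of_le this
  generalize conflictAll e n p = q at hfix
  intro u hu w hw a ha hsa hsu hcyc
  have k3 := (h3 q).resolve_right (by rw [hfix]; exact lt_irrefl _)
  have k2 := (h2 u hu q).resolve_right (by rw [k3.2 u hu]; exact lt_irrefl _)
  have k1 := (h1 u hu w hw q).resolve_right (by rw [k2.2 w hw]; exact lt_irrefl _)
  have huw : u ≠ w := by rintro rfl; exact ht.irrefl _ hcyc.1
  -- A step that meets a conflict always changes the state of `u`, from 0 to 1 or 2; comparing it
  -- before and after contradicts the fixed point.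
  have hst := congrArg (fun p => p.1.1 u) (k1.2 a ha)
  simp only [conflictStep, hsa, hsu, hcyc, true_and, if_true] at hst
  constructor
  · intro hw1
    simp [hw1] at hst
  · intro hw0
    simp only [hw0, zero_ne_one, if_false, if_true] at hst
    split_ifs at hst
    · simp at hst
    · simp [huw] at hst

/-- The decisions in `st` are those of the set `O`, and `M` is kept. -/
def Consistent (n : ℕ) (O M : Finset ℕ) (st : ℕ → ℕ) : Prop :=
  ∀ j < n, (st j = 1 → j ∈ O) ∧ (st j = 2 → j ∉ O) ∧ st j ≤ 2 ∧ (j ∈ M → st j = 1)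

theorem Consistent.update {n : ℕ} {O M : Finset ℕ} {st : ℕ → ℕ} (h : Consistent n O M st)
    {u x : ℕ} (h0 : st u = 0) (hx : x = 1 ∧ u ∈ O ∨ x = 2 ∧ u ∉ O) :
    Consistent n O M (Function.update st u x) := by
  intro j hj
  by_cases hju : j = u
  · subst hju
    have hM : j ∉ M := fun hM => by have := (h j hj).2.2.2 hM; omega
    rw [Function.update_self]
    rcases hx with ⟨rfl, hO⟩ | ⟨rfl, hO⟩ <;> simp [hO, hM]
  · rw [Function.update_of_ne hju]
    exact h j hj

/-- Every decision is made as `O` demands. The invariant is that the two stored numbers are `Nat.fib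
(i + 1)` and `Nat.fib i` with at most `i` vertices undecided. Deleting `u` passes to `i - 1` and
uses the counters below `Nat.fib i`; keeping `u` forces `w` out, since `O` has no triangle, and
passes to `i - 2` with the other `Nat.fib (i - 1)` counters. A forced deletion consumes nothing. -/
theorem exists_conflictAll {e : ℕ → ℕ → Prop} {n : ℕ} (ht : IsTour n e) {O M : Finset ℕ}
    (hO : NoCyc e O) {st : ℕ → ℕ} (hst : Consistent n O M st) :
    ∃ c < Nat.fib (n + 1), Consistent n O M
      (conflictAll e n ((st, Nat.fib (n + 1), Nat.fib n), c)).1.1 := by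
  set G : (ℕ → ℕ) × ℕ × ℕ → Prop := fun q => Consistent n O M q.1 ∧
    ∃ i, q.2.1 = Nat.fib (i + 1) ∧ q.2.2 = Nat.fib i ∧ undecided n q.1 ≤ i with hG
  set B : (ℕ → ℕ) × ℕ × ℕ → ℕ := fun q => q.2.1 with hB
  have step : ∀ u < n, ∀ w < n, ∀ a < n, ∀ q, G q → ∃ q', G q' ∧ ∀ c' < B q', ∃ c < B q,
      conflictStep e u w a (q, c) = (q', c') := by
    rintro u hu w hw a ha ⟨s, fa, fb⟩ ⟨hs, i, hfa, hfb, hi⟩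
    simp only at hs hfa hfb hi
    subst hfa hfb
    by_cases h1 : s a = 1 ∧ s u = 0 ∧ Cyc e u w a
    swap
    · exact ⟨_, ⟨hs, i, rfl, rfl, hi⟩, fun c' hc' => ⟨c', hc', by
        simp only [conflictStep]; rw [if_neg h1]⟩⟩
    have haO := (hs a ha).1 h1.1
    have huw : w ≠ u := by rintro rfl; exact ht.irrefl _ h1.2.2.1
    have hund := fun x (hx : x ≠ 0) => undecided_update (x := x) hu h1.2.1 hx
    by_cases hw1 : s w = 1
    · have huO : u ∉ O := fun huO => hO u huO w ((hs w hw).1 hw1) a haO h1.2.2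
      refine ⟨(Function.update s u 2, Nat.fib (i + 1), Nat.fib i),
        ⟨hs.update h1.2.1 (Or.inr ⟨rfl, huO⟩), i, rfl, rfl, ?_⟩,
        fun c' hc' => ⟨c', hc', ?_⟩⟩
      · have := hund 2 (by norm_num); simp only; omega
      · simp only [conflictStep]; rw [if_pos h1, if_pos hw1]
    by_cases hw0 : s w = 0
    swap
    · exact ⟨_, ⟨hs, i, rfl, rfl, hi⟩, fun c' hc' => ⟨c', hc', by
        simp only [conflictStep]; rw [if_pos h1, if_neg hw1, if_neg hw0]⟩⟩
    by_cases huO : u ∈ O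
    · have hwO : w ∉ O := fun hwO => hO u huO w hwO a haO h1.2.2
      have h5 := hund 1 (by norm_num)
      have hw0' : Function.update s u 1 w = 0 := by rw [Function.update_of_ne huw]; exact hw0
      have h6 := undecided_update (x := 2) hw hw0' (by norm_num)
      -- Both `u` and `w` are undecided, so `i` is at least 2.
      obtain ⟨i', rfl⟩ : ∃ i', i = i' + 2 := ⟨i - 2, by omega⟩
      have k1 : Nat.fib (i' + 2 + 1) = Nat.fib (i' + 1) + Nat.fib (i' + 2) := Nat.fib_add_two
      have k2 : Nat.fib (i' + 2) = Nat.fib i' + Nat.fib (i' + 1) := Nat.fib_add_two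
      refine ⟨(Function.update (Function.update s u 1) w 2, Nat.fib (i' + 1), Nat.fib i'),
        ⟨(hs.update h1.2.1 (Or.inl ⟨rfl, huO⟩)).update hw0' (Or.inr ⟨rfl, hwO⟩), i', rfl, rfl,
          ?_⟩, fun c' hc' => ⟨c' + Nat.fib (i' + 2), ?_, ?_⟩⟩
      · simp only; omega
      · simp only [hB] at hc' ⊢
        omega
      · simp only [conflictStep]
        rw [if_pos h1, if_neg hw1, if_pos hw0, if_neg (by omega), k1, k2]
        simp
    · have h5 := hund 2 (by norm_num)
      obtain ⟨i', rfl⟩ : ∃ i', i = i' + 1 := ⟨i - 1, by omega⟩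
      have k2 : Nat.fib (i' + 1 + 1) = Nat.fib i' + Nat.fib (i' + 1) := Nat.fib_add_two
      refine ⟨(Function.update s u 2, Nat.fib (i' + 1), Nat.fib i'),
        ⟨hs.update h1.2.1 (Or.inr ⟨rfl, huO⟩), i', rfl, rfl, ?_⟩, fun c' hc' => ⟨c', ?_, ?_⟩⟩
      · simp only; omega
      · simp only [hB] at hc' ⊢
        omega
      · simp only [hB] at hc'
        simp only [conflictStep]
        rw [if_pos h1, if_neg hw1, if_pos hw0, if_pos hc', k2]
        simp
  obtain ⟨q', hq', h⟩ := iter_lift (f := fun _ => conflictPass e n) (N := n + 1)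
    (G := fun _ => G) (B := fun _ => B) (q := (st, Nat.fib (n + 1), Nat.fib n))
    (fun _ _ q hq => iter_lift (G := fun _ => G) (B := fun _ => B)
      (fun u hu q hq => iter_lift (G := fun _ => G) (B := fun _ => B)
        (fun w hw q hq => iter_lift (G := fun _ => G) (B := fun _ => B)
          (fun a ha q hq => step u hu w hw a ha q hq) hq) hq) hq)
    ⟨hst, n, rfl, rfl, by simpa [undecided] using card_filter_le (range n) (fun j => st j = 0)⟩
  obtain ⟨-, i, hi, -⟩ := id hq'
  obtain ⟨c, hc, hc'⟩ := h 0 (by simp [hB, hi, Nat.fib_pos])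
  exact ⟨c, hc, by unfold conflictAll; rw [hc']; exact hq'.1⟩

/-! #### Solving a state without conflicts class by class -/

def supp (n : ℕ) (f : ℕ → ℕ) : Finset ℕ := (range n).filter (fun j => f j ≠ 0)

theorem mem_supp {n : ℕ} {f : ℕ → ℕ} {j : ℕ} : j ∈ supp n f ↔ j < n ∧ f j ≠ 0 := by
  simp [supp]

theorem supp_congr {n : ℕ} {f g : ℕ → ℕ} (h : ∀ j < n, f j = g j) : supp n f = supp n g := by
  ext j; simp only [mem_supp]
  constructor <;> rintro ⟨h1, h2⟩ <;> [rw [h j h1] at h2; rw [← h j h1] at h2] <;>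
    exact ⟨h1, h2⟩

open Classical in
/-- The kept vertices to which there is an arc from `w`. -/
noncomputable def keptOut (e : ℕ → ℕ → Prop) (n : ℕ) (st : ℕ → ℕ) (w : ℕ) : Finset ℕ :=
  (range n).filter (fun a => st a = 1 ∧ e w a)

open Classical in
/-- The class of `r`: the undecided vertices that no kept vertex separates from `r`. -/
noncomputable def cls (e : ℕ → ℕ → Prop) (n : ℕ) (st : ℕ → ℕ) (r : ℕ) : Finset ℕ :=
  (range n).filter (fun w => st w = 0 ∧ keptOut e n st w = keptOut e n st r)

open Classical in
/-- The kept vertices, with `X` on the class of `r` and `S` on the other classes. -/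
noncomputable def cand (e : ℕ → ℕ → Prop) (n : ℕ) (st : ℕ → ℕ) (r : ℕ) (S X : ℕ → ℕ) (w : ℕ) : ℕ :=
  if st w = 1 then 1 else if st w = 0 then
    if keptOut e n st w = keptOut e n st r then X w else S w
  else 0

theorem mem_cls {e : ℕ → ℕ → Prop} {n : ℕ} {st : ℕ → ℕ} {r w : ℕ} :
    w ∈ cls e n st r ↔ w < n ∧ st w = 0 ∧ keptOut e n st w = keptOut e n st r := by
  simp [cls]

/-- Acceptance of a candidate. -/
def Improves (e : ℕ → ℕ → Prop) (n : ℕ) (st : ℕ → ℕ) (r : ℕ) (S X : ℕ → ℕ) : Prop :=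
  NoCyc e (supp n (cand e n st r S X)) ∧ ∑ w ∈ cls e n st r, S w < ∑ w ∈ cls e n st r, X w

/-- `S'` results from `S` by trying the candidate given by `X`. -/
def Improved (e : ℕ → ℕ → Prop) (n : ℕ) (st : ℕ → ℕ) (r : ℕ) (X S S' : ℕ → ℕ) : Prop :=
  (Improves e n st r S X → ∀ j < n, S' j = cand e n st r S X j) ∧
    (¬ Improves e n st r S X → ∀ j < n, S' j = S j)

/-- `S` is a partial solution that contains the kept and no deleted vertices. -/
structure Partial (e : ℕ → ℕ → Prop) (n : ℕ) (st S : ℕ → ℕ) : Prop where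
  le_one : ∀ j < n, S j ≤ 1
  kept : ∀ j < n, st j = 1 → S j = 1
  deleted : ∀ j < n, st j = 2 → S j = 0
  noCyc : NoCyc e (supp n S)

theorem Partial.improved {e : ℕ → ℕ → Prop} {n : ℕ} {st : ℕ → ℕ} {r : ℕ} {X S S' : ℕ → ℕ}
    (h : Partial e n st S) (hX : ∀ j < n, X j ≤ 1) (hi : Improved e n st r X S S') :
    Partial e n st S' := by
  by_cases hc : Improves e n st r S X
  · have h' := hi.1 hc
    refine ⟨fun j hj => ?_, fun j hj hs => ?_, fun j hj hs => ?_, ?_⟩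
    · rw [h' j hj]; unfold cand; split_ifs
      exacts [le_rfl, hX j hj, h.le_one j hj, by omega]
    · rw [h' j hj, cand, if_pos hs]
    · rw [h' j hj, cand, if_neg (by omega), if_neg (by omega)]
    · rw [supp_congr h']; exact hc.1
  · have h' := hi.2 hc
    refine ⟨fun j hj => ?_, fun j hj hs => ?_, fun j hj hs => ?_, ?_⟩
    · rw [h' j hj]; exact h.le_one j hj
    · rw [h' j hj]; exact h.kept j hj hs
    · rw [h' j hj]; exact h.deleted j hj hs
    · rw [supp_congr h']; exact h.noCyc

theorem sum_cls_cand {e : ℕ → ℕ → Prop} {n : ℕ} {st : ℕ → ℕ} {r r' : ℕ} {X S : ℕ → ℕ} :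
    ∑ w ∈ cls e n st r', cand e n st r S X w =
      open Classical in if keptOut e n st r' = keptOut e n st r then ∑ w ∈ cls e n st r, X w
        else ∑ w ∈ cls e n st r', S w := by
  split_ifs with h
  · have : cls e n st r' = cls e n st r := by ext w; simp only [mem_cls, h]
    rw [this]
    refine sum_congr rfl fun w hw => ?_
    rw [mem_cls] at hw
    rw [cand, if_neg (by omega), if_pos hw.2.1, if_pos hw.2.2]
  · refine sum_congr rfl fun w hw => ?_
    rw [mem_cls] at hw
    rw [cand, if_neg (by omega), if_pos hw.2.1, if_neg (by rw [hw.2.2]; exact h)]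

/-- An accepted candidate increases the sum over its own class and leaves the other classes alone.
What has been achieved for one class is therefore never lost later. -/
theorem Improved.sum_le {e : ℕ → ℕ → Prop} {n : ℕ} {st : ℕ → ℕ} {r : ℕ} {X S S' : ℕ → ℕ}
    (hi : Improved e n st r X S S') (r' : ℕ) :
    ∑ w ∈ cls e n st r', S w ≤ ∑ w ∈ cls e n st r', S' w := by
  by_cases hc : Improves e n st r S X
  · have h' := hi.1 hc
    rw [sum_congr rfl fun w hw => h' w (mem_cls.mp hw).1, sum_cls_cand]
    split_ifs with h
    · have : cls e n st r' = cls e n st r := by ext w; simp only [mem_cls, h]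
      rw [this]; exact hc.2.le
    · exact le_rfl
  · have h' := hi.2 hc
    exact le_of_eq (sum_congr rfl fun w hw => (h' w (mem_cls.mp hw).1).symm)

/-- Without conflicts a triangle of the kept and undecided vertices lies in a single class. -/
theorem ConflictFree.triangle {e : ℕ → ℕ → Prop} {n : ℕ} {st : ℕ → ℕ} (ht : IsTour n e)
    (hf : ConflictFree e n st) (hK : NoCyc e ((range n).filter (fun j => st j = 1)))
    {u w a : ℕ} (hu : u < n) (hw : w < n) (ha : a < n) (su : st u ≤ 1) (sw : st w ≤ 1)
    (sa : st a ≤ 1) (hc : Cyc e u w a) :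
    (st u = 0 ∧ st w = 0 ∧ st a = 0) ∧ keptOut e n st w = keptOut e n st u ∧
      keptOut e n st a = keptOut e n st u := by
  have hc1 : Cyc e w a u := ⟨hc.2.1, hc.2.2, hc.1⟩
  have hc2 : Cyc e a u w := ⟨hc.2.2, hc.1, hc.2.1⟩
  have f1 := hf u hu w hw a ha
  have f2 := hf w hw a ha u hu
  have f3 := hf a ha u hu w hw
  have hall : ¬ (st u = 1 ∧ st w = 1 ∧ st a = 1) := fun h =>
    hK u (by simp [hu, h]) w (by simp [hw, h]) a (by simp [ha, h]) hc
  -- In each rotation a kept third vertex and an undecided first one would force the second to be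
  -- deleted. So kept and undecided vertices do not mix, and all three kept is excluded by `hK`.
  have h0 : st u = 0 ∧ st w = 0 ∧ st a = 0 := by
    have g1 : st a = 1 → st u = 0 → False := fun x y => by have := f1 x y hc; omega
    have g2 : st u = 1 → st w = 0 → False := fun x y => by have := f2 x y hc1; omega
    have g3 : st w = 1 → st a = 0 → False := fun x y => by have := f3 x y hc2; omega
    have : st u = 0 ∨ st u = 1 := by omega
    have : st w = 0 ∨ st w = 1 := by omega
    have : st a = 0 ∨ st a = 1 := by omega
    tauto
  -- If a kept `b` had `y → b` but `b → x`, then `x`, `y`, `b` would be a conflict. Going once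
  -- around the triangle turns the three inclusions into equalities.
  have sub : ∀ x < n, ∀ y < n, st x = 0 → st y = 0 → e x y →
      keptOut e n st y ⊆ keptOut e n st x := by
    intro x hx y hy sx sy hxy b hb
    simp only [keptOut, mem_filter, mem_range] at hb ⊢
    refine ⟨hb.1, hb.2.1, ?_⟩
    have hne : x ≠ b := by rintro rfl; omega
    rcases ht.total x b hx hb.1 hne with h | h
    · exact h
    · exact absurd sy (hf x hx y hy b hb.1 hb.2.1 sx ⟨hxy, hb.2.2, h⟩).2
  have s1 := sub u hu w hw h0.1 h0.2.1 hc.1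
  have s2 := sub w hw a ha h0.2.1 h0.2.2 hc.2.1
  have s3 := sub a ha u hu h0.2.2 h0.1 hc.2.2
  exact ⟨h0, s1.antisymm (s3.trans s2), (s2.trans s1).antisymm s3⟩

-- The candidate that agrees with `O` on the class has no triangle: by `ConflictFree.triangle` a
-- triangle would lie in one class, hence in `O` or in the old partial solution. So it is accepted
-- unless the class was already solved at least as well.
open Classical in
theorem Improved.le_sum {e : ℕ → ℕ → Prop} {n : ℕ} {st : ℕ → ℕ} {r : ℕ} {X S S' : ℕ → ℕ}
    (hi : Improved e n st r X S S') (ht : IsTour n e) (hf : ConflictFree e n st)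
    {O M : Finset ℕ} (hO : NoCyc e O) (hst : Consistent n O M st) (hS : Partial e n st S)
    (hX : ∀ j < n, X j = if j ∈ O ∩ cls e n st r then 1 else 0) :
    (O ∩ cls e n st r).card ≤ ∑ w ∈ cls e n st r, S' w := by
  have hXsum : ∑ w ∈ cls e n st r, X w = (O ∩ cls e n st r).card := by
    rw [sum_congr rfl fun w hw => hX w (mem_cls.mp hw).1, ← sum_filter, sum_const,
      smul_eq_mul, mul_one]
    congr 1; ext w; simp only [mem_filter, mem_inter]; tauto
  have hK : NoCyc e ((range n).filter (fun j => st j = 1)) := hO.mono fun j hj => by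
    simp only [mem_filter, mem_range] at hj
    exact (hst j hj.1).1 hj.2
  have hno : NoCyc e (supp n (cand e n st r S X)) := by
    have le1 : ∀ x, x ∈ supp n (cand e n st r S X) → st x ≤ 1 := by
      intro x hx
      rw [mem_supp] at hx
      by_contra h
      exact hx.2 (by rw [cand, if_neg (by omega), if_neg (by omega)])
    intro u hu w hw a ha hc
    obtain ⟨h0, hw', ha'⟩ := hf.triangle ht hK (mem_supp.mp hu).1 (mem_supp.mp hw).1
      (mem_supp.mp ha).1 (le1 u hu) (le1 w hw) (le1 a ha) hc
    by_cases hr : keptOut e n st u = keptOut e n st r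
    · have mem : ∀ x, x ∈ supp n (cand e n st r S X) → st x = 0 →
          keptOut e n st x = keptOut e n st u → x ∈ O := by
        intro x hx sx kx
        rw [mem_supp] at hx
        have h2 := hx.2
        rw [cand, if_neg (by omega), if_pos sx, if_pos (kx.trans hr), hX x hx.1] at h2
        by_contra hxO
        exact h2 (if_neg fun h => hxO (mem_inter.mp h).1)
      exact hO u (mem u hu h0.1 rfl) w (mem w hw h0.2.1 hw') a (mem a ha h0.2.2 ha') hc
    · have mem : ∀ x, x ∈ supp n (cand e n st r S X) → st x = 0 →
          keptOut e n st x = keptOut e n st u → x ∈ supp n S := by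
        intro x hx sx kx
        rw [mem_supp] at hx ⊢
        have h2 := hx.2
        rw [cand, if_neg (by omega), if_pos sx, if_neg (by rw [kx]; exact hr)] at h2
        exact ⟨hx.1, h2⟩
      exact hS.noCyc u (mem u hu h0.1 rfl) w (mem w hw h0.2.1 hw') a (mem a ha h0.2.2 ha') hc
  by_cases hc : Improves e n st r S X
  · have h' := hi.1 hc
    rw [sum_congr rfl fun w hw => h' w (mem_cls.mp hw).1, sum_cls_cand, if_pos rfl, hXsum]
  · have h' := hi.2 hc
    rw [sum_congr rfl fun w hw => h' w (mem_cls.mp hw).1]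
    have : ¬ ∑ w ∈ cls e n st r, S w < ∑ w ∈ cls e n st r, X w := fun h => hc ⟨hno, h⟩
    exact hXsum ▸ not_lt.mp this

-- The classes are the fibres of `keptOut` on the undecided vertices, so the bounds add up over
-- them. A vertex of `O` that is decided must be kept and is counted by `S`.
open Classical in
theorem Partial.card_le_sum {e : ℕ → ℕ → Prop} {n : ℕ} {st S : ℕ → ℕ} (hS : Partial e n st S)
    {O M : Finset ℕ} (hO : O ⊆ range n) (hst : Consistent n O M st)
    (h : ∀ r < n, (O ∩ cls e n st r).card ≤ ∑ w ∈ cls e n st r, S w) :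
    O.card ≤ ∑ j ∈ range n, S j := by
  have hcard : O.card = ∑ j ∈ range n, if j ∈ O then 1 else 0 := by
    rw [← sum_filter, sum_const, smul_eq_mul, mul_one]
    congr 1; ext j; simp only [mem_filter]; exact ⟨fun hj => ⟨hO hj, hj⟩, And.right⟩
  rw [hcard, ← sum_filter_add_sum_filter_not (range n) (fun j => st j = 0),
    ← sum_filter_add_sum_filter_not (range n) (fun j => st j = 0) (f := S)]
  refine Nat.add_le_add ?_ (sum_le_sum fun j hj => ?_)
  · set U := (range n).filter (fun j => st j = 0) with hU
    have hmap : ∀ j ∈ U, keptOut e n st j ∈ U.image (keptOut e n st) := fun j hj =>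
      mem_image_of_mem _ hj
    rw [← sum_fiberwise_of_maps_to hmap, ← sum_fiberwise_of_maps_to hmap]
    refine sum_le_sum fun b hb => ?_
    obtain ⟨r, hr, rfl⟩ := mem_image.mp hb
    have hfib : U.filter (fun j => keptOut e n st j = keptOut e n st r) = cls e n st r := by
      ext j; simp only [hU, mem_filter, mem_range, mem_cls, and_assoc]
    rw [hfib]
    have hrn : r < n := by simp only [hU, mem_filter, mem_range] at hr; exact hr.1
    refine le_trans (le_of_eq ?_) (h r hrn)
    rw [← sum_filter, sum_const, smul_eq_mul, mul_one]
    congr 1; ext w; simp only [mem_filter, mem_inter]; tauto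
  · simp only [mem_filter, mem_range] at hj
    split_ifs with hjO
    · have h1 := hst j hj.1
      have : st j = 1 := by
        have h2 : st j ≠ 2 := fun h2 => h1.2.1 h2 hjO
        omega
      rw [hS.kept j hj.1 this]
    · exact Nat.zero_le _

/-- All of `M` is kept, so a vertex of `M` between two members `x` and `y` of a class would be in
`keptOut` of `x` but not of `y`. The class thus meets `O` in a single gap of `M`. -/
theorem card_inter_cls_lt {e : ℕ → ℕ → Prop} {n : ℕ} {st : ℕ → ℕ} (ht : IsTour n e) {L : ℕ}
    {O M : Finset ℕ} (hO : O ⊆ range n) (hst : Consistent n O M st) (hMO : M ⊆ O)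
    (hM : ∀ C ⊆ O, (∀ x ∈ C, x ∉ M) →
      (∀ x ∈ C, ∀ y ∈ C, ∀ a ∈ M, ¬ (e x a ∧ e a y)) → C.card < L) (r : ℕ) :
    (open Classical in (O ∩ cls e n st r)).card < L := by
  refine hM _ inter_subset_left ?_ ?_
  · intro x hx hxM
    obtain ⟨-, hx⟩ := mem_inter.mp hx
    rw [mem_cls] at hx
    have := (hst x hx.1).2.2.2 hxM
    omega
  · rintro x hx y hy a haM ⟨h1, h2⟩
    obtain ⟨-, hx⟩ := mem_inter.mp hx
    obtain ⟨-, hy⟩ := mem_inter.mp hy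
    rw [mem_cls] at hx hy
    have han := mem_range.mp (hO (hMO haM))
    have : a ∈ keptOut e n st y := by
      rw [hy.2.2, ← hx.2.2]
      simp only [keptOut, mem_filter, mem_range]
      exact ⟨han, (hst a han).2.2.2 haM, h1⟩
    simp only [keptOut, mem_filter] at this
    exact ht.asymm _ _ h2 this.2.2

end TransitiveSearch

/-! ### The program -/

namespace TransitiveSearch

open LoopLang Finset

/-! Variables: `0` number `n` of vertices, `1` `n + 1`, `2` width of the table, `3` size bound and
`4` number of sparse subsets, `5` and `6` Fibonacci numbers, `7` number of small subsets, `8` size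
of the best solution, `9` and `10` counters, `11` and `12` input of the decoding, `13` auxiliary
index, `14` auxiliary value, `15`, `16`, `17` counter and Fibonacci numbers of the branching, `18`
to `23` indices, `24` and `25` sums over a class, `26` and `27` flags, `28` cardinality.

Arrays: `0` adjacency matrix, `1` table of `subCount`, `2` states of the vertices, `3` decoded
subset, `4` partial solution, `5` candidate, `6` best solution. -/

/-- The entry of the adjacency matrix in row `i` and column `j`. -/
def matE (i j : ℕ) : Expr := .arr 0 (.add (.mul (.var i) (.var 0)) (.var j))

/-- Nonzero if and only if the values are equal. -/
def eqE (e f : Expr) : Expr := .sub (.lit 1) (.add (.sub e f) (.sub f e))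

/-- Nonzero if and only if variables `19`, `20`, `21` form a directed triangle. -/
def cycE : Expr := .mul (.mul (matE 19 20) (matE 20 21)) (matE 21 19)

def whenC (e : Expr) (c : Cmd) : Cmd := .ite e c .skip

def tableE (r b : Expr) : Expr := .arr 1 (.add (.mul r (.var 2)) b)

def unrankC (k : ℕ) : Cmd :=
  .loop 13 0 (.seq (.assign 14 (tableE (.sub (.sub (.var 0) (.lit 1)) (.var 13)) (.var 11)))
    (.ite (.sub (.var 14) (.var 12)) (.store k (.var 13) (.lit 0))
      (.seq (.store k (.var 13) (.lit 1)) (.seq (.assign 12 (.sub (.var 12) (.var 14)))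
        (.assign 11 (.sub (.var 11) (.lit 1)))))))

def conflictStepC : Cmd :=
  whenC (eqE (.arr 2 (.var 21)) (.lit 1)) (whenC (eqE (.arr 2 (.var 19)) (.lit 0)) (whenC cycE
    (.ite (eqE (.arr 2 (.var 20)) (.lit 1)) (.store 2 (.var 19) (.lit 2))
      (whenC (eqE (.arr 2 (.var 20)) (.lit 0))
        (.ite (.sub (.var 17) (.var 15))
          (.seq (.store 2 (.var 19) (.lit 2)) (.seq (.assign 14 (.sub (.var 16) (.var 17)))
            (.seq (.assign 16 (.var 17)) (.assign 17 (.var 14)))))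
          (.seq (.store 2 (.var 19) (.lit 1)) (.seq (.store 2 (.var 20) (.lit 2))
            (.seq (.assign 15 (.sub (.var 15) (.var 17)))
              (.seq (.assign 16 (.sub (.var 16) (.var 17)))
                (.assign 17 (.sub (.var 17) (.var 16))))))))))))

def conflictC : Cmd := .loop 18 1 (.loop 19 0 (.loop 20 0 (.loop 21 0 conflictStepC)))

def noCycC (k : ℕ) : Cmd :=
  .seq (.assign 27 (.lit 1)) (.loop 19 0 (.loop 20 0 (.loop 21 0
    (whenC (.mul (.mul (.arr k (.var 19)) (.mul (.arr k (.var 20)) (.arr k (.var 21)))) cycE)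
      (.assign 27 (.lit 0))))))

def candC : Cmd :=
  .seq (.assign 24 (.lit 0)) (.seq (.assign 25 (.lit 0)) (.loop 20 0
    (.ite (eqE (.arr 2 (.var 20)) (.lit 1)) (.store 5 (.var 20) (.lit 1))
      (.ite (eqE (.arr 2 (.var 20)) (.lit 0))
        (.seq (.assign 26 (.lit 0))
          (.seq (.loop 21 0 (whenC (eqE (.arr 2 (.var 21)) (.lit 1))
              (.ite (eqE (matE 20 21) (matE 22 21)) .skip (.assign 26 (.lit 1)))))
            (.ite (.var 26) (.store 5 (.var 20) (.arr 4 (.var 20)))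
              (.seq (.store 5 (.var 20) (.arr 3 (.var 20)))
                (.seq (.assign 24 (.add (.var 24) (.arr 3 (.var 20))))
                  (.assign 25 (.add (.var 25) (.arr 4 (.var 20)))))))))
        (.store 5 (.var 20) (.lit 0))))))

def copyC (k l : ℕ) : Cmd := .loop 13 0 (.store l (.var 13) (.arr k (.var 13)))

def improveC : Cmd :=
  .seq (.assign 11 (.lit 255)) (.seq (.assign 12 (.var 23)) (.seq (unrankC 3) (.seq candC
    (.seq (noCycC 5) (whenC (.var 27) (whenC (.sub (.var 24) (.var 25)) (copyC 5 4)))))))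

/-- Every vertex serves as a representative, so a class is treated once per member and decided
vertices are tried too. This is redundant but costs only a polynomial factor. -/
def classesC : Cmd :=
  .seq (.loop 13 0 (.store 4 (.var 13) (eqE (.arr 2 (.var 13)) (.lit 1))))
    (.loop 22 0 (.loop 23 7 improveC))

/-- The test for triangles is repeated here, because under unsuitable counters the kept vertices
themselves may contain triangles. -/
def recordC : Cmd :=
  .seq (noCycC 4) (.seq (.assign 28 (.lit 0))
    (.seq (.loop 13 0 (.assign 28 (.add (.var 28) (.arr 4 (.var 13)))))
      (whenC (.var 27) (whenC (.sub (.var 28) (.var 8))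
        (.seq (.assign 8 (.var 28)) (copyC 4 6))))))

def branchC : Cmd :=
  .seq (.assign 11 (.var 3)) (.seq (.assign 12 (.var 9)) (.seq (unrankC 2)
    (.seq (.assign 15 (.var 10)) (.seq (.assign 16 (.var 5)) (.seq (.assign 17 (.var 6))
      (.seq conflictC (.seq classesC recordC)))))))

def searchC : Cmd := .loop 9 4 (.loop 10 5 branchC)

def tableC : Cmd :=
  .loop 22 1 (.loop 20 2 (.ite (.mul (.var 22) (.var 20))
    (.store 1 (.add (.mul (.var 22) (.var 2)) (.var 20))
      (.add (tableE (.sub (.var 22) (.lit 1)) (.var 20))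
        (tableE (.sub (.var 22) (.lit 1)) (.sub (.var 20) (.lit 1)))))
    (.store 1 (.add (.mul (.var 22) (.var 2)) (.var 20)) (.lit 1))))

def fibC : Cmd :=
  .seq (.assign 5 (.lit 1)) (.seq (.assign 6 (.lit 0)) (.loop 13 0
    (.seq (.assign 14 (.var 5)) (.seq (.assign 5 (.add (.var 5) (.var 6)))
      (.assign 6 (.var 14))))))

/-- Division by 256 through repeated incrementation; the condition says that `256 * (v₃ + 1) ≤ n`.
-/
def sparseC : Cmd :=
  .seq (.assign 3 (.lit 0)) (.loop 13 0
    (whenC (.sub (.add (.var 0) (.lit 1)) (.mul (.add (.var 3) (.lit 1)) (.lit 256)))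
      (.assign 3 (.add (.var 3) (.lit 1)))))

def initC : Cmd :=
  .seq (.assign 1 (.add (.var 0) (.lit 1))) (.seq (.assign 2 (.add (.var 0) (.lit 257)))
    (.seq tableC (.seq fibC (.seq sparseC (.seq (.assign 4 (tableE (.var 0) (.var 3)))
      (.assign 7 (tableE (.var 0) (.lit 255))))))))

def outputC : Cmd := .loop 13 0 (.store 0 (.var 13) (.sub (.lit 1) (.arr 6 (.var 13))))

def mainC : Cmd := .seq initC (.seq searchC outputC)

theorem mainC_wf : mainC.wf = true := by decide

/-! #### Verification -/

/-- Bounds for the variables that bound loops. -/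
def loopBound (n : ℕ) : ℕ → ℕ
  | 0 => n
  | 1 => n + 1
  | 2 => n + 257
  | 4 => subCount n (n / 256)
  | 5 => Nat.fib (n + 1)
  | 7 => subCount n 255
  | _ => 0

theorem index_inj {W r r' j j' : ℕ} (hj : j < W) (hj' : j' < W) (h : r * W + j = r' * W + j') :
    r = r' ∧ j = j' := by
  have hr : r = r' := by
    have h1 := congrArg (· / W) h
    simpa [Nat.mul_comm _ W, Nat.mul_add_div (by omega : 0 < W), Nat.div_eq_of_lt hj,
      Nat.div_eq_of_lt hj'] using h1
  subst hr
  exact ⟨rfl, by omega⟩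

theorem index_lt {W R r j : ℕ} (hr : r < R) (hj : j < W) : r * W + j < R * W := by
  have : (r + 1) * W ≤ R * W := Nat.mul_le_mul_right _ hr
  rw [add_mul, one_mul] at this
  omega

theorem le_arrLen {n i : ℕ} (h : i < n) : i < arrLen n := by unfold arrLen; nlinarith

theorem valid_vec {n k i : ℕ} (h : i < n) (hk : 1 ≤ k) (hk' : k ≤ 6) : Valid n k i :=
  Or.inr ⟨hk, hk', le_arrLen h⟩

theorem valid_mat {n i j : ℕ} (hi : i < n) (hj : j < n) : Valid n 0 (i * n + j) :=
  Or.inl ⟨rfl, index_lt hi hj⟩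

theorem valid_table {n r b : ℕ} (hr : r < n + 1) (hb : b < n + 257) :
    Valid n 1 (r * (n + 257) + b) := Or.inr ⟨le_rfl, by norm_num, index_lt hr hb⟩

theorem lt_bits {n m : ℕ} (h : m ≤ n + 1000) : m < 2 ^ bits n := by
  have h1 : n < 2 ^ n := Nat.lt_two_pow_self
  have h2 : 2 ^ bits n = 2 ^ n * 2 ^ n * 2 ^ 40 := by
    rw [← pow_add, ← pow_add]; congr 1; unfold bits; omega
  rw [h2]
  have := Nat.one_le_two_pow (n := n)
  nlinarith

theorem two_pow_lt_bits {n m : ℕ} (h : m ≤ 2 ^ (n + 1)) : m < 2 ^ bits n :=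
  h.trans_lt (Nat.pow_lt_pow_right (by norm_num) (by unfold bits; omega))

open Classical in
/-- The store holds the number of vertices and the adjacency matrix. -/
structure Env (n : ℕ) (e : ℕ → ℕ → Prop) (s : Store) : Prop where
  v0 : s.v 0 = n
  mat : ∀ i < n, ∀ j < n, s.a 0 (i * n + j) = if e i j then 1 else 0

/-- The store also holds the table of `subCount`. -/
structure EnvTable (n : ℕ) (e : ℕ → ℕ → Prop) (s : Store) : Prop extends Env n e s where
  v2 : s.v 2 = n + 257
  table : ∀ r < n + 1, ∀ b < n + 257, s.a 1 (r * (n + 257) + b) = subCount r b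

/-- The store also holds the bounds of the loops of the search. -/
structure EnvFull (n : ℕ) (e : ℕ → ℕ → Prop) (s : Store) : Prop extends EnvTable n e s where
  v1 : s.v 1 = n + 1
  v3 : s.v 3 = n / 256
  v4 : s.v 4 = subCount n (n / 256)
  v5 : s.v 5 = Nat.fib (n + 1)
  v6 : s.v 6 = Nat.fib n
  v7 : s.v 7 = subCount n 255

section

variable {n : ℕ} {e : ℕ → ℕ → Prop} {s s' : Store} {c : Cmd} {Q : Store → Prop}

theorem Env.agree (h : Env n e s) (ha : Agree c s s') (hv : 0 ∉ c.vmods) (hk : 0 ∉ c.amods) :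
    Env n e s' := by
  refine ⟨by rw [ha.1 _ hv, h.v0], ?_⟩
  rw [ha.2 _ hk]; exact h.mat

theorem EnvTable.agree (h : EnvTable n e s) (ha : Agree c s s')
    (hv : ∀ x ∈ [0, 2], x ∉ c.vmods) (hk : ∀ x ∈ [0, 1], x ∉ c.amods) : EnvTable n e s' := by
  refine ⟨h.toEnv.agree ha (hv 0 (by simp)) (hk 0 (by simp)), ?_, ?_⟩
  · rw [ha.1 2 (hv 2 (by simp)), h.v2]
  · rw [ha.2 1 (hk 1 (by simp))]; exact h.table

theorem EnvFull.agree (h : EnvFull n e s) (ha : Agree c s s')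
    (hv : ∀ x ∈ [0, 1, 2, 3, 4, 5, 6, 7], x ∉ c.vmods) (hk : ∀ x ∈ [0, 1], x ∉ c.amods) :
    EnvFull n e s' := by
  refine ⟨h.toEnvTable.agree ha (fun x hx => hv x (by simp at hx ⊢; tauto)) hk,
    ?_, ?_, ?_, ?_, ?_, ?_⟩
  · rw [ha.1 1 (hv 1 (by simp)), h.v1]
  · rw [ha.1 3 (hv 3 (by simp)), h.v3]
  · rw [ha.1 4 (hv 4 (by simp)), h.v4]
  · rw [ha.1 5 (hv 5 (by simp)), h.v5]
  · rw [ha.1 6 (hv 6 (by simp)), h.v6]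
  · rw [ha.1 7 (hv 7 (by simp)), h.v7]

theorem Env.setv (h : Env n e s) {x m : ℕ} (hx : x ≠ 0) : Env n e (s.setv x m) :=
  ⟨by rw [Store.setv_v, if_neg hx.symm, h.v0], h.mat⟩

theorem EnvTable.setv (h : EnvTable n e s) {x m : ℕ} (hx : x ≠ 0) (hx' : x ≠ 2) :
    EnvTable n e (s.setv x m) :=
  ⟨h.toEnv.setv hx, by rw [Store.setv_v, if_neg hx'.symm, h.v2], h.table⟩

theorem EnvFull.setv (h : EnvFull n e s) {x m : ℕ} (hx : 8 ≤ x) : EnvFull n e (s.setv x m) := by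
  refine ⟨h.toEnvTable.setv (by omega) (by omega), ?_, ?_, ?_, ?_, ?_, ?_⟩ <;>
    rw [Store.setv_v, if_neg (by omega)]
  exacts [h.v1, h.v3, h.v4, h.v5, h.v6, h.v7]

theorem eqE_ne_zero {f g : Expr} : (eqE f g).eval s ≠ 0 ↔ f.eval s = g.eval s := by
  simp only [eqE, Expr.eval]; omega

theorem eqE_eq_zero {f g : Expr} : (eqE f g).eval s = 0 ↔ f.eval s ≠ g.eval s := by
  rw [ne_eq, ← eqE_ne_zero, not_not]

theorem Spec.when {N : ℕ → ℕ} {f : Expr} (hf : Bounded n s → f.ok n s)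
    (hc : f.eval s ≠ 0 → Spec n N c s Q) (hd : f.eval s = 0 → Q s) :
    Spec n N (whenC f c) s Q :=
  Spec.ite hf hc fun h => Spec.skip (hd h)

theorem matE_eval (h : Env n e s) {i j : ℕ} (hi : s.v i < n) (hj : s.v j < n) :
    (matE i j).eval s = open Classical in if e (s.v i) (s.v j) then 1 else 0 := by
  simp only [matE, Expr.eval, h.v0]
  exact h.mat _ hi _ hj

theorem matE_ok (h : Env n e s) {i j : ℕ} (hi : s.v i < n) (hj : s.v j < n) :
    (matE i j).ok n s := by
  simp only [matE, Expr.ok, Expr.eval, h.v0, true_and]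
  exact valid_mat hi hj

theorem cycE_eval (h : Env n e s) (hu : s.v 19 < n) (hw : s.v 20 < n) (ha : s.v 21 < n) :
    cycE.eval s ≠ 0 ↔ Cyc e (s.v 19) (s.v 20) (s.v 21) := by
  simp only [cycE, Expr.eval, matE_eval h hu hw, matE_eval h hw ha, matE_eval h ha hu, Cyc]
  simp
  tauto

theorem cycE_ok (h : Env n e s) (hu : s.v 19 < n) (hw : s.v 20 < n) (ha : s.v 21 < n) :
    cycE.ok n s := ⟨⟨matE_ok h hu hw, matE_ok h hw ha⟩, matE_ok h ha hu⟩

/-- The bound on variable `11` keeps the lookups within one row of the table; it covers both uses,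
with budget 255 and with budget `n / 256`. -/
theorem unrankC_spec {k : ℕ} (h : EnvTable n e s) (hk : 2 ≤ k) (hk' : k ≤ 6)
    (hb : s.v 11 ≤ n + 256) :
    Spec n (loopBound n) (unrankC k) s
      (fun s' => ∀ j < n, s'.a k j = unrank n (s.v 11) (s.v 12) j) := by
  set q : ℕ → ((ℕ → ℕ) × ℕ) × ℕ := fun i =>
    iter (unrankStep n) i ((fun _ => 0, s.v 11), s.v 12) with hq
  refine Spec.loop (fun i s' => (∀ j < i, s'.a k j = (q i).1.1 j) ∧ s'.v 11 = (q i).1.2 ∧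
    s'.v 12 = (q i).2 ∧ s'.v 11 ≤ n + 256) (by rfl) (by rw [h.v0]; rfl) (by simp [hq, iter, hb])
    ?_ ?_
  · rintro i s1 hi hag ⟨i1, i2, i3, i4⟩
    rw [h.v0] at hi
    have h1 : EnvTable n e s1 := h.agree hag (by simp [Cmd.vmods])
      (by simp [Cmd.amods]; omega)
    have hev : (tableE (.sub (.sub (.var 0) (.lit 1)) (.var 13)) (.var 11)).eval (s1.setv 13 i) =
        subCount (n - 1 - i) (q i).1.2 := by
      simp only [tableE, Expr.eval, Store.setv_v, Store.setv_a]
      simp only [show (0 : ℕ) ≠ 13 by decide, show (2 : ℕ) ≠ 13 by decide,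
        show (11 : ℕ) ≠ 13 by decide, if_false, if_true, h1.v0, h1.v2, i2]
      exact h1.table _ (by omega) _ (by omega)
    have hqs : q (i + 1) = unrankStep n i (q i) := rfl
    refine Spec.assign_seq (by norm_num) (fun _ => ⟨?_, ?_⟩) ?_
    · simp only [tableE, Expr.ok, Expr.eval, Store.setv_v]
      simp only [show (0 : ℕ) ≠ 13 by decide, show (2 : ℕ) ≠ 13 by decide,
        show (11 : ℕ) ≠ 13 by decide, if_false, if_true, h1.v0, h1.v2, true_and]
      exact valid_table (by omega) (by omega)
    · rw [hev]
      exact two_pow_lt_bits ((subCount_le_two_pow _ _).trans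
        (Nat.pow_le_pow_right (by norm_num) (by omega)))
    · rw [hev]
      refine Spec.ite (fun _ => by simp [Expr.ok]) ?_ ?_
      · intro hc
        simp [Expr.eval, i3] at hc
        refine Spec.store (fun _ => ⟨trivial, trivial, ?_, ?_⟩) ?_
        · simpa [Expr.eval] using valid_vec hi (by omega) hk'
        · simp [Expr.eval]
        · have hc' : (q i).2 < subCount (n - 1 - i) (q i).1.2 := by omega
          rw [hqs, unrankStep, if_pos hc']
          refine ⟨fun j hj => ?_, by simpa [Expr.eval] using i2, by simpa [Expr.eval] using i3,
            by simpa [Expr.eval] using i4⟩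
          simp [Expr.eval, Function.update_apply]
          split_ifs with hji
          · rfl
          · exact i1 j (by omega)
      · intro hc
        simp [Expr.eval, i3] at hc
        refine Spec.store_seq (fun _ => ⟨trivial, trivial, ?_, ?_⟩) ?_
        · simpa [Expr.eval] using valid_vec hi (by omega) hk'
        · exact lt_bits (by simp [Expr.eval])
        refine Spec.assign_seq (by norm_num) (fun hB => ⟨by simp [Expr.ok], ?_⟩) ?_
        · exact (Nat.sub_le _ _).trans_lt (hB.v_lt 12 (by norm_num))
        refine Spec.assign (fun hB => ⟨by simp [Expr.ok], ?_⟩) ?_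
        · exact (Nat.sub_le _ _).trans_lt (hB.v_lt 11 (by norm_num))
        have hc' : ¬ (q i).2 < subCount (n - 1 - i) (q i).1.2 := by omega
        rw [hqs, unrankStep, if_neg hc']
        refine ⟨fun j hj => ?_, by simp [Expr.eval, i2], by simp [Expr.eval, i3], ?_⟩
        · simp [Expr.eval, Function.update_apply]
          split_ifs with hji
          · rfl
          · exact i1 j (by omega)
        · simp [Expr.eval]; omega
  · rintro s1 hag ⟨i1, -⟩ j hj
    rw [h.v0] at i1
    exact i1 j hj

end

end TransitiveSearch

/-! ### Verification of the branching and of the test for triangles -/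

namespace TransitiveSearch

open LoopLang Finset

section

variable {n : ℕ} {e : ℕ → ℕ → Prop} {s s' : Store} {c : Cmd} {Q : Store → Prop}

/-- The store represents the state `q` of the branching. -/
def ConflictRep (n : ℕ) (s : Store) (q : ((ℕ → ℕ) × ℕ × ℕ) × ℕ) : Prop :=
  (∀ j < n, s.a 2 j = q.1.1 j) ∧ s.v 15 = q.2 ∧ s.v 16 = q.1.2.1 ∧ s.v 17 = q.1.2.2

theorem ConflictRep.setv {q : ((ℕ → ℕ) × ℕ × ℕ) × ℕ} (h : ConflictRep n s q) {x m : ℕ}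
    (hx : 18 ≤ x) : ConflictRep n (s.setv x m) q := by
  obtain ⟨h1, h2, h3, h4⟩ := h
  refine ⟨h1, ?_, ?_, ?_⟩ <;> rw [Store.setv_v, if_neg (by omega)] <;> assumption

theorem conflictStepC_spec {q : ((ℕ → ℕ) × ℕ × ℕ) × ℕ} (h : Env n e s) (hu : s.v 19 < n)
    (hw : s.v 20 < n) (ha : s.v 21 < n) (hq : ConflictRep n s q) :
    Spec n (loopBound n) conflictStepC s
      (fun s' => ConflictRep n s' (conflictStep e (s.v 19) (s.v 20) (s.v 21) q)) := by
  obtain ⟨q1, q2, q3, q4⟩ := id hq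
  have v2 : ∀ {x}, x < n → Valid n 2 x := fun hx => valid_vec hx (by norm_num) (by norm_num)
  refine Spec.when (fun _ => by simpa [eqE, Expr.ok, Expr.eval] using v2 ha) ?_ ?_
  swap
  · intro hc
    rw [eqE_eq_zero] at hc
    simp only [Expr.eval, q1 _ ha] at hc
    rw [conflictStep, if_neg fun h => hc h.1]
    exact hq
  intro hc1
  rw [eqE_ne_zero] at hc1
  simp only [Expr.eval, q1 _ ha] at hc1
  refine Spec.when (fun _ => by simpa [eqE, Expr.ok, Expr.eval] using v2 hu) ?_ ?_
  swap
  · intro hc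
    rw [eqE_eq_zero] at hc
    simp only [Expr.eval, q1 _ hu] at hc
    rw [conflictStep, if_neg fun h => hc h.2.1]
    exact hq
  intro hc2
  rw [eqE_ne_zero] at hc2
  simp only [Expr.eval, q1 _ hu] at hc2
  refine Spec.when (fun _ => cycE_ok h hu hw ha) ?_ ?_
  swap
  · intro hc
    rw [conflictStep, if_neg fun h' => (cycE_eval h hu hw ha).mpr h'.2.2 hc]
    exact hq
  intro hc3
  rw [cycE_eval h hu hw ha] at hc3
  rw [conflictStep, if_pos ⟨hc1, hc2, hc3⟩]
  refine Spec.ite (fun _ => by simpa [eqE, Expr.ok, Expr.eval] using v2 hw) ?_ ?_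
  · intro hc4
    rw [eqE_ne_zero] at hc4
    simp only [Expr.eval, q1 _ hw] at hc4
    rw [if_pos hc4]
    refine Spec.store (fun _ => ⟨trivial, trivial, v2 hu, lt_bits (by simp [Expr.eval])⟩) ?_
    refine ⟨fun j hj => ?_, q2, q3, q4⟩
    simp [Expr.eval, Function.update_apply, q1 j hj]
  intro hc4
  rw [eqE_eq_zero] at hc4
  simp only [Expr.eval, q1 _ hw] at hc4
  rw [if_neg hc4]
  refine Spec.when (fun _ => by simpa [eqE, Expr.ok, Expr.eval] using v2 hw) ?_ ?_
  swap
  · intro hc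
    rw [eqE_eq_zero] at hc
    simp only [Expr.eval, q1 _ hw] at hc
    rw [if_neg hc]
    exact hq
  intro hc5
  rw [eqE_ne_zero] at hc5
  simp only [Expr.eval, q1 _ hw] at hc5
  rw [if_pos hc5]
  refine Spec.ite (fun _ => ⟨trivial, trivial⟩) ?_ ?_
  · intro hc6
    simp only [Expr.eval, q2, q4] at hc6
    rw [if_pos (by omega)]
    refine Spec.store_seq (fun _ => ⟨trivial, trivial, v2 hu, lt_bits (by simp [Expr.eval])⟩) ?_
    refine Spec.assign_seq (by norm_num) (fun hB => ⟨⟨trivial, trivial⟩,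
      (Nat.sub_le _ _).trans_lt (hB.v_lt 16 (by norm_num))⟩) ?_
    refine Spec.assign_seq (by norm_num) (fun hB => ⟨trivial, hB.v_lt 17 (by norm_num)⟩) ?_
    refine Spec.assign (fun hB => ⟨trivial, hB.v_lt 14 (by norm_num)⟩) ?_
    refine ⟨fun j hj => ?_, ?_, ?_, ?_⟩
    · simp [Expr.eval, Function.update_apply, q1 j hj]
    · simp [Expr.eval, q2]
    · simp [Expr.eval, q4]
    · simp [Expr.eval, q3, q4]
  · intro hc6
    simp only [Expr.eval, q2, q4] at hc6
    rw [if_neg (by omega)]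
    refine Spec.store_seq (fun _ => ⟨trivial, trivial, v2 hu, lt_bits (by simp [Expr.eval])⟩) ?_
    refine Spec.store_seq (fun _ => ⟨trivial, trivial, v2 hw, lt_bits (by simp [Expr.eval])⟩) ?_
    -- The order of the three subtractions matters: variable `17` is reduced by the new value of
    -- variable `16`, which takes the pair two places down the Fibonacci sequence.
    refine Spec.assign_seq (by norm_num) (fun hB => ⟨⟨trivial, trivial⟩,
      (Nat.sub_le _ _).trans_lt (hB.v_lt 15 (by norm_num))⟩) ?_
    refine Spec.assign_seq (by norm_num) (fun hB => ⟨⟨trivial, trivial⟩,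
      (Nat.sub_le _ _).trans_lt (hB.v_lt 16 (by norm_num))⟩) ?_
    refine Spec.assign (fun hB => ⟨⟨trivial, trivial⟩,
      (Nat.sub_le _ _).trans_lt (hB.v_lt 17 (by norm_num))⟩) ?_
    refine ⟨fun j hj => ?_, ?_, ?_, ?_⟩
    · simp [Expr.eval, Function.update_apply, q1 j hj]
    · simp [Expr.eval, q2, q4]
    · simp [Expr.eval, q3, q4]
    · simp [Expr.eval, q3, q4]

theorem conflictC_spec {q : ((ℕ → ℕ) × ℕ × ℕ) × ℕ} (h : EnvFull n e s)
    (hq : ConflictRep n s q) :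
    Spec n (loopBound n) conflictC s (fun s' => ConflictRep n s' (conflictAll e n q)) := by
  refine Spec.loop (fun i s' => ConflictRep n s' (iter (fun _ => conflictPass e n) i q))
    (by rfl) (by rw [h.v1]; rfl) hq ?_ (fun s1 hag hs1 => ?_)
  swap
  · rw [h.v1] at hs1 ⊢; exact hs1.setv (by norm_num)
  intro i s1 _ hag hs1
  have h1 : Env n e (s1.setv 18 i) := (h.toEnv.agree hag (by decide) (by decide)).setv (by norm_num)
  replace hs1 : ConflictRep n (s1.setv 18 i) _ := hs1.setv (by norm_num)
  generalize s1.setv 18 i = t1 at *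
  simp only [iter]
  generalize iter (fun _ => conflictPass e n) i q = q1 at *
  refine Spec.loop (fun u s' => ConflictRep n s'
    (iter (fun u => iter (fun w => iter (fun a => conflictStep e u w a) n) n) u q1))
    (by rfl) (by rw [h1.v0]; rfl) hs1 ?_ (fun s2 hag hs2 => ?_)
  swap
  · rw [h1.v0] at hs2 ⊢; exact hs2.setv (by norm_num)
  intro u s2 hu hag2 hs2
  rw [h1.v0] at hu
  have h2 : Env n e (s2.setv 19 u) := (h1.agree hag2 (by decide) (by decide)).setv (by norm_num)
  replace hs2 : ConflictRep n (s2.setv 19 u) _ := hs2.setv (by norm_num)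
  have hu2 : (s2.setv 19 u).v 19 = u := by simp
  generalize s2.setv 19 u = t2 at *
  simp only [iter]
  generalize iter (fun u => iter (fun w => iter (fun a => conflictStep e u w a) n) n) u q1 = q2 at *
  refine Spec.loop (fun w s' => ConflictRep n s'
    (iter (fun w => iter (fun a => conflictStep e u w a) n) w q2))
    (by rfl) (by rw [h2.v0]; rfl) hs2 ?_ (fun s3 hag hs3 => ?_)
  swap
  · rw [h2.v0] at hs3 ⊢; exact hs3.setv (by norm_num)
  intro w s3 hw hag3 hs3
  rw [h2.v0] at hw
  have h3 : Env n e (s3.setv 20 w) := (h2.agree hag3 (by decide) (by decide)).setv (by norm_num)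
  replace hs3 : ConflictRep n (s3.setv 20 w) _ := hs3.setv (by norm_num)
  have hw3 : (s3.setv 20 w).v 20 = w := by simp
  have hu3 : (s3.setv 20 w).v 19 = u := by simp [hag3.1 19 (by decide), hu2]
  generalize s3.setv 20 w = t3 at *
  simp only [iter]
  generalize iter (fun w => iter (fun a => conflictStep e u w a) n) w q2 = q3 at *
  refine Spec.loop (fun a s' => ConflictRep n s' (iter (fun a => conflictStep e u w a) a q3))
    (by rfl) (by rw [h3.v0]; rfl) hs3 ?_ (fun s4 hag hs4 => ?_)
  swap
  · rw [h3.v0] at hs4 ⊢; exact hs4.setv (by norm_num)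
  intro a s4 ha hag4 hs4
  rw [h3.v0] at ha
  have h4 : Env n e (s4.setv 21 a) := (h3.agree hag4 (by decide) (by decide)).setv (by norm_num)
  replace hs4 : ConflictRep n (s4.setv 21 a) _ := hs4.setv (by norm_num)
  have ha4 : (s4.setv 21 a).v 21 = a := by simp
  have hu4 : (s4.setv 21 a).v 19 = u := by simp [hag4.1 19 (by decide), hu3]
  have hw4 : (s4.setv 21 a).v 20 = w := by simp [hag4.1 20 (by decide), hw3]
  generalize s4.setv 21 a = t4 at *
  have := conflictStepC_spec h4 (by omega) (by omega) (by omega) hs4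
  rw [hu4, hw4, ha4] at this
  exact this

/-- After initialization the flag is only ever cleared, so it states that no triple scanned so far
is a triangle. The nested invariants carry the scanned triples as a conjunction with one part per
loop. -/
theorem noCycC_spec {k : ℕ} (h : Env n e s) (hk : 2 ≤ k) (hk' : k ≤ 6) :
    Spec n (loopBound n) (noCycC k) s (fun s' => s'.v 27 ≠ 0 ↔ NoCyc e (supp n (s.a k))) := by
  have hak : ∀ {c' : Cmd} {s s' : Store}, Agree c' s s' → c'.amods = [] → s'.a k = s.a k :=
    fun hag hc => hag.2 k (by rw [hc]; simp)
  set P : ℕ → ℕ → ℕ → Prop := fun u w a =>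
    ¬ ((s.a k u ≠ 0 ∧ s.a k w ≠ 0 ∧ s.a k a ≠ 0) ∧ Cyc e u w a) with hP
  have hfin : NoCyc e (supp n (s.a k)) ↔ ∀ u < n, ∀ w < n, ∀ a < n, P u w a := by
    simp only [NoCyc, mem_supp, hP]
    constructor
    · rintro h u hu w hw a ha ⟨⟨h1, h2, h3⟩, h4⟩
      exact h u ⟨hu, h1⟩ w ⟨hw, h2⟩ a ⟨ha, h3⟩ h4
    · rintro h u ⟨hu, h1⟩ w ⟨hw, h2⟩ a ⟨ha, h3⟩ h4
      exact h u hu w hw a ha ⟨⟨h1, h2, h3⟩, h4⟩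
  have hsucc : ∀ (R : ℕ → Prop) (i : ℕ), (∀ j < i + 1, R j) ↔ (∀ j < i, R j) ∧ R i := by
    intro R i
    constructor
    · exact fun h => ⟨fun j hj => h j (by omega), h i (by omega)⟩
    · rintro ⟨h1, h2⟩ j hj
      rcases Nat.lt_succ_iff_lt_or_eq.mp hj with h3 | rfl
      exacts [h1 j h3, h2]
  rw [hfin]
  refine Spec.assign_seq (by norm_num) (fun _ => ⟨trivial, lt_bits (by simp [Expr.eval])⟩) ?_
  have h1 : Env n e (s.setv 27 (Expr.eval s (.lit 1))) := h.setv (by norm_num)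
  have hv1 : (s.setv 27 (Expr.eval s (.lit 1))).v 27 = 1 := by simp [Expr.eval]
  have ha1 : (s.setv 27 (Expr.eval s (.lit 1))).a k = s.a k := rfl
  generalize s.setv 27 (Expr.eval s (.lit 1)) = t1 at *
  refine Spec.loop (fun i s' => s'.v 27 ≠ 0 ↔ ∀ u < i, ∀ w < n, ∀ a < n, P u w a)
    (by rfl) (by rw [h1.v0]; rfl) (by simp [hv1]) ?_ (fun s2 hag hs2 => ?_)
  swap
  · rw [h1.v0] at hs2 ⊢; simpa using hs2
  intro u s2 hu hag2 hs2
  rw [h1.v0] at hu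
  have h2 : Env n e (s2.setv 19 u) := (h1.agree hag2 (by simp [Cmd.vmods, whenC])
    (by simp [Cmd.amods, whenC])).setv (by norm_num)
  replace hs2 : (s2.setv 19 u).v 27 ≠ 0 ↔ ∀ u' < u, ∀ w < n, ∀ a < n, P u' w a := by
    simpa using hs2
  have hu2 : (s2.setv 19 u).v 19 = u := by simp
  have ha2 : (s2.setv 19 u).a k = s.a k := by rw [Store.setv_a, hak hag2 (by rfl), ha1]
  generalize s2.setv 19 u = t2 at *
  refine Spec.loop (fun i s' => s'.v 27 ≠ 0 ↔ (∀ u' < u, ∀ w < n, ∀ a < n, P u' w a) ∧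
      ∀ w < i, ∀ a < n, P u w a)
    (by rfl) (by rw [h2.v0]; rfl) (by simpa using hs2) ?_ (fun s3 hag hs3 => ?_)
  swap
  · rw [h2.v0] at hs3 ⊢
    rw [hsucc]
    simpa using hs3
  intro w s3 hw hag3 hs3
  rw [h2.v0] at hw
  have h3 : Env n e (s3.setv 20 w) := (h2.agree hag3 (by simp [Cmd.vmods, whenC])
    (by simp [Cmd.amods, whenC])).setv (by norm_num)
  replace hs3 : (s3.setv 20 w).v 27 ≠ 0 ↔ (∀ u' < u, ∀ w < n, ∀ a < n, P u' w a) ∧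
      ∀ w' < w, ∀ a < n, P u w' a := by simpa using hs3
  have hw3 : (s3.setv 20 w).v 20 = w := by simp
  have hu3 : (s3.setv 20 w).v 19 = u := by simp [hag3.1 19 (by simp [Cmd.vmods, whenC]), hu2]
  have ha3 : (s3.setv 20 w).a k = s.a k := by rw [Store.setv_a, hak hag3 (by rfl), ha2]
  generalize s3.setv 20 w = t3 at *
  refine Spec.loop (fun i s' => s'.v 27 ≠ 0 ↔ ((∀ u' < u, ∀ w < n, ∀ a < n, P u' w a) ∧
      ∀ w' < w, ∀ a < n, P u w' a) ∧ ∀ a < i, P u w a)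
    (by rfl) (by rw [h3.v0]; rfl) (by simpa using hs3) ?_ (fun s4 hag hs4 => ?_)
  swap
  · rw [h3.v0] at hs4 ⊢
    rw [hsucc, ← and_assoc]
    simpa using hs4
  intro a s4 ha hag4 hs4
  rw [h3.v0] at ha
  have h4 : Env n e (s4.setv 21 a) := (h3.agree hag4 (by simp [Cmd.vmods, whenC])
    (by simp [Cmd.amods, whenC])).setv (by norm_num)
  replace hs4 : (s4.setv 21 a).v 27 ≠ 0 ↔ ((∀ u' < u, ∀ w < n, ∀ a < n, P u' w a) ∧
      ∀ w' < w, ∀ a < n, P u w' a) ∧ ∀ a' < a, P u w a' := by simpa using hs4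
  have ha4 : (s4.setv 21 a).v 21 = a := by simp
  have hu4 : (s4.setv 21 a).v 19 = u := by simp [hag4.1 19 (by simp [Cmd.vmods, whenC]), hu3]
  have hw4 : (s4.setv 21 a).v 20 = w := by simp [hag4.1 20 (by simp [Cmd.vmods, whenC]), hw3]
  have hk4 : (s4.setv 21 a).a k = s.a k := by rw [Store.setv_a, hak hag4 (by rfl), ha3]
  generalize s4.setv 21 a = t4 at *
  have hcyc := cycE_eval h4 (by omega) (by omega) (by omega)
  rw [hu4, hw4, ha4] at hcyc
  have hPe : (Expr.mul (.mul (.arr k (.var 19)) (.mul (.arr k (.var 20)) (.arr k (.var 21))))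
      cycE).eval t4 ≠ 0 ↔ ¬ P u w a := by
    simp only [hP, not_not, ← hcyc]
    simp only [Expr.eval, hu4, hw4, ha4, hk4, mul_ne_zero_iff]
  have vk : ∀ {x}, x < n → Valid n k x := fun hx => valid_vec hx (by omega) hk'
  refine Spec.when (fun _ => ?_) (fun hc => ?_) (fun hc => ?_)
  · refine ⟨⟨⟨trivial, vk ?_⟩, ⟨trivial, vk ?_⟩, ⟨trivial, vk ?_⟩⟩,
      cycE_ok h4 (by omega) (by omega) (by omega)⟩ <;> simp only [Expr.eval] <;> omega
  · refine Spec.assign (fun _ => ⟨trivial, lt_bits (by simp [Expr.eval])⟩) ?_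
    rw [hPe] at hc
    rw [hsucc]
    simp [Expr.eval, hc]
  · have hc' : P u w a := by
      by_contra h
      exact hPe.mpr (not_not.mpr h) hc
    rw [hsucc, hs4]
    simp [hc']

theorem copyC_spec {k l : ℕ} (h : Env n e s) (hk : 2 ≤ k) (hk' : k ≤ 6) (hl : 2 ≤ l)
    (hl' : l ≤ 6) (hkl : k ≠ l) :
    Spec n (loopBound n) (copyC k l) s (fun s' => ∀ j < n, s'.a l j = s.a k j) := by
  refine Spec.loop (fun i s' => ∀ j < i, s'.a l j = s.a k j) (by rfl) (by rw [h.v0]; rfl)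
    (by simp) ?_ (fun s1 hag hs1 => by rw [h.v0] at hs1; exact hs1)
  intro i s1 hi hag hs1
  rw [h.v0] at hi
  have hk1 : s1.a k = s.a k := hag.2 k (by simpa [Cmd.amods] using hkl)
  have vk : Valid n k i := valid_vec hi (by omega) hk'
  refine Spec.store (fun hB => ⟨trivial, ⟨trivial, ?_⟩, ?_, ?_⟩) ?_
  · simpa [Expr.eval] using vk
  · simpa [Expr.eval] using valid_vec hi (by omega) hl'
  · exact hB.a_lt k _ (by simpa [Expr.eval] using vk)
  · intro j hj
    simp only [Expr.eval, Store.seta_a, Store.setv_v, if_true, true_and, Store.setv_a, hk1]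
    split_ifs with hji
    · rw [hji]
    · exact hs1 j (by omega)

end

end TransitiveSearch

/-! ### Verification of the candidates for a class -/

namespace TransitiveSearch

open LoopLang Finset

section

variable {n : ℕ} {e : ℕ → ℕ → Prop} {s s' : Store} {c : Cmd} {Q : Store → Prop}

theorem eqE_ok {f g : Expr} (hf : f.ok n s) (hg : g.ok n s) : (eqE f g).ok n s := by
  simp only [eqE, Expr.ok, hf, hg, and_self]

theorem keptOut_eq_iff {st : ℕ → ℕ} {w r : ℕ} :
    keptOut e n st w = keptOut e n st r ↔ ¬ ∃ a < n, st a = 1 ∧ ¬ (e w a ↔ e r a) := by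
  simp only [keptOut, Finset.ext_iff, mem_filter, mem_range]
  push Not
  constructor
  · intro h a ha hs
    have := h a
    tauto
  · intro h a
    have := h a
    tauto

open Classical in
theorem sum_cls_eq {st f : ℕ → ℕ} {r : ℕ} : ∑ w ∈ cls e n st r, f w =
    ∑ j ∈ range n, if st j = 0 ∧ keptOut e n st j = keptOut e n st r then f j else 0 := by
  rw [cls, sum_filter]

theorem sum_ite_le {p : ℕ → Prop} [DecidablePred p] {f : ℕ → ℕ} {i : ℕ} (hi : i ≤ n) (hf : ∀ j < n, f j ≤ 1) :
    (∑ j ∈ range i, if p j then f j else 0) ≤ i := by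
  calc _ ≤ ∑ j ∈ range i, 1 := sum_le_sum fun j hj => by
        split_ifs
        · exact hf j (by have := mem_range.mp hj; omega)
        · omega
    _ = i := by simp

/-- The loop that tells whether a kept vertex separates variables `20` and `22`. -/
theorem separatedC_spec (h : Env n e s) (hr : s.v 22 < n) (hw : s.v 20 < n) (h26 : s.v 26 = 0) :
    Spec n (loopBound n) (.loop 21 0 (whenC (eqE (.arr 2 (.var 21)) (.lit 1))
      (.ite (eqE (matE 20 21) (matE 22 21)) .skip (.assign 26 (.lit 1))))) s
      (fun s' => s'.v 26 = 0 ↔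
        keptOut e n (s.a 2) (s.v 20) = keptOut e n (s.a 2) (s.v 22)) := by
  refine Spec.loop (fun i s' => s'.v 26 ≠ 0 ↔
      ∃ a < i, s.a 2 a = 1 ∧ ¬ (e (s.v 20) a ↔ e (s.v 22) a))
    (by rfl) (by rw [h.v0]; rfl) (by simp [h26]) ?_ (fun s1 hag hs1 => ?_)
  swap
  · rw [h.v0] at hs1 ⊢
    rw [keptOut_eq_iff, ← hs1, not_not]
    simp
  intro a s1 ha hag hs1
  rw [h.v0] at ha
  have h1 : Env n e (s1.setv 21 a) := (h.agree hag (by decide) (by decide)).setv (by norm_num)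
  replace hs1 : (s1.setv 21 a).v 26 ≠ 0 ↔
      ∃ a' < a, s.a 2 a' = 1 ∧ ¬ (e (s.v 20) a' ↔ e (s.v 22) a') := by simpa using hs1
  have e20 : (s1.setv 21 a).v 20 = s.v 20 := by simp [hag.1 20 (by decide)]
  have e22 : (s1.setv 21 a).v 22 = s.v 22 := by simp [hag.1 22 (by decide)]
  have e21 : (s1.setv 21 a).v 21 = a := by simp
  have ea : (s1.setv 21 a).a 2 = s.a 2 := by rw [Store.setv_a, hag.2 2 (by decide)]
  generalize s1.setv 21 a = t at *
  have hsucc : (∃ a' < a + 1, s.a 2 a' = 1 ∧ ¬ (e (s.v 20) a' ↔ e (s.v 22) a')) ↔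
      (∃ a' < a, s.a 2 a' = 1 ∧ ¬ (e (s.v 20) a' ↔ e (s.v 22) a')) ∨
        (s.a 2 a = 1 ∧ ¬ (e (s.v 20) a ↔ e (s.v 22) a)) := by
    constructor
    · rintro ⟨a', h1, h2⟩
      rcases Nat.lt_succ_iff_lt_or_eq.mp h1 with h3 | rfl
      exacts [Or.inl ⟨a', h3, h2⟩, Or.inr h2]
    · rintro (⟨a', h1, h2⟩ | h2)
      exacts [⟨a', by omega, h2⟩, ⟨a, by omega, h2⟩]
  have hmat : (matE 20 21).eval t = (matE 22 21).eval t ↔ (e (s.v 20) a ↔ e (s.v 22) a) := by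
    rw [matE_eval h1 (by omega) (by omega), matE_eval h1 (by omega) (by omega), e20, e21, e22]
    by_cases h1 : e (s.v 20) a <;> by_cases h2 : e (s.v 22) a <;> simp [h1, h2]
  rw [hsucc]
  refine Spec.when (fun _ => ?_) (fun hc => ?_) (fun hc => ?_)
  · simpa [eqE, Expr.ok, Expr.eval, e21] using valid_vec ha (k := 2) (by norm_num) (by norm_num)
  · rw [eqE_ne_zero] at hc
    simp only [Expr.eval, e21, ea] at hc
    refine Spec.ite (fun _ => ?_) (fun hc2 => Spec.skip ?_) (fun hc2 => ?_)
    · have m1 := matE_ok h1 (i := 20) (j := 21) (by omega) (by omega)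
      have m2 := matE_ok h1 (i := 22) (j := 21) (by omega) (by omega)
      exact eqE_ok m1 m2
    · rw [eqE_ne_zero, hmat] at hc2
      exact hs1.trans ⟨Or.inl, fun h => h.elim id fun h => absurd hc2 h.2⟩
    · rw [eqE_eq_zero, ne_eq, hmat] at hc2
      refine Spec.assign (fun _ => ⟨trivial, lt_bits (by simp [Expr.eval])⟩) ?_
      simp [Expr.eval, hc, hc2]
  · rw [eqE_eq_zero] at hc
    simp only [Expr.eval, e21, ea] at hc
    exact hs1.trans ⟨Or.inl, fun h => h.elim id fun h => absurd h.1 hc⟩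

/-- That `X` and the partial solution take values at most 1 is needed for safety: it bounds the two
running sums by the loop counter. -/
theorem candC_spec {X : ℕ → ℕ} (h : Env n e s) (hr : s.v 22 < n) (hX : ∀ j < n, s.a 3 j = X j)
    (hX1 : ∀ j < n, X j ≤ 1) (hS : ∀ j < n, s.a 4 j ≤ 1) :
    Spec n (loopBound n) candC s (fun s' =>
      (∀ j < n, s'.a 5 j = cand e n (s.a 2) (s.v 22) (s.a 4) X j) ∧
      s'.v 24 = ∑ w ∈ cls e n (s.a 2) (s.v 22), X w ∧
      s'.v 25 = ∑ w ∈ cls e n (s.a 2) (s.v 22), s.a 4 w) := by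
  classical
  set r := s.v 22 with hrdef
  set st := s.a 2 with hst
  set S := s.a 4 with hSdef
  refine Spec.assign_seq (by norm_num) (fun _ => ⟨trivial, lt_bits (by simp [Expr.eval])⟩) ?_
  refine Spec.assign_seq (by norm_num) (fun _ => ⟨trivial, lt_bits (by simp [Expr.eval])⟩) ?_
  set t := (s.setv 24 (Expr.eval s (.lit 0))).setv 25
    (Expr.eval (s.setv 24 (Expr.eval s (.lit 0))) (.lit 0)) with htdef
  have ht : Env n e t := (h.setv (by norm_num)).setv (by norm_num)
  have t24 : t.v 24 = 0 := by simp [htdef, Expr.eval]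
  have t25 : t.v 25 = 0 := by simp [htdef, Expr.eval]
  have t22 : t.v 22 = r := by simp [htdef, hrdef]
  have ta : t.a = s.a := rfl
  clear_value t
  refine Spec.loop (fun i s' => (∀ j < i, s'.a 5 j = cand e n st r S X j) ∧
      (s'.v 24 = ∑ j ∈ range i,
        if st j = 0 ∧ keptOut e n st j = keptOut e n st r then X j else 0) ∧
      s'.v 25 = ∑ j ∈ range i,
        if st j = 0 ∧ keptOut e n st j = keptOut e n st r then S j else 0)
    (by rfl) (by rw [ht.v0]; rfl) (by simp [t24, t25]) ?_ (fun s1 hag hs1 => ?_)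
  swap
  · rw [ht.v0] at hs1 ⊢
    rw [sum_cls_eq, sum_cls_eq]
    simpa using hs1
  rintro w s1 hw hag ⟨i1, i2, i3⟩
  rw [ht.v0] at hw
  have h1 : Env n e (s1.setv 20 w) := (ht.agree hag (by decide) (by decide)).setv (by norm_num)
  replace i1 : ∀ j < w, (s1.setv 20 w).a 5 j = cand e n st r S X j := i1
  replace i2 : (s1.setv 20 w).v 24 = _ := i2
  replace i3 : (s1.setv 20 w).v 25 = _ := i3
  have e20 : (s1.setv 20 w).v 20 = w := by simp
  have e22 : (s1.setv 20 w).v 22 = r := by simp [hag.1 22 (by decide), t22]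
  have a2 : (s1.setv 20 w).a 2 = st := by rw [Store.setv_a, hag.2 2 (by decide), ta]
  have a3 : (s1.setv 20 w).a 3 = s.a 3 := by rw [Store.setv_a, hag.2 3 (by decide), ta]
  have a4 : (s1.setv 20 w).a 4 = S := by rw [Store.setv_a, hag.2 4 (by decide), ta]
  generalize s1.setv 20 w = u at *
  have vw : ∀ {k}, 1 ≤ k → k ≤ 6 → Valid n k (u.v 20) := fun hk hk' => by
    rw [e20]; exact valid_vec hw hk hk'
  have store5 : ∀ {u' : Store} {m : ℕ}, u'.v 20 = w → u'.a 5 = u.a 5 →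
      m = cand e n st r S X w →
      ∀ j < w + 1, (u'.seta 5 (u'.v 20) m).a 5 j = cand e n st r S X j := by
    intro u' m hu hu5 hm j hj
    simp only [Store.seta_a, true_and, hu]
    split_ifs with hjw
    · rw [hm, hjw]
    · rw [hu5]; exact i1 j (by omega)
  simp only [sum_range_succ]
  refine Spec.ite (fun _ => ?_) (fun hc => ?_) (fun hc => ?_)
  · simpa [eqE, Expr.ok, Expr.eval] using vw (k := 2) (by norm_num) (by norm_num)
  · rw [eqE_ne_zero] at hc
    simp only [Expr.eval, e20, a2] at hc
    refine Spec.store (fun _ => ⟨trivial, trivial, vw (by norm_num) (by norm_num),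
      lt_bits (by simp [Expr.eval])⟩) ⟨?_, ?_, ?_⟩
    · exact store5 e20 rfl (by rw [cand, if_pos hc]; rfl)
    · simp [hc, i2]
    · simp [hc, i3]
  rw [eqE_eq_zero] at hc
  simp only [Expr.eval, e20, a2] at hc
  refine Spec.ite (fun _ => ?_) (fun hc2 => ?_) (fun hc2 => ?_)
  · simpa [eqE, Expr.ok, Expr.eval] using vw (k := 2) (by norm_num) (by norm_num)
  swap
  · rw [eqE_eq_zero] at hc2
    simp only [Expr.eval, e20, a2] at hc2
    refine Spec.store (fun _ => ⟨trivial, trivial, vw (by norm_num) (by norm_num),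
      lt_bits (by simp [Expr.eval])⟩) ⟨?_, ?_, ?_⟩
    · exact store5 e20 rfl (by rw [cand, if_neg hc, if_neg hc2]; rfl)
    · simp [hc2, i2]
    · simp [hc2, i3]
  rw [eqE_ne_zero] at hc2
  simp only [Expr.eval, e20, a2] at hc2
  refine Spec.assign_seq (by norm_num) (fun _ => ⟨trivial, lt_bits (by simp [Expr.eval])⟩) ?_
  refine Spec.seq (by rfl) (separatedC_spec (h1.setv (by norm_num)) (by simpa [e22] using hr)
    (by simpa [e20] using hw) (by simp [Expr.eval])) (fun u' hag' hsep => ?_)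
  have f20 : u'.v 20 = w := by simp [hag'.1 20 (by decide), e20]
  have f24 : u'.v 24 = u.v 24 := by simp [hag'.1 24 (by decide)]
  have f25 : u'.v 25 = u.v 25 := by simp [hag'.1 25 (by decide)]
  have fa : ∀ k, u'.a k = u.a k := fun k => by rw [hag'.2 k (by decide +revert)]; rfl
  simp only [Store.setv_v, Store.setv_a, show (20 : ℕ) ≠ 26 by decide,
    show (22 : ℕ) ≠ 26 by decide, if_false, e20, e22, a2] at hsep
  have vw' : ∀ {k}, 1 ≤ k → k ≤ 6 → Valid n k (u'.v 20) := fun hk hk' => by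
    rw [f20]; exact valid_vec hw hk hk'
  refine Spec.ite (fun _ => trivial) (fun hc3 => ?_) (fun hc3 => ?_)
  · have hk : ¬ keptOut e n st w = keptOut e n st r := fun h => hc3 (hsep.mpr h)
    refine Spec.store (fun hB => ⟨trivial, ⟨trivial, vw' (by norm_num) (by norm_num)⟩,
      vw' (by norm_num) (by norm_num), hB.a_lt 4 _ (vw' (by norm_num) (by norm_num))⟩) ⟨?_, ?_, ?_⟩
    · refine store5 f20 (fa 5) ?_
      rw [cand, if_neg hc, if_pos hc2, if_neg hk]
      simp [Expr.eval, f20, fa, a4]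
    · simp [hk, f24, i2]
    · simp [hk, f25, i3]
  · have hk : keptOut e n st w = keptOut e n st r := hsep.mp hc3
    have b24 := sum_ite_le (p := fun j => st j = 0 ∧ keptOut e n st j = keptOut e n st r)
      (f := X) hw.le hX1
    have b25 := sum_ite_le (p := fun j => st j = 0 ∧ keptOut e n st j = keptOut e n st r)
      (f := S) hw.le hS
    rw [← i2] at b24
    rw [← i3] at b25
    have hXw := hX1 w hw
    have hSw := hS w hw
    refine Spec.store_seq (fun hB => ⟨trivial, ⟨trivial, vw' (by norm_num) (by norm_num)⟩,
      vw' (by norm_num) (by norm_num), hB.a_lt 3 _ (vw' (by norm_num) (by norm_num))⟩) ?_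
    refine Spec.assign_seq (by norm_num) (fun _ => ⟨⟨trivial, trivial,
      vw' (by norm_num) (by norm_num)⟩, lt_bits ?_⟩) ?_
    · simp [Expr.eval, f20, f24, fa, a3, hX w hw]; omega
    refine Spec.assign (fun _ => ⟨⟨trivial, trivial,
      vw' (by norm_num) (by norm_num)⟩, lt_bits ?_⟩) ⟨?_, ?_, ?_⟩
    · simp [Expr.eval, f20, f25, fa, a4]; omega
    · refine store5 f20 (fa 5) ?_
      rw [cand, if_neg hc, if_pos hc2, if_pos hk]
      simp [Expr.eval, f20, fa, a3, hX w hw]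
    · simp [Expr.eval, f20, f24, fa, a3, hX w hw, hk, hc2, i2]
    · simp [Expr.eval, f20, f25, fa, a4, hk, hc2, i3]

theorem improveC_spec (h : EnvFull n e s) (hr : s.v 22 < n) (hS : ∀ j < n, s.a 4 j ≤ 1) :
    Spec n (loopBound n) improveC s (fun s' =>
      Improved e n (s.a 2) (s.v 22) (unrank n 255 (s.v 23)) (s.a 4) (s'.a 4)) := by
  set X := unrank n 255 (s.v 23) with hX
  refine Spec.assign_seq (by norm_num) (fun _ => ⟨trivial, lt_bits (by simp [Expr.eval])⟩) ?_
  refine Spec.assign_seq (by norm_num) (fun hB => ⟨trivial, hB.v_lt 23 (by norm_num)⟩) ?_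
  simp only [Expr.eval, Store.setv_v, show (23 : ℕ) ≠ 11 by decide, if_false]
  have h0 : EnvFull n e ((s.setv 11 255).setv 12 (s.v 23)) :=
    (h.setv (by norm_num)).setv (by norm_num)
  refine Spec.seq (by rfl) (unrankC_spec (k := 3) h0.toEnvTable (by norm_num) (by norm_num)
    (by simp)) (fun s1 hag1 h1 => ?_)
  have env1 : EnvFull n e s1 := h0.agree hag1 (by decide) (by decide)
  have g22 : s1.v 22 = s.v 22 := by simp [hag1.1 22 (by decide)]
  have g2 : s1.a 2 = s.a 2 := by rw [hag1.2 2 (by decide)]; rfl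
  have g4 : s1.a 4 = s.a 4 := by rw [hag1.2 4 (by decide)]; rfl
  replace h1 : ∀ j < n, s1.a 3 j = X j := by simpa using h1
  refine Spec.seq (by rfl) (candC_spec env1.toEnv (by omega) h1
    (fun j hj => unrank_le_one n 255 _ hj) (by rw [g4]; exact hS)) (fun s2 hag2 h2 => ?_)
  rw [g2, g4, g22] at h2
  have env2 : EnvFull n e s2 := env1.agree hag2 (by decide) (by decide)
  refine Spec.seq (by rfl) (noCycC_spec env2.toEnv (k := 5) (by norm_num) (by norm_num))
    (fun s3 hag3 h3 => ?_)
  have env3 : EnvFull n e s3 := env2.agree hag3 (by decide) (by decide)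
  have k4 : s3.a 4 = s.a 4 := by rw [hag3.2 4 (by decide), hag2.2 4 (by decide), g4]
  have k5 : s3.a 5 = s2.a 5 := hag3.2 5 (by decide)
  have k24 : s3.v 24 = s2.v 24 := hag3.1 24 (by decide)
  have k25 : s3.v 25 = s2.v 25 := hag3.1 25 (by decide)
  rw [supp_congr h2.1] at h3
  refine Spec.when (fun _ => trivial) (fun hc => ?_) (fun hc => ?_)
  · refine Spec.when (fun _ => ⟨trivial, trivial⟩) (fun hc2 => ?_) (fun hc2 => ?_)
    · have himp : Improves e n (s.a 2) (s.v 22) (s.a 4) X := by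
        refine ⟨h3.mp hc, ?_⟩
        simp only [Expr.eval, k24, k25, h2.2] at hc2
        omega
      refine (copyC_spec (k := 5) (l := 4) env3.toEnv (by norm_num) (by norm_num) (by norm_num)
        (by norm_num) (by norm_num)).mono fun s4 h4 => ⟨fun _ j hj => ?_, fun h => absurd himp h⟩
      rw [h4 j hj, k5, h2.1 j hj]
    · refine ⟨fun himp => ?_, fun _ j _ => by rw [k4]⟩
      have := himp.2
      simp only [Expr.eval, k24, k25, h2.2] at hc2
      omega
  · exact ⟨fun himp => absurd (h3.mpr himp.1) (not_not.mpr hc), fun _ j _ => by rw [k4]⟩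

end

end TransitiveSearch

/-! ### Verification of the search -/

namespace TransitiveSearch

open LoopLang Finset

section

variable {n : ℕ} {e : ℕ → ℕ → Prop} {s s' : Store} {c : Cmd} {Q : Store → Prop}

theorem Improved.le_one {st X S S' : ℕ → ℕ} {r : ℕ} (h : Improved e n st r X S S')
    (hX : ∀ j < n, X j ≤ 1) (hS : ∀ j < n, S j ≤ 1) : ∀ j < n, S' j ≤ 1 := by
  intro j hj
  by_cases hc : Improves e n st r S X
  · rw [h.1 hc j hj, cand]
    split_ifs
    exacts [le_rfl, hX j hj, hS j hj, by omega]
  · rw [h.2 hc j hj]; exact hS j hj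

-- The set `O` occurs only in the proof. The bound by 1 must hold for all counters, because safety
-- depends on it; the comparison with `O` is claimed only if the branching agreed with `O`.
open Classical in
theorem classesC_spec (h : EnvFull n e s) (ht : IsTour n e) {O M : Finset ℕ}
    (hO : O ⊆ range n) (hOc : NoCyc e O) (hf : ConflictFree e n (s.a 2))
    (hsmall : Consistent n O M (s.a 2) → ∀ r, (O ∩ cls e n (s.a 2) r).card ≤ 255) :
    Spec n (loopBound n) classesC s (fun s' => (∀ j < n, s'.a 4 j ≤ 1) ∧
      (Consistent n O M (s.a 2) → NoCyc e (supp n (s'.a 4)) ∧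
        O.card ≤ ∑ j ∈ range n, s'.a 4 j)) := by
  set st := s.a 2 with hst
  refine Spec.seq (by rfl) (P := fun s' => ∀ j < n, s'.a 4 j = if st j = 1 then 1 else 0)
    ?_ ?_
  · refine Spec.loop (fun i s' => ∀ j < i, s'.a 4 j = if st j = 1 then 1 else 0) (by rfl)
      (by rw [h.v0]; rfl) (by simp) ?_ (fun s1 hag hs1 => by rw [h.v0] at hs1; exact hs1)
    intro i s1 hi hag hs1
    rw [h.v0] at hi
    have g2 : s1.a 2 = st := hag.2 2 (by decide)
    have hval : (eqE (.arr 2 (.var 13)) (.lit 1)).eval (s1.setv 13 i) =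
        if st i = 1 then 1 else 0 := by
      simp only [eqE, Expr.eval, Store.setv_v, Store.setv_a, if_true, g2]
      split_ifs <;> omega
    refine Spec.store (fun _ => ⟨trivial, eqE_ok ⟨trivial, ?_⟩ trivial, ?_, ?_⟩) ?_
    · simpa [Expr.eval] using valid_vec (k := 2) hi (by norm_num) (by norm_num)
    · simpa [Expr.eval] using valid_vec (k := 4) hi (by norm_num) (by norm_num)
    · rw [hval]; exact lt_bits (by split_ifs <;> omega)
    · intro j hj
      rw [hval]
      simp only [Expr.eval, Store.seta_a, Store.setv_v, if_true, true_and, Store.setv_a]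
      by_cases hji : j = i
      · rw [if_pos hji, hji]
      · rw [if_neg hji, hs1 j (by omega)]
  intro s1 hag1 h1
  have env1 : EnvFull n e s1 := h.agree hag1 (by decide) (by decide)
  have st1 : s1.a 2 = st := hag1.2 2 (by decide)
  -- The classes of representatives before `r` are solved, and for the class of `r` the subsets
  -- numbered below `m` have been tried.
  set Inv : ℕ → ℕ → Store → Prop := fun r m s' => (∀ j < n, s'.a 4 j ≤ 1) ∧
    (Consistent n O M st → Partial e n st (s'.a 4) ∧
      (∀ r' < r, (O ∩ cls e n st r').card ≤ ∑ w ∈ cls e n st r', s'.a 4 w) ∧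
      ∀ m' < m, (∀ j < n, unrank n 255 m' j = if j ∈ O ∩ cls e n st r then 1 else 0) →
        (O ∩ cls e n st r).card ≤ ∑ w ∈ cls e n st r, s'.a 4 w) with hInv
  refine Spec.loop (fun r s' => Inv r 0 s') (by rfl) (by rw [env1.v0]; rfl)
    ⟨fun j hj => ?_, fun hcons => ⟨⟨fun j hj => ?_, fun j hj hs => ?_, fun j hj hs => ?_, ?_⟩,
      by simp, by simp⟩⟩ ?_ (fun s2 hag2 hs2 => ?_)
  · rw [h1 j hj]; split_ifs <;> omega
  · rw [h1 j hj]; split_ifs <;> omega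
  · rw [h1 j hj, if_pos hs]
  · rw [h1 j hj, if_neg (by omega)]
  · refine hOc.mono fun j hj => ?_
    rw [mem_supp] at hj
    refine (hcons j hj.1).1 ?_
    by_contra hne
    exact hj.2 (by rw [h1 j hj.1, if_neg hne])
  swap
  · rw [env1.v0] at hs2 ⊢
    refine ⟨hs2.1, fun hcons => ?_⟩
    obtain ⟨hp, hall, -⟩ := hs2.2 hcons
    exact ⟨hp.noCyc, hp.card_le_sum hO hcons hall⟩
  intro r s2 hr hag2 hs2
  rw [env1.v0] at hr
  have env2 : EnvFull n e (s2.setv 22 r) := (env1.agree hag2 (by decide) (by decide)).setv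
    (by norm_num)
  have st2 : (s2.setv 22 r).a 2 = st := by rw [Store.setv_a, hag2.2 2 (by decide), st1]
  have r2 : (s2.setv 22 r).v 22 = r := by simp
  replace hs2 : Inv r 0 (s2.setv 22 r) := hs2
  generalize s2.setv 22 r = t2 at *
  refine Spec.loop (fun m s' => Inv r m s') (by rfl) (by rw [env2.v7]; rfl) hs2 ?_
    (fun s3 hag3 hs3 => ?_)
  swap
  · rw [env2.v7] at hs3 ⊢
    refine ⟨hs3.1, fun hcons => ?_⟩
    obtain ⟨hp, hall, hex⟩ := hs3.2 hcons
    refine ⟨hp, fun r' hr' => ?_, by simp⟩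
    rcases Nat.lt_succ_iff_lt_or_eq.mp hr' with h3 | rfl
    · exact hall r' h3
    · obtain ⟨m, hm, hX⟩ := exists_unrank n 255 _ (hsmall hcons r')
      exact hex m hm hX
  intro m s3 hm hag3 hs3
  have env3 : EnvFull n e (s3.setv 23 m) := (env2.agree hag3 (by decide) (by decide)).setv
    (by norm_num)
  have st3 : (s3.setv 23 m).a 2 = st := by rw [Store.setv_a, hag3.2 2 (by decide), st2]
  have r3 : (s3.setv 23 m).v 22 = r := by simp [hag3.1 22 (by decide), r2]
  have m3 : (s3.setv 23 m).v 23 = m := by simp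
  replace hs3 : Inv r m (s3.setv 23 m) := hs3
  generalize s3.setv 23 m = t3 at *
  refine (improveC_spec env3 (by omega) hs3.1).mono fun s4 hi => ?_
  rw [st3, r3, m3] at hi
  have hX1 : ∀ j < n, unrank n 255 m j ≤ 1 := fun j hj => unrank_le_one n 255 m hj
  refine ⟨hi.le_one hX1 hs3.1, fun hcons => ?_⟩
  obtain ⟨hp, hall, hex⟩ := hs3.2 hcons
  refine ⟨hp.improved hX1 hi, fun r' hr' => (hall r' hr').trans (hi.sum_le r'), ?_⟩
  intro m' hm' hX
  rcases Nat.lt_succ_iff_lt_or_eq.mp hm' with h3 | rfl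
  · exact (hex m' h3 hX).trans (hi.sum_le r)
  · exact hi.le_sum ht hf hOc hcons hp hX

/-- Array `6` holds a set without directed triangles and variable `8` its cardinality. -/
def BestOk (n : ℕ) (e : ℕ → ℕ → Prop) (s : Store) : Prop :=
  (∀ j < n, s.a 6 j ≤ 1) ∧ NoCyc e (supp n (s.a 6)) ∧ s.v 8 = ∑ j ∈ range n, s.a 6 j

theorem BestOk.agree (h : BestOk n e s) (ha : Agree c s s') (hv : 8 ∉ c.vmods)
    (hk : 6 ∉ c.amods) : BestOk n e s' := by
  unfold BestOk
  rw [ha.1 8 hv, ha.2 6 hk]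
  exact h

theorem recordC_spec (h : Env n e s) (hS : ∀ j < n, s.a 4 j ≤ 1) (hb : BestOk n e s) :
    Spec n (loopBound n) recordC s (fun s' => BestOk n e s' ∧ s.v 8 ≤ s'.v 8 ∧
      (NoCyc e (supp n (s.a 4)) → ∑ j ∈ range n, s.a 4 j ≤ s'.v 8)) := by
  refine Spec.seq (by rfl) (noCycC_spec h (k := 4) (by norm_num) (by norm_num))
    (fun s1 hag1 h1 => ?_)
  have env1 : Env n e s1 := h.agree hag1 (by decide) (by decide)
  have b1 : BestOk n e s1 := hb.agree hag1 (by decide) (by decide)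
  have g4 : s1.a 4 = s.a 4 := hag1.2 4 (by decide)
  have g8 : s1.v 8 = s.v 8 := hag1.1 8 (by decide)
  have hsum : ∀ i ≤ n, ∑ j ∈ range i, s.a 4 j ≤ i := fun i hi => by
    calc ∑ j ∈ range i, s.a 4 j ≤ ∑ j ∈ range i, 1 :=
          sum_le_sum fun j hj => hS j (by have := mem_range.mp hj; omega)
      _ = i := by simp
  refine Spec.assign_seq (by norm_num) (fun _ => ⟨trivial, lt_bits (by simp [Expr.eval])⟩) ?_
  have env1' : Env n e (s1.setv 28 (Expr.eval s1 (.lit 0))) := env1.setv (by norm_num)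
  refine Spec.seq (by rfl) (P := fun s' => s'.v 28 = ∑ j ∈ range n, s.a 4 j) ?_ ?_
  · refine Spec.loop (fun i s' => s'.v 28 = ∑ j ∈ range i, s.a 4 j) (by rfl)
      (by rw [env1'.v0]; rfl) (by simp [Expr.eval]) ?_
      (fun s2 hag2 hs2 => by rw [env1'.v0] at hs2 ⊢; simpa using hs2)
    intro i s2 hi hag2 hs2
    rw [env1'.v0] at hi
    have k4 : s2.a 4 = s.a 4 := by rw [hag2.2 4 (by decide), Store.setv_a, g4]
    have hle := hsum i hi.le
    have hi1 := hS i hi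
    refine Spec.assign (fun _ => ⟨⟨trivial, trivial, ?_⟩, lt_bits ?_⟩) ?_
    · simpa [Expr.eval] using valid_vec (k := 4) hi (by norm_num) (by norm_num)
    · simp [Expr.eval, k4, hs2]; omega
    · simp [Expr.eval, k4, hs2, sum_range_succ]
  intro s2 hag2 h2
  have env2 : Env n e s2 := env1'.agree hag2 (by decide) (by decide)
  have b2 : BestOk n e s2 := BestOk.agree (s := s1.setv 28 (Expr.eval s1 (.lit 0))) b1 hag2
    (by decide) (by decide)
  have k4 : s2.a 4 = s.a 4 := by rw [hag2.2 4 (by decide), Store.setv_a, g4]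
  have k8 : s2.v 8 = s.v 8 := by rw [hag2.1 8 (by decide)]; simpa using g8
  have k27 : s2.v 27 = s1.v 27 := by rw [hag2.1 27 (by decide)]; simp
  refine Spec.when (fun _ => trivial) (fun hc => ?_) (fun hc => ?_)
  · simp only [Expr.eval, k27] at hc
    have hno := h1.mp hc
    refine Spec.when (fun _ => ⟨trivial, trivial⟩) (fun hc2 => ?_) (fun hc2 => ?_)
    · simp only [Expr.eval, h2, k8] at hc2
      refine Spec.assign_seq (by norm_num) (fun hB => ⟨trivial, hB.v_lt 28 (by norm_num)⟩) ?_
      refine (copyC_spec (k := 4) (l := 6) (env2.setv (by norm_num)) (by norm_num) (by norm_num)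
        (by norm_num) (by norm_num) (by norm_num)).agree fun s3 hag3 h3 => ?_
      replace h3 : ∀ j < n, s3.a 6 j = s.a 4 j := by simpa [k4] using h3
      have m8 : s3.v 8 = ∑ j ∈ range n, s.a 4 j := by
        rw [hag3.1 8 (by decide)]; simp [Expr.eval, h2]
      refine ⟨⟨fun j hj => ?_, ?_, ?_⟩, by omega, fun _ => m8.ge⟩
      · rw [h3 j hj]; exact hS j hj
      · rw [supp_congr h3]; exact hno
      · rw [m8]; exact sum_congr rfl fun j hj => (h3 j (mem_range.mp hj)).symm
    · simp only [Expr.eval, h2, k8] at hc2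
      exact ⟨b2, by omega, fun _ => by omega⟩
  · simp only [Expr.eval, k27] at hc
    exact ⟨b2, k8.ge, fun hno => absurd hc (h1.mpr hno)⟩

/-- The counters lead the branching to decisions that agree with `O`. -/
def Good (e : ℕ → ℕ → Prop) (n : ℕ) (O M : Finset ℕ) (c₁ c₂ : ℕ) : Prop :=
  Consistent n O M
    (conflictAll e n ((unrank n (n / 256) c₁, Nat.fib (n + 1), Nat.fib n), c₂)).1.1

-- The decoded vector is the characteristic vector of `M`, and read as states it means that `M` is
-- kept and all else undecided. This is consistent with `O`, so the branching can be steered from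
-- there.
open Classical in
theorem exists_good (ht : IsTour n e) {O M : Finset ℕ} (hOc : NoCyc e O)
    (hMO : M ⊆ O) (hM : M.card ≤ n / 256) :
    ∃ c₁ < subCount n (n / 256), ∃ c₂ < Nat.fib (n + 1), Good e n O M c₁ c₂ := by
  obtain ⟨c₁, h1, h2⟩ := exists_unrank n (n / 256) M hM
  have hcons : Consistent n O M (unrank n (n / 256) c₁) := by
    intro j hj
    rw [h2 j hj]
    by_cases hjM : j ∈ M
    · simp [hjM, hMO hjM]
    · simp [hjM]
  obtain ⟨c₂, h3, h4⟩ := exists_conflictAll ht hOc hcons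
  exact ⟨c₁, h1, c₂, h3, h4⟩

theorem Consistent.congr {O M : Finset ℕ} {st st' : ℕ → ℕ} (h : Consistent n O M st)
    (hst : ∀ j < n, st' j = st j) : Consistent n O M st' := by
  intro j hj
  rw [hst j hj]
  exact h j hj

theorem ConflictFree.congr {st st' : ℕ → ℕ} (h : ConflictFree e n st)
    (hst : ∀ j < n, st' j = st j) : ConflictFree e n st' := by
  intro u hu w hw a ha
  rw [hst u hu, hst w hw, hst a ha]
  exact h u hu w hw a ha

theorem branchC_spec (h : EnvFull n e s) (ht : IsTour n e) (hb : BestOk n e s) {O M : Finset ℕ}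
    (hO : O ⊆ range n) (hOc : NoCyc e O) (hMO : M ⊆ O)
    (hM : ∀ C ⊆ O, (∀ x ∈ C, x ∉ M) →
      (∀ x ∈ C, ∀ y ∈ C, ∀ a ∈ M, ¬ (e x a ∧ e a y)) → C.card < 256) :
    Spec n (loopBound n) branchC s (fun s' => BestOk n e s' ∧ s.v 8 ≤ s'.v 8 ∧
      (Good e n O M (s.v 9) (s.v 10) → O.card ≤ s'.v 8)) := by
  refine Spec.assign_seq (by norm_num) (fun hB => ⟨trivial, hB.v_lt 3 (by norm_num)⟩) ?_
  refine Spec.assign_seq (by norm_num) (fun hB => ⟨trivial, hB.v_lt 9 (by norm_num)⟩) ?_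
  simp only [Expr.eval, Store.setv_v, show (9 : ℕ) ≠ 11 by decide, if_false]
  have env0 : EnvFull n e ((s.setv 11 (s.v 3)).setv 12 (s.v 9)) :=
    (h.setv (by norm_num)).setv (by norm_num)
  refine Spec.seq (by rfl) (unrankC_spec (k := 2) env0.toEnvTable (by norm_num) (by norm_num)
    (by simp [h.v3]; omega)) (fun s1 hag1 h1 => ?_)
  have env1 : EnvFull n e s1 := env0.agree hag1 (by decide) (by decide)
  replace h1 : ∀ j < n, s1.a 2 j = unrank n (n / 256) (s.v 9) j := by simpa [h.v3] using h1
  have b1 : BestOk n e s1 := BestOk.agree (s := (s.setv 11 (s.v 3)).setv 12 (s.v 9)) hb hag1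
    (by decide) (by decide)
  have g8 : s1.v 8 = s.v 8 := by rw [hag1.1 8 (by decide)]; simp
  have g10 : s1.v 10 = s.v 10 := by rw [hag1.1 10 (by decide)]; simp
  refine Spec.assign_seq (by norm_num) (fun hB => ⟨trivial, hB.v_lt 10 (by norm_num)⟩) ?_
  refine Spec.assign_seq (by norm_num) (fun hB => ⟨trivial, hB.v_lt 5 (by norm_num)⟩) ?_
  refine Spec.assign_seq (by norm_num) (fun hB => ⟨trivial, hB.v_lt 6 (by norm_num)⟩) ?_
  simp only [Expr.eval, Store.setv_v, show (5 : ℕ) ≠ 15 by decide, show (6 : ℕ) ≠ 16 by decide,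
    show (6 : ℕ) ≠ 15 by decide, if_false, env1.v5, env1.v6, g10]
  set t := ((s1.setv 15 (s.v 10)).setv 16 (Nat.fib (n + 1))).setv 17 (Nat.fib n) with htdef
  have envt : EnvFull n e t :=
    ((env1.setv (by norm_num)).setv (by norm_num)).setv (by norm_num)
  have bt : BestOk n e t := b1
  have t8 : t.v 8 = s.v 8 := by simp [htdef, g8]
  have hrep : ConflictRep n t
      ((unrank n (n / 256) (s.v 9), Nat.fib (n + 1), Nat.fib n), s.v 10) :=
    ⟨h1, by simp [htdef], by simp [htdef], by simp [htdef]⟩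
  clear_value t
  refine Spec.seq (by rfl) (conflictC_spec envt hrep) (fun s2 hag2 h2 => ?_)
  have env2 : EnvFull n e s2 := envt.agree hag2 (by decide) (by decide)
  have b2 : BestOk n e s2 := bt.agree hag2 (by decide) (by decide)
  have k8 : s2.v 8 = s.v 8 := by rw [hag2.1 8 (by decide), t8]
  have hst := h2.1
  refine Spec.seq (by rfl) (classesC_spec env2 ht hO hOc
    ((conflictFree_conflictAll ht _).congr hst)
    (fun hcons r => Nat.le_of_lt_succ (card_inter_cls_lt ht hO hcons hMO hM r)))
    (fun s3 hag3 h3 => ?_)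
  have env3 : EnvFull n e s3 := env2.agree hag3 (by decide) (by decide)
  have b3 : BestOk n e s3 := b2.agree hag3 (by decide) (by decide)
  have m8 : s3.v 8 = s.v 8 := by rw [hag3.1 8 (by decide), k8]
  refine (recordC_spec env3.toEnv h3.1 b3).mono fun s4 h4 => ⟨h4.1, m8 ▸ h4.2.1, fun hg => ?_⟩
  obtain ⟨h5, h6⟩ := h3.2 (Consistent.congr hg hst)
  exact h6.trans (h4.2.2 h5)

/-- The two loops reach the good pair of counters at some time, and the recorded size never
decreases afterwards. -/
theorem searchC_spec (h : EnvFull n e s) (ht : IsTour n e) (hb : BestOk n e s) {O : Finset ℕ}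
    (hO : O ⊆ range n) (hOc : NoCyc e O) :
    Spec n (loopBound n) searchC s (fun s' => BestOk n e s' ∧ O.card ≤ s'.v 8) := by
  obtain ⟨M, hMO, hMc, hM⟩ := exists_sparse_subset ht hO hOc (L := 256) (by norm_num)
  obtain ⟨g₁, hg₁, g₂, hg₂, hg⟩ := exists_good ht hOc hMO hMc
  refine Spec.loop (fun i s' => BestOk n e s' ∧ (g₁ < i → O.card ≤ s'.v 8)) (by rfl)
    (by rw [h.v4]; rfl) ⟨hb, by simp⟩ ?_ (fun s1 hag hs1 => ?_)
  swap
  · rw [h.v4] at hs1 ⊢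
    exact ⟨hs1.1, by simpa using hs1.2 hg₁⟩
  intro i s1 hi hag1 hs1
  have env1 : EnvFull n e (s1.setv 9 i) := (h.agree hag1 (by decide) (by decide)).setv
    (by norm_num)
  replace hs1 : BestOk n e (s1.setv 9 i) ∧ (g₁ < i → O.card ≤ (s1.setv 9 i).v 8) :=
    ⟨hs1.1, by simpa using hs1.2⟩
  have e9 : (s1.setv 9 i).v 9 = i := by simp
  generalize s1.setv 9 i = t1 at *
  -- The premise says that the good pair lies lexicographically before the current one.
  refine Spec.loop (fun j s' => BestOk n e s' ∧ (g₁ < i ∨ g₁ = i ∧ g₂ < j → O.card ≤ s'.v 8))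
    (by rfl) (by rw [env1.v5]; rfl) ⟨hs1.1, fun h => hs1.2 (by omega)⟩ ?_
    (fun s2 hag hs2 => ?_)
  swap
  · rw [env1.v5] at hs2 ⊢
    refine ⟨hs2.1, fun h => ?_⟩
    simpa using hs2.2 (by omega)
  intro j s2 hj hag2 hs2
  have env2 : EnvFull n e (s2.setv 10 j) := (env1.agree hag2 (by decide) (by decide)).setv
    (by norm_num)
  have f9 : (s2.setv 10 j).v 9 = i := by simp [hag2.1 9 (by decide), e9]
  have f10 : (s2.setv 10 j).v 10 = j := by simp
  replace hs2 : BestOk n e (s2.setv 10 j) ∧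
      (g₁ < i ∨ g₁ = i ∧ g₂ < j → O.card ≤ (s2.setv 10 j).v 8) := ⟨hs2.1, by simpa using hs2.2⟩
  generalize s2.setv 10 j = t2 at *
  refine (branchC_spec env2 ht hs2.1 hO hOc hMO hM).mono fun s3 h3 => ⟨h3.1, fun hlt => ?_⟩
  by_cases hold : g₁ < i ∨ g₁ = i ∧ g₂ < j
  · exact (hs2.2 hold).trans h3.2.1
  · obtain ⟨rfl, rfl⟩ : g₁ = i ∧ g₂ = j := by omega
    exact h3.2.2 (by rw [f9, f10]; exact hg)

end

end TransitiveSearch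

/-! ### Verification of the initialization and the output -/

namespace TransitiveSearch

open LoopLang Finset

section

variable {n : ℕ} {e : ℕ → ℕ → Prop} {s s' : Store} {c : Cmd} {Q : Store → Prop}

theorem fib_succ_le_two_pow (n : ℕ) : Nat.fib (n + 1) ≤ 2 ^ n := by
  induction n with
  | zero => simp
  | succ n ih =>
    rw [Nat.fib_add_two, pow_succ]
    have := Nat.fib_le_fib_succ (n := n)
    omega

theorem tableC_spec (h : Env n e s) (h1 : s.v 1 = n + 1) (h2 : s.v 2 = n + 257) :
    Spec n (loopBound n) tableC s (fun s' => ∀ r < n + 1, ∀ b < n + 257,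
      s'.a 1 (r * (n + 257) + b) = subCount r b) := by
  refine Spec.loop (fun i s' => ∀ r < i, ∀ b < n + 257,
      s'.a 1 (r * (n + 257) + b) = subCount r b) (by rfl) (by rw [h1]; rfl) (by simp) ?_
    (fun s1 hag hs1 => by rw [h1] at hs1; exact hs1)
  intro r s1 hr hag1 hs1
  rw [h1] at hr
  have env1 : Env n e (s1.setv 22 r) := (h.agree hag1 (by decide) (by decide)).setv (by norm_num)
  have e2 : (s1.setv 22 r).v 2 = n + 257 := by simp [hag1.1 2 (by decide), h2]
  have e22 : (s1.setv 22 r).v 22 = r := by simp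
  replace hs1 : ∀ r' < r, ∀ b < n + 257,
    (s1.setv 22 r).a 1 (r' * (n + 257) + b) = subCount r' b := hs1
  generalize s1.setv 22 r = t1 at *
  refine Spec.loop (fun i s' => (∀ r' < r, ∀ b < n + 257,
      s'.a 1 (r' * (n + 257) + b) = subCount r' b) ∧
      ∀ b < i, s'.a 1 (r * (n + 257) + b) = subCount r b) (by rfl) (by rw [e2]; rfl)
    ⟨hs1, by simp⟩ ?_ (fun s2 hag hs2 => ?_)
  swap
  · rw [e2] at hs2 ⊢
    intro r' hr'
    rcases Nat.lt_succ_iff_lt_or_eq.mp hr' with h3 | rfl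
    exacts [hs2.1 r' h3, hs2.2]
  rintro b s2 hb hag2 ⟨i1, i2⟩
  rw [e2] at hb
  have f2 : (s2.setv 20 b).v 2 = n + 257 := by simp [hag2.1 2 (by decide), e2]
  have f22 : (s2.setv 20 b).v 22 = r := by simp [hag2.1 22 (by decide), e22]
  have f20 : (s2.setv 20 b).v 20 = b := by simp
  replace i1 : ∀ r' < r, ∀ b' < n + 257,
    (s2.setv 20 b).a 1 (r' * (n + 257) + b') = subCount r' b' := i1
  replace i2 : ∀ b' < b, (s2.setv 20 b).a 1 (r * (n + 257) + b') = subCount r b' := i2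
  generalize s2.setv 20 b = t2 at *
  have post : ∀ m, m = subCount r b → (∀ r' < r, ∀ b' < n + 257,
      (t2.seta 1 (r * (n + 257) + b) m).a 1 (r' * (n + 257) + b') = subCount r' b') ∧
      ∀ b' < b + 1, (t2.seta 1 (r * (n + 257) + b) m).a 1 (r * (n + 257) + b') =
        subCount r b' := by
    rintro m rfl
    constructor
    · intro r' hr' b' hb'
      rw [Store.seta_a, if_neg, i1 r' hr' b' hb']
      rintro ⟨-, h⟩
      have := index_inj hb' hb h
      omega
    · intro b' hb'
      rw [Store.seta_a]
      split_ifs with h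
      · rw [show b' = b by omega]
      · exact i2 b' (by omega)
  refine Spec.ite (fun _ => ⟨trivial, trivial⟩) (fun hc => ?_) (fun hc => ?_)
  · simp only [Expr.eval, f20, f22, mul_ne_zero_iff] at hc
    obtain ⟨r', rfl⟩ : ∃ r', r = r' + 1 := ⟨r - 1, by omega⟩
    obtain ⟨b', rfl⟩ : ∃ b', b = b' + 1 := ⟨b - 1, by omega⟩
    have v1 := i1 r' (by omega) (b' + 1) hb
    have v2 := i1 r' (by omega) b' (by omega)
    refine Spec.store (fun _ => ⟨⟨⟨trivial, trivial⟩, trivial⟩, ⟨⟨⟨⟨⟨trivial, trivial⟩, trivial⟩,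
      trivial⟩, ?_⟩, ⟨⟨⟨⟨trivial, trivial⟩, trivial⟩, ⟨trivial, trivial⟩⟩, ?_⟩⟩, ?_, ?_⟩) ?_
    · simp only [Expr.eval, f2, f20, f22, Nat.add_sub_cancel]
      exact valid_table (by omega) hb
    · simp only [Expr.eval, f2, f20, f22, Nat.add_sub_cancel]
      exact valid_table (by omega) (by omega)
    · simp only [Expr.eval, f2, f20, f22]
      exact valid_table hr hb
    · simp only [tableE, Expr.eval, f2, f20, f22, Nat.add_sub_cancel, v1, v2]
      refine two_pow_lt_bits ((subCount_le_two_pow (r' + 1) (b' + 1)).trans ?_)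
      exact Nat.pow_le_pow_right (by norm_num) (by omega)
    · simp only [tableE, Expr.eval, f2, f20, f22, Nat.add_sub_cancel, v1, v2]
      exact post _ rfl
  · simp only [Expr.eval, f20, f22, mul_eq_zero] at hc
    refine Spec.store (fun _ => ⟨⟨⟨trivial, trivial⟩, trivial⟩, trivial, ?_, ?_⟩) ?_
    · simp only [Expr.eval, f2, f20, f22]
      exact valid_table hr hb
    · exact lt_bits (by simp [Expr.eval])
    · simp only [Expr.eval, f2, f20, f22]
      refine post _ ?_
      rcases hc with rfl | rfl
      · rfl
      · exact (subCount_zero_right r).symm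

theorem fibC_spec (h : Env n e s) :
    Spec n (loopBound n) fibC s (fun s' => s'.v 5 = Nat.fib (n + 1) ∧ s'.v 6 = Nat.fib n) := by
  refine Spec.assign_seq (by norm_num) (fun _ => ⟨trivial, lt_bits (by simp [Expr.eval])⟩) ?_
  refine Spec.assign_seq (by norm_num) (fun _ => ⟨trivial, lt_bits (by simp [Expr.eval])⟩) ?_
  have env : Env n e ((s.setv 5 (Expr.eval s (.lit 1))).setv 6
      (Expr.eval (s.setv 5 (Expr.eval s (.lit 1))) (.lit 0))) :=
    (h.setv (by norm_num)).setv (by norm_num)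
  refine Spec.loop (fun i s' => s'.v 5 = Nat.fib (i + 1) ∧ s'.v 6 = Nat.fib i) (by rfl)
    (by rw [env.v0]; rfl) (by simp [Expr.eval]) ?_
    (fun s2 hag hs2 => by rw [env.v0] at hs2 ⊢; simpa using hs2)
  rintro i s1 hi hag ⟨i5, i6⟩
  rw [env.v0] at hi
  refine Spec.assign_seq (by norm_num) (fun hB => ⟨trivial, hB.v_lt 5 (by norm_num)⟩) ?_
  refine Spec.assign_seq (by norm_num) (fun _ => ⟨⟨trivial, trivial⟩, ?_⟩) ?_
  · refine two_pow_lt_bits ?_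
    simp [Expr.eval, i5, i6]
    rw [add_comm, ← Nat.fib_add_two]
    exact (fib_succ_le_two_pow (i + 1)).trans (Nat.pow_le_pow_right (by norm_num) (by omega))
  refine Spec.assign (fun hB => ⟨trivial, hB.v_lt 14 (by norm_num)⟩) ?_
  simp [Expr.eval, i5, i6]
  rw [add_comm, ← Nat.fib_add_two]

theorem sparseC_spec (h : Env n e s) :
    Spec n (loopBound n) sparseC s (fun s' => s'.v 3 = n / 256) := by
  refine Spec.assign_seq (by norm_num) (fun _ => ⟨trivial, lt_bits (by simp [Expr.eval])⟩) ?_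
  have env : Env n e (s.setv 3 (Expr.eval s (.lit 0))) := h.setv (by norm_num)
  -- The quotient grows by at most one per pass, and `n` passes suffice since `n / 256 ≤ n`.
  refine Spec.loop (fun i s' => s'.v 3 = min i (n / 256)) (by rfl)
    (by rw [env.v0]; rfl) (by simp [Expr.eval]) ?_
    (fun s2 hag hs2 => by
      rw [env.v0] at hs2 ⊢
      simp only [Store.setv_v, show (3 : ℕ) ≠ 13 by decide, if_false]
      omega)
  intro i s1 hi hag hs1
  rw [env.v0] at hi
  have e0 : s1.v 0 = n := (env.agree hag (by decide) (by decide)).v0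
  have hcond : (Expr.sub (.add (.var 0) (.lit 1))
      (.mul (.add (.var 3) (.lit 1)) (.lit 256))).eval (s1.setv 13 i) =
        n + 1 - (s1.v 3 + 1) * 256 := by
    simp [Expr.eval, e0]
  refine Spec.when (fun _ => ⟨⟨trivial, trivial⟩, ⟨trivial, trivial⟩, trivial⟩) (fun hc => ?_)
    (fun hc => ?_)
  · rw [hcond] at hc
    refine Spec.assign (fun _ => ⟨⟨trivial, trivial⟩, lt_bits ?_⟩) ?_
    · simp [Expr.eval, hs1]; omega
    · simp [Expr.eval]; omega
  · rw [hcond] at hc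
    simp only [Store.setv_v, show (3 : ℕ) ≠ 13 by decide, if_false]
    omega

theorem initC_spec (h : Env n e s) :
    Spec n (loopBound n) initC s (fun s' => EnvFull n e s') := by
  refine Spec.assign_seq (by norm_num) (fun _ => ⟨⟨trivial, trivial⟩, lt_bits ?_⟩) ?_
  · simp [Expr.eval, h.v0]
  refine Spec.assign_seq (by norm_num) (fun _ => ⟨⟨trivial, trivial⟩, lt_bits ?_⟩) ?_
  · simp [Expr.eval, h.v0]
  simp only [Expr.eval, Store.setv_v, show (0 : ℕ) ≠ 1 by decide, if_false, h.v0]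
  have env0 : Env n e ((s.setv 1 (n + 1)).setv 2 (n + 257)) :=
    (h.setv (by norm_num)).setv (by norm_num)
  refine Spec.seq (by rfl) (tableC_spec env0 (by simp) (by simp)) (fun s1 hag1 h1 => ?_)
  have env1 : Env n e s1 := env0.agree hag1 (by decide) (by decide)
  refine Spec.seq (by rfl) (fibC_spec env1) (fun s2 hag2 h2 => ?_)
  have env2 : Env n e s2 := env1.agree hag2 (by decide) (by decide)
  refine Spec.seq (by rfl) (sparseC_spec env2) (fun s3 hag3 h3 => ?_)
  have env3 : Env n e s3 := env2.agree hag3 (by decide) (by decide)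
  have e1 : s3.v 1 = n + 1 := by
    rw [hag3.1 1 (by decide), hag2.1 1 (by decide), hag1.1 1 (by decide)]; simp
  have e2 : s3.v 2 = n + 257 := by
    rw [hag3.1 2 (by decide), hag2.1 2 (by decide), hag1.1 2 (by decide)]; simp
  have e5 : s3.v 5 = Nat.fib (n + 1) := by rw [hag3.1 5 (by decide), h2.1]
  have e6 : s3.v 6 = Nat.fib n := by rw [hag3.1 6 (by decide), h2.2]
  have tab : ∀ r < n + 1, ∀ b < n + 257, s3.a 1 (r * (n + 257) + b) = subCount r b := by
    rw [hag3.2 1 (by decide), hag2.2 1 (by decide)]; exact h1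
  have v4 : (tableE (.var 0) (.var 3)).eval s3 = subCount n (n / 256) := by
    simp only [tableE, Expr.eval, env3.v0, e2, h3]
    exact tab n (by omega) _ (by omega)
  have v7 : ∀ m, (tableE (.var 0) (.lit 255)).eval (s3.setv 4 m) = subCount n 255 := by
    intro m
    simp only [tableE, Expr.eval, Store.setv_v, Store.setv_a, show (0 : ℕ) ≠ 4 by decide,
      show (2 : ℕ) ≠ 4 by decide, if_false, env3.v0, e2]
    exact tab n (by omega) _ (by omega)
  have small : ∀ b, subCount n b < 2 ^ bits n := fun b =>
    two_pow_lt_bits ((subCount_le_two_pow n b).trans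
      (Nat.pow_le_pow_right (by norm_num) (by omega)))
  refine Spec.assign_seq (by norm_num) (fun _ => ⟨⟨⟨⟨trivial, trivial⟩, trivial⟩, ?_⟩, ?_⟩) ?_
  · simp only [Expr.eval, env3.v0, e2, h3]
    exact valid_table (by omega) (by omega)
  · rw [v4]; exact small _
  refine Spec.assign (fun _ => ⟨⟨⟨⟨trivial, trivial⟩, trivial⟩, ?_⟩, ?_⟩) ?_
  · simp only [Expr.eval, Store.setv_v, show (0 : ℕ) ≠ 4 by decide,
      show (2 : ℕ) ≠ 4 by decide, if_false, env3.v0, e2]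
    exact valid_table (by omega) (by omega)
  · rw [v7]; exact small _
  rw [v4, v7]
  exact ⟨⟨(env3.setv (by norm_num)).setv (by norm_num), by simp [e2], tab⟩, by simp [e1],
    by simp [h3], by simp, by simp [e5], by simp [e6], by simp⟩

/-- The output overwrites the beginning of the matrix, which is no longer needed. It is
complemented, since array `6` holds the vertices that stay. -/
theorem outputC_spec (h : Env n e s) :
    Spec n (loopBound n) outputC s (fun s' => ∀ j < n, s'.a 0 j = 1 - s.a 6 j) := by
  refine Spec.loop (fun i s' => ∀ j < i, s'.a 0 j = 1 - s.a 6 j) (by rfl) (by rw [h.v0]; rfl)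
    (by simp) ?_ (fun s1 hag hs1 => by rw [h.v0] at hs1; exact hs1)
  intro i s1 hi hag hs1
  rw [h.v0] at hi
  have a6 : s1.a 6 = s.a 6 := hag.2 6 (by decide)
  refine Spec.store (fun _ => ⟨trivial, ⟨trivial, trivial, ?_⟩, ?_, lt_bits ?_⟩) ?_
  · simpa [Expr.eval] using valid_vec (k := 6) hi (by norm_num) (by norm_num)
  · simp only [Expr.eval, Store.setv_v, if_true]
    exact Or.inl ⟨rfl, by nlinarith⟩
  · simp only [Expr.eval]; omega
  · intro j hj
    simp only [Expr.eval, Store.seta_a, Store.setv_v, if_true, true_and, Store.setv_a, a6]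
    split_ifs with hji
    · rw [hji]
    · exact hs1 j (by omega)

theorem mainC_spec (h : Env n e s) (ht : IsTour n e) (hb : BestOk n e s) {O : Finset ℕ}
    (hO : O ⊆ range n) (hOc : NoCyc e O) :
    Spec n (loopBound n) mainC s (fun s' => ∃ B : ℕ → ℕ, (∀ j < n, B j ≤ 1) ∧
      NoCyc e (supp n B) ∧ O.card ≤ ∑ j ∈ range n, B j ∧ ∀ j < n, s'.a 0 j = 1 - B j) := by
  refine Spec.seq (by rfl) (initC_spec h) (fun s1 hag1 env1 => ?_)
  have b1 : BestOk n e s1 := hb.agree hag1 (by decide) (by decide)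
  refine Spec.seq (by rfl) (searchC_spec env1 ht b1 hO hOc) (fun s2 hag2 h2 => ?_)
  have env2 : Env n e s2 := env1.toEnv.agree hag2 (by decide) (by decide)
  obtain ⟨⟨h3, h4, h5⟩, h6⟩ := h2
  exact (outputC_spec env2).mono fun s3 hs3 => ⟨s2.a 6, h3, h4, h5 ▸ h6, hs3⟩

end

/-! #### Resource bounds -/

/-- `f` is bounded by a polynomial. -/
def PolyBounded (f : ℕ → ℕ) : Prop := ∃ P : Polynomial ℕ, ∀ n, f n ≤ P.eval n

theorem PolyBounded.const (c : ℕ) : PolyBounded fun _ => c := ⟨.C c, by simp⟩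

theorem PolyBounded.id : PolyBounded fun n => n := ⟨.X, by simp⟩

theorem PolyBounded.add {f g : ℕ → ℕ} (hf : PolyBounded f) (hg : PolyBounded g) :
    PolyBounded fun n => f n + g n := by
  obtain ⟨P, hP⟩ := hf
  obtain ⟨R, hR⟩ := hg
  exact ⟨P + R, fun n => by simpa using Nat.add_le_add (hP n) (hR n)⟩

theorem PolyBounded.mul {f g : ℕ → ℕ} (hf : PolyBounded f) (hg : PolyBounded g) :
    PolyBounded fun n => f n * g n := by
  obtain ⟨P, hP⟩ := hf
  obtain ⟨R, hR⟩ := hg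
  exact ⟨P * R, fun n => by simpa using Nat.mul_le_mul (hP n) (hR n)⟩

theorem PolyBounded.pow {f : ℕ → ℕ} (hf : PolyBounded f) (k : ℕ) :
    PolyBounded fun n => f n ^ k := by
  obtain ⟨P, hP⟩ := hf
  exact ⟨P ^ k, fun n => by simpa using Nat.pow_le_pow_left (hP n) k⟩

theorem PolyBounded.mono {f g : ℕ → ℕ} (hg : PolyBounded g) (h : ∀ n, f n ≤ g n) :
    PolyBounded f := by
  obtain ⟨P, hP⟩ := hg
  exact ⟨P, fun n => (h n).trans (hP n)⟩

theorem polyBounded_bits : PolyBounded bits :=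
  ((PolyBounded.const 2).mul .id).add (.const 40)

theorem polyBounded_regBits : PolyBounded regBits := polyBounded_bits.mul (.const 64)

theorem polyBounded_unit : PolyBounded unit :=
  ((PolyBounded.const 1).add polyBounded_regBits).pow 2

theorem polyBounded_memLen : PolyBounded memLen :=
  (PolyBounded.id.mul .id).add ((PolyBounded.const 6).mul
    ((PolyBounded.id.add (.const 1)).mul (PolyBounded.id.add (.const 257))))

theorem polyBounded_spaceBound : PolyBounded spaceBound :=
  ((PolyBounded.const _).mul ((PolyBounded.const _).add polyBounded_regBits)).add
    (polyBounded_memLen.mul (polyBounded_memLen.add polyBounded_bits))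

/-- The variables that bound loops are among those with polynomial bounds. -/
def polyLoops : Cmd → Bool
  | .skip => true
  | .assign _ _ => true
  | .store _ _ _ => true
  | .seq c d => polyLoops c && polyLoops d
  | .ite _ c d => polyLoops c && polyLoops d
  | .loop _ y c => (y = 0 || y = 1 || y = 2 || y = 7) && polyLoops c

/-- The loop over small subsets also counts as polynomial, since `subCount n 255` is at most `(n +
1) ^ 255`. -/
theorem polyBounded_costBound (c : Cmd) (hc : polyLoops c = true) :
    PolyBounded fun n => c.costBound (loopBound n) := by
  induction c with
  | skip => exact .const 1
  | assign _ _ => exact .const 1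
  | store _ _ _ => exact .const 1
  | seq c d ihc ihd =>
    simp only [polyLoops, Bool.and_eq_true] at hc
    exact (ihc hc.1).add (ihd hc.2)
  | ite _ c d ihc ihd =>
    simp only [polyLoops, Bool.and_eq_true] at hc
    exact (PolyBounded.const 1).add ((ihc hc.1).add (ihd hc.2))
  | loop _ y c ih =>
    simp only [polyLoops, Bool.and_eq_true, Bool.or_eq_true, decide_eq_true_eq] at hc
    refine (PolyBounded.const 1).add (PolyBounded.mul ?_ ((ih hc.2).add (.const 1)))
    rcases hc.1 with ((rfl | rfl) | rfl) | rfl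
    · exact .id
    · exact PolyBounded.id.add (.const 1)
    · exact PolyBounded.id.add (.const 257)
    · exact ((PolyBounded.id.add (.const 1)).pow 255).mono fun n => subCount_le_pow n 255

theorem exists_costBound_mainC : ∃ P : Polynomial ℕ, ∀ n,
    unitsPerCmd * mainC.costBound (loopBound n) * unit n ≤
      P.eval n * (subCount n (n / 256) * Nat.fib (n + 1)) := by
  have hB := polyBounded_costBound branchC (by decide)
  have hI := polyBounded_costBound initC (by decide)
  have hO := polyBounded_costBound outputC (by decide)
  -- Only the two outer loops of the search have exponential bounds `a` and `b`. The summand 4 pays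
  -- for their overhead `1 + 2 * a + a * b ≤ 4 * (a * b)`.
  obtain ⟨P, hP⟩ := ((PolyBounded.const unitsPerCmd).mul
    ((hI.add (hO.add hB)).add (.const 4))).mul polyBounded_unit
  refine ⟨P, fun n => le_trans ?_ (Nat.mul_le_mul_right _ (hP n))⟩
  beta_reduce
  have h1 := subCount_pos n (n / 256)
  have h2 : 0 < Nat.fib (n + 1) := Nat.fib_pos.mpr (by omega)
  have hcost : mainC.costBound (loopBound n) = initC.costBound (loopBound n) +
      ((1 + subCount n (n / 256) * ((1 + Nat.fib (n + 1) *
        (branchC.costBound (loopBound n) + 1)) + 1)) + outputC.costBound (loopBound n)) := rfl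
  rw [hcost]
  generalize initC.costBound (loopBound n) = I
  generalize branchC.costBound (loopBound n) = B
  generalize outputC.costBound (loopBound n) = O
  generalize subCount n (n / 256) = a at *
  generalize Nat.fib (n + 1) = b at *
  have h3 : a ≤ a * b := Nat.le_mul_of_pos_right a h2
  have key : I + (1 + a * (1 + b * (B + 1) + 1) + O) ≤ (I + (O + B) + 4) * (a * b) := by
    have h4 : I ≤ I * (a * b) := Nat.le_mul_of_pos_right I (by omega)
    have h5 : O ≤ O * (a * b) := Nat.le_mul_of_pos_right O (by omega)
    have h6 : a * (1 + b * (B + 1) + 1) = 2 * a + B * (a * b) + a * b := by ring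
    have h7 : (I + (O + B) + 4) * (a * b) =
      I * (a * b) + O * (a * b) + B * (a * b) + 4 * (a * b) := by ring
    omega
  calc unitsPerCmd * (I + (1 + a * (1 + b * (B + 1) + 1) + O)) * unit n
      ≤ unitsPerCmd * ((I + (O + B) + 4) * (a * b)) * unit n :=
        Nat.mul_le_mul_right _ (Nat.mul_le_mul_left _ key)
    _ = _ := by ring

/-! ### Bases of the exponential factors -/

/-- The base slightly exceeds the golden ratio, so its square is at least its successor. -/
theorem fib_succ_le_pow (n : ℕ) : (Nat.fib (n + 1) : ℝ) ≤ (1.6181 : ℝ) ^ n := by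
  have : (Nat.fib (n + 1) : ℝ) ≤ (1.6181 : ℝ) ^ n ∧
      (Nat.fib (n + 2) : ℝ) ≤ (1.6181 : ℝ) ^ (n + 1) := by
    induction n with
    | zero => norm_num
    | succ n ih =>
      refine ⟨ih.2, ?_⟩
      rw [Nat.fib_add_two (n := n + 1)]
      push_cast
      have h1 : (0 : ℝ) ≤ (1.6181 : ℝ) ^ n := by positivity
      have h2 : (1.6181 : ℝ) ^ (n + 1) = 1.6181 ^ n * 1.6181 := pow_succ _ _
      have h3 : (1.6181 : ℝ) ^ (n + 1 + 1) = 1.6181 ^ n * 1.6181 * 1.6181 := by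
        rw [pow_succ, pow_succ]
      rw [h3]
      have := ih.1
      have := ih.2
      rw [h2] at this
      nlinarith
  exact this.1

/-- The weight bound with `y = 64`: the factor `1 + 1 / y` is small, and so is the 256th root of
`y`, which lies below 1.0164. -/
theorem subCount_sparse_le (n : ℕ) :
    (subCount n (n / 256) : ℝ) ≤ (65 / 64 * 1.0164 : ℝ) ^ n := by
  have h1 := subCount_le_weight n (n / 256) (y := 64) (by norm_num)
  have h2 : (64 : ℝ) ^ (n / 256) ≤ (1.0164 : ℝ) ^ n := by
    have h3 : (64 : ℝ) ≤ (1.0164 : ℝ) ^ 256 := by norm_num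
    calc (64 : ℝ) ^ (n / 256) ≤ ((1.0164 : ℝ) ^ 256) ^ (n / 256) :=
          pow_le_pow_left₀ (by norm_num) h3 _
      _ = (1.0164 : ℝ) ^ (256 * (n / 256)) := (pow_mul _ _ _).symm
      _ ≤ (1.0164 : ℝ) ^ n := pow_le_pow_right₀ (by norm_num) (Nat.mul_div_le n 256)
  refine h1.trans ?_
  rw [mul_pow]
  have h4 : (1 + 1 / 64 : ℝ) = 65 / 64 := by norm_num
  rw [h4]
  exact mul_le_mul_of_nonneg_left h2 (by positivity)

theorem exists_eval_le_pow (P : Polynomial ℕ) {ρ : ℝ} (hρ : 1 < ρ) :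
    ∃ C : ℝ, ∀ n : ℕ, ((P.eval n : ℕ) : ℝ) ≤ C * ρ ^ n := by
  induction P using Polynomial.induction_on' with
  | add P R hP hR =>
    obtain ⟨C, hC⟩ := hP
    obtain ⟨D, hD⟩ := hR
    refine ⟨C + D, fun n => ?_⟩
    rw [Polynomial.eval_add, Nat.cast_add, add_mul]
    exact add_le_add (hC n) (hD n)
  | monomial k a =>
    obtain ⟨C, hC⟩ := (tendsto_pow_const_div_const_pow_of_one_lt k hρ).bddAbove_range
    refine ⟨a * C, fun n => ?_⟩
    have h1 : (n : ℝ) ^ k / ρ ^ n ≤ C := hC ⟨n, rfl⟩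
    rw [div_le_iff₀ (by positivity)] at h1
    rw [Polynomial.eval_monomial, Nat.cast_mul, Nat.cast_pow, mul_assoc]
    exact mul_le_mul_of_nonneg_left h1 (by positivity)

/-- The three bases multiply to less than 1.6705, and the polynomial factor is bounded by a constant
times a power of the ratio `1.6740 / 1.6705 > 1`. -/
theorem exists_time_bound : ∃ C : ℝ, ∀ n : ℕ,
    ((unitsPerCmd * mainC.costBound (loopBound n) * unit n : ℕ) : ℝ) ≤ C * (1.6740 : ℝ) ^ n := by
  obtain ⟨P, hP⟩ := exists_costBound_mainC
  obtain ⟨C, hC⟩ := exists_eval_le_pow P (ρ := 1.6740 / 1.6705) (by norm_num)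
  refine ⟨C, fun n => ?_⟩
  have h1 : ((unitsPerCmd * mainC.costBound (loopBound n) * unit n : ℕ) : ℝ) ≤
      ((P.eval n : ℕ) : ℝ) * ((subCount n (n / 256) : ℝ) * (Nat.fib (n + 1) : ℝ)) := by
    exact_mod_cast hP n
  have h2 : (subCount n (n / 256) : ℝ) * (Nat.fib (n + 1) : ℝ) ≤ (1.6705 : ℝ) ^ n := by
    calc (subCount n (n / 256) : ℝ) * (Nat.fib (n + 1) : ℝ)
        ≤ (65 / 64 * 1.0164 : ℝ) ^ n * (1.6181 : ℝ) ^ n :=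
          mul_le_mul (subCount_sparse_le n) (fib_succ_le_pow n) (by positivity) (by positivity)
      _ = (65 / 64 * 1.0164 * 1.6181 : ℝ) ^ n := (mul_pow _ _ _).symm
      _ ≤ (1.6705 : ℝ) ^ n := pow_le_pow_left₀ (by norm_num) (by norm_num) n
  calc _ ≤ ((P.eval n : ℕ) : ℝ) * (1.6705 : ℝ) ^ n :=
        h1.trans (mul_le_mul_of_nonneg_left h2 (by positivity))
    _ ≤ C * (1.6740 / 1.6705 : ℝ) ^ n * (1.6705 : ℝ) ^ n :=
        mul_le_mul_of_nonneg_right (hC n) (by positivity)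
    _ = C * (1.6740 : ℝ) ^ n := by
        rw [mul_assoc, ← mul_pow]; norm_num

end TransitiveSearch

namespace TransitiveSearch

open LoopLang Finset RAM

/-! ### Feedback vertex sets of tournaments -/

section

variable {n : ℕ} (T : Tournament (Fin n))

/-- The arc relation on natural numbers. -/
def arc (u w : ℕ) : Prop := ∃ (hu : u < n) (hw : w < n), T.Adj ⟨u, hu⟩ ⟨w, hw⟩

theorem adj_asymm {u w : Fin n} (h : T.Adj u w) : ¬ T.Adj w u := by
  intro h'
  have hne : u ≠ w := by rintro rfl; exact T.loopless _ h
  rcases T.exactly_one u w hne with ⟨-, h1⟩ | ⟨-, h1⟩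
  exacts [h1 h', h1 h]

theorem isTour_arc : IsTour n (arc T) where
  asymm := by
    rintro u w ⟨hu, hw, h⟩ ⟨_, _, h'⟩
    exact adj_asymm T h h'
  total u w hu hw hne := by
    have hne' : (⟨u, hu⟩ : Fin n) ≠ ⟨w, hw⟩ := fun h => hne (Fin.mk.inj_iff.mp h)
    rcases T.exactly_one _ _ hne' with ⟨h, -⟩ | ⟨h, -⟩
    exacts [Or.inl ⟨hu, hw, h⟩, Or.inr ⟨hw, hu, h⟩]

/-- The vertices outside `F`, as natural numbers. -/
def rest (F : Finset (Fin n)) : Finset ℕ := Fᶜ.map Fin.valEmbedding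

theorem mem_rest {F : Finset (Fin n)} {u : ℕ} : u ∈ rest F ↔ ∃ hu : u < n, ⟨u, hu⟩ ∉ F := by
  simp only [rest, mem_map, mem_compl, Fin.valEmbedding_apply]
  constructor
  · rintro ⟨x, hx, rfl⟩; exact ⟨x.isLt, hx⟩
  · rintro ⟨hu, h⟩; exact ⟨⟨u, hu⟩, h, rfl⟩

theorem rest_subset (F : Finset (Fin n)) : rest F ⊆ range n := fun u hu => by
  obtain ⟨h, -⟩ := mem_rest.mp hu
  exact mem_range.mpr h

theorem card_rest (F : Finset (Fin n)) : (rest F).card + F.card = n := by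
  rw [rest, card_map, card_compl, Fintype.card_fin]
  have := card_le_univ F
  rw [Fintype.card_fin] at this
  omega

/-- A set of vertices of a tournament is a feedback vertex set if and only if it meets all
directed triangles. -/
theorem isFVS_iff (F : Finset (Fin n)) : T.IsFVS F ↔ NoCyc (arc T) (rest F) := by
  constructor
  · intro h u hu w hw a ha hc
    obtain ⟨hu', hu⟩ := mem_rest.mp hu
    obtain ⟨hw', hw⟩ := mem_rest.mp hw
    obtain ⟨ha', ha⟩ := mem_rest.mp ha
    obtain ⟨⟨_, _, h1⟩, ⟨_, _, h2⟩, ⟨_, _, h3⟩⟩ := hc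
    exact h ⟨u, hu'⟩ (((Relation.TransGen.single ⟨hu, hw, h1⟩).tail ⟨hw, ha, h2⟩).tail
      ⟨ha, hu, h3⟩)
  · intro h v hv
    -- Without triangles the arc relation is transitive on the remaining vertices, so every walk
    -- shortens to a single arc; a closed walk would become a loop.
    have key : ∀ x y, Relation.TransGen
        (fun a b => a ∈ {v | v ∉ F} ∧ b ∈ {v | v ∉ F} ∧ T.Adj a b) x y →
        x ∉ F ∧ y ∉ F ∧ T.Adj x y := by
      intro x y hxy
      induction hxy with
      | single h => exact h
      | @tail b c _ hbc ih =>
        refine ⟨ih.1, hbc.2.1, ?_⟩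
        obtain ⟨_, _, h3⟩ := h.trans (isTour_arc T) (rest_subset F)
          (mem_rest.mpr ⟨x.isLt, ih.1⟩) (mem_rest.mpr ⟨b.isLt, ih.2.1⟩)
          (mem_rest.mpr ⟨c.isLt, hbc.2.1⟩) ⟨x.isLt, b.isLt, ih.2.2⟩ ⟨b.isLt, c.isLt, hbc.2.2⟩
        exact h3
    exact T.loopless v (key v v hv).2.2

theorem exists_isMinimumFVS : ∃ F, T.IsMinimumFVS F := by
  classical
  have hne : (univ.filter fun F : Finset (Fin n) => T.IsFVS F).Nonempty := by
    refine ⟨univ, mem_filter.mpr ⟨mem_univ _, ?_⟩⟩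
    rw [isFVS_iff]
    intro u hu
    obtain ⟨_, h⟩ := mem_rest.mp hu
    exact absurd (mem_univ _) h
  obtain ⟨F, hF, hmin⟩ := exists_min_image _ card hne
  exact ⟨F, (mem_filter.mp hF).2, fun F' hF' => hmin F' (mem_filter.mpr ⟨mem_univ _, hF'⟩)⟩

/-- The store that the input represents. -/
noncomputable def inputStore : Store where
  v := (input T).reg
  a k i := (input T).mem (addr n k i)

open Classical in
theorem input_mem (a : ℕ) : (input T).mem a =
    if ∃ i j : Fin n, a = i.val * n + j.val ∧ T.Adj i j then 1 else 0 := rfl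

theorem input_reg (x : ℕ) : (input T).reg x = if x = 0 then n else 0 := by
  simp only [input, Finsupp.single_apply, eq_comm]

theorem input_mem_eq_zero {a : ℕ} (ha : n * n ≤ a) : (input T).mem a = 0 := by
  rw [input_mem, if_neg]
  rintro ⟨i, j, rfl, -⟩
  have := index_lt i.isLt j.isLt
  omega

theorem represents_input : Represents n (inputStore T) (input T) where
  fits :=
    { reg_lt := fun i => by
        rw [input_reg]
        exact lt_regBits (lt_bits (by split_ifs <;> omega))
      reg_zero := fun i hi => by
        rw [input_reg, if_neg]
        rintro rfl
        exact absurd hi (by norm_num)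
      mem_lt := fun a => by
        rw [input_mem]
        exact lt_bits (by split_ifs <;> omega)
      mem_zero := fun a ha => input_mem_eq_zero T (by unfold memLen at ha; omega) }
  reg_eq _ _ := rfl
  mem_eq _ _ _ := rfl
  v_lt x _ := by
    show (input T).reg x < _
    rw [input_reg]
    exact lt_bits (by split_ifs <;> omega)
  v_zero := by
    show (input T).reg 0 = n
    rw [input_reg, if_pos rfl]

theorem env_input : Env n (arc T) (inputStore T) where
  v0 := (represents_input T).v_zero
  mat i hi j hj := by
    show (input T).mem (i * n + j) = _
    rw [input_mem]
    have key : (∃ i' j' : Fin n, i * n + j = i'.val * n + j'.val ∧ T.Adj i' j') ↔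
        arc T i j := by
      constructor
      · rintro ⟨i', j', h, h'⟩
        obtain ⟨rfl, rfl⟩ := index_inj hj j'.isLt h
        exact ⟨i'.isLt, j'.isLt, h'⟩
      · rintro ⟨hi', hj', h⟩
        exact ⟨⟨i, hi'⟩, ⟨j, hj'⟩, rfl, h⟩
    by_cases h : arc T i j
    · rw [if_pos h, if_pos (key.mpr h)]
    · rw [if_neg h, if_neg fun h' => h (key.mp h')]

theorem bestOk_input : BestOk n (arc T) (inputStore T) := by
  have h6 : ∀ j, (inputStore T).a 6 j = 0 := fun j => by
    -- All memory behind the matrix is initially 0, so the best solution starts as the empty set,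
    -- without explicit initialization.
    refine input_mem_eq_zero T ?_
    simp only [addr]; norm_num; omega
  refine ⟨fun j _ => by rw [h6]; omega, ?_, ?_⟩
  · intro u hu
    exact absurd (h6 u) (mem_supp.mp hu).2
  · rw [sum_congr rfl fun j _ => h6 j, sum_const_zero]
    show (input T).reg 8 = 0
    rw [input_reg, if_neg (by norm_num)]

end

end TransitiveSearch

open TransitiveSearch LoopLang in
/-- One program finds a minimum feedback vertex set of every tournament, in time `O(1.6740 ^ n)`
and in space polynomial in `n`, where `n` is the number of vertices. -/
theorem mainTheorem2 :
    ∃ (p : RAM.Prog) (C : ℝ) (S : Polynomial ℕ), ∀ (n : ℕ) (T : Tournament (Fin n)),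
      ∃ (s : RAM.State) (t m : ℕ) (F : Finset (Fin n)),
        RAM.Runs p (RAM.input T) s t m ∧ RAM.Outputs s F ∧ T.IsMinimumFVS F ∧
        (t : ℝ) ≤ C * (1.6740 : ℝ) ^ n ∧ m ≤ S.eval n := by
  obtain ⟨C, hC⟩ := exists_time_bound
  obtain ⟨S, hS⟩ := polyBounded_spaceBound
  refine ⟨mainC.comp, C, S, fun n T => ?_⟩
  obtain ⟨F₀, hF₀, hmin⟩ := exists_isMinimumFVS T
  have hrep := represents_input T
  -- Here `O` becomes the complement of a minimum feedback vertex set, so the set `B` that the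
  -- program finds is at least as large as that complement.
  obtain ⟨hsafe, hcost, B, hB1, hBc, hBO, hout⟩ := mainC_spec (env_input T) (isTour_arc T)
    (bestOk_input T) (rest_subset F₀) ((isFVS_iff T F₀).mp hF₀) hrep.bounded
  obtain ⟨σ, ⟨t, m, hrun, ht, hm⟩, hσ⟩ := mainC.comp_takes mainC_wf _ _ hrep hsafe
  set F : Finset (Fin n) := Finset.univ.filter fun i => B i = 0 with hF
  have hrest : rest F = supp n B := by
    ext u
    simp only [mem_rest, mem_supp, hF, Finset.mem_filter, Finset.mem_univ, true_and, exists_prop]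
  have hsum : ∑ j ∈ Finset.range n, B j = (supp n B).card := by
    rw [supp, Finset.card_filter]
    refine Finset.sum_congr rfl fun j hj => ?_
    have := hB1 j (Finset.mem_range.mp hj)
    split_ifs <;> omega
  refine ⟨σ, t, m, F, hrun, fun i => ?_, ⟨?_, fun F' hF' => ?_⟩, ?_, hm.trans (hS n)⟩
  · have h1 := hσ.mem_eq 0 i (Or.inl ⟨rfl, by have := i.isLt; nlinarith⟩)
    rw [addr, if_pos rfl] at h1
    rw [h1, hout i i.isLt]
    have := hB1 i i.isLt
    simp only [hF, Finset.mem_filter, Finset.mem_univ, true_and]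
    split_ifs <;> omega
  · rw [isFVS_iff, hrest]; exact hBc
  · refine le_trans ?_ (hmin F' hF')
    have h1 := card_rest F
    have h2 := card_rest F₀
    rw [hrest] at h1
    omega
  · refine le_trans ?_ (hC n)
    exact_mod_cast ht.trans (Nat.mul_le_mul_right _ (Nat.mul_le_mul_left _ hcost))
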